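/- **Setting.** Let $\beta,\gamma\in\mathbb R$, let $\theta:(0,\infty)\to\mathbb R$ satisfy (H1) $\theta\in L^\infty(0,\infty)$ and $|\theta(r)-1|\le c\,r$ for (almost) all $r>0$, for some $c>0$, and put $\Gamma_{\rm reg}(\mathbf y)=\beta+\frac{\gamma}{|\mathbf y|}\theta(|\mathbf y|)$ for $\mathbf y\in\mathbb R^3\setminus\{0\}$. Let $\hat f(p)=(2\pi)^{-d/2}\int e^{-ip\cdot x}f(x)\,dx$ be the unitary Fourier transform on $L^2(\mathbb R^d)$ and $\|f\|_{H^s}^2=\int(1+|p|^2)^s|\hat f(p)|^2\,dp$. For $\lambda>0$ and $\xi\in H^{1/2}(\mathbb R^3)$ let $$\Phi^\lambda(\xi)=\int d\mathbf p\,\sqrt{\tfrac34p^2+\lambda}\;|\hat\xi(\mathbf p)|^2-\frac1{\pi^2}\iint d\mathbf p\,d\mathbf p'\,\frac{\overline{\hat\xi(\mathbf p)}\,\hat\xi(\mathbf p')}{p^2+p'^2+\mathbf p\cdot\mathbf p'+\lambda}+\int d\mathbf y\,\Gamma_{\rm reg}(\mathbf y)|\xi(\mathbf y)|^2 .$$ Let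 $L^2_{\rm sym}(\mathbb R^6)=\{\psi\in L^2(\mathbb R^6):\psi(\mathbf x,\mathbf y)=\psi(-\mathbf x,\mathbf y)=\psi(\frac12\mathbf x+\mathbf y,\frac34\mathbf x-\frac12\mathbf y)\}$ and define $\mathcal G^\lambda\xi\in L^2(\mathbb R^6)$ by $$\widehat{\mathcal G^\lambda\xi}(\mathbf k,\mathbf p)=\sqrt{\frac2\pi}\;\frac{\hat\xi(\mathbf p)+\hat\xi(\mathbf k-\frac12\mathbf p)+\hat\xi(-\mathbf k-\frac12\mathbf p)}{k^2+\frac34p^2+\lambda}.$$ The energy form is $$F(\psi)=\int d\mathbf k\,d\mathbf p\,\big(k^2+\tfrac34p^2+\lambda\big)|\hat w^\lambda(\mathbf k,\mathbf p)|^2-\lambda\|\psi\|^2+12\pi\,\Phi^\lambda(\xi),\qquad \psi=w^\lambda+\mathcal G^\lambda\xi,$$ with domain $\mathcal D(F)=\{\psi\in L^2_{\rm sym}(\mathbb R^6):\psi=w^\lambda+\mathcal G^\lambda\xi,\ w^\lambda\in H^1(\mathbb R^6),\ \xi\in H^{1/2}(\mathbb R^3)\}$. A quadratic form $q$ with domain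 $D$ in a Hilbert space $H$ is called closed if $u_n\in D$, $u_n\to u$ in $H$ and $q(u_n-u_m)\to0$ as $n,m\to\infty$ imply $u\in D$ and $q(u_n-u)\to0$. **Theorem 2.1.** Assume (H1) and $\gamma>\gamma_c:=\frac{\sqrt3}{\pi}\Big(\frac{4\pi}{3\sqrt3}-1\Big)$. Then: (i) There are $\lambda_0>0$ and $c_0>0$ such that for every $\lambda>\lambda_0$ the form $\Phi^\lambda$ is well defined (all its integrals converge absolutely) and real-valued on $H^{1/2}(\mathbb R^3)$, is coercive, $\Phi^\lambda(\xi)\ge c_0\|\xi\|^2_{H^{1/2}}$ for all $\xi\in H^{1/2}(\mathbb R^3)$, satisfies $\Phi^\lambda(\xi)\le C_\lambda\|\xi\|^2_{H^{1/2}}$ for some $C_\lambda<\infty$ and all such $\xi$ (so that it is equivalent to the squared $H^{1/2}$ norm), and is closed in $L^2(\mathbb R^3)$ on the domain $H^{1/2}(\mathbb R^3)$. (ii) For every $\lambda>0$ the value $F(\psi)$ does not depend on the choice of the decomposition $\psi=w^\lambda+\mathcal G^\lambda\xi$, and $\mathcal D(F)$ and $F$ do not depend on $\lambda>0$. The form $F$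 with domain $\mathcal D(F)$ is real-valued, bounded from below (there is $m\in\mathbb R$ with $F(\psi)\ge m\|\psi\|^2$ for all $\psi\in\mathcal D(F)$) and closed in $L^2_{\rm sym}(\mathbb R^6)$. -/

import Mathlib

open MeasureTheory Filter Topology

noncomputable section

/-- Position or momentum space `ℝ³` with its Euclidean norm. -/
abbrev E3 : Type := EuclideanSpace ℝ (Fin 3)

/-- The space `ℝ⁶` of pairs of Jacobi coordinates `(x, y)` (or `(k, p)` in momentum space), with
its Euclidean norm; the two components of `q` are `q.fst` and `q.snd`. -/
abbrev E6 : Type := WithLp 2 (E3 × E3)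

/-- `L²(E)`, with complex values. -/
abbrev L2 (E : Type) [MeasureSpace E] : Type := Lp ℂ 2 (volume : Measure E)

section Fourier

variable {E : Type} [NormedAddCommGroup E] [InnerProductSpace ℝ E] [FiniteDimensional ℝ E]
  [MeasurableSpace E] [BorelSpace E]

/-- The unitary Fourier transform
`f̂(p) = (2π)^{-d/2} ∫ e^{-i p·x} f(x) dx` of `f ∈ L²(E)`, `d = dim E`, obtained by rescaling
Mathlib's Fourier–Plancherel transform `∫ e^{-2πi p·x} f(x) dx`. -/
def uFourier (f : L2 E) : E → ℂ := fun p =>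
  (((2 * Real.pi) ^ (-(Module.finrank ℝ E : ℝ) / 2) : ℝ) : ℂ) *
    (Lp.fourierTransformₗᵢ E ℂ f : L2 E) ((2 * Real.pi)⁻¹ • p)

theorem uFourier_add (f g : L2 E) :
    uFourier (f + g) =ᵐ[volume] fun p => uFourier f p + uFourier g p := by
  have h := (Measure.quasiMeasurePreserving_smul (volume : Measure E)
    (r := (2 * Real.pi)⁻¹) (by positivity)).ae
    (Lp.coeFn_add (Lp.fourierTransformₗᵢ E ℂ f) (Lp.fourierTransformₗᵢ E ℂ g))
  filter_upwards [h] with p hp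
  simp only [uFourier, map_add]
  rw [hp, Pi.add_apply, mul_add]

theorem uFourier_smul (c : ℂ) (f : L2 E) :
    uFourier (c • f) =ᵐ[volume] fun p => c * uFourier f p := by
  have h := (Measure.quasiMeasurePreserving_smul (volume : Measure E)
    (r := (2 * Real.pi)⁻¹) (by positivity)).ae
    (Lp.coeFn_smul c (Lp.fourierTransformₗᵢ E ℂ f))
  filter_upwards [h] with p hp
  simp only [uFourier, map_smul]
  rw [hp, Pi.smul_apply, smul_eq_mul]
  ring

variable (E) in
/-- The Sobolev space `H^s(E)`, `s ≥ 0`, as a subspace of `L²(E)`. -/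
def sobolev (s : ℝ) : Submodule ℂ (L2 E) where
  carrier := {f | TemperedDistribution.MemSobolev s 2 (Lp.toTemperedDistribution f)}
  add_mem' {f g} hf hg := by
    have := hf.add hg
    simpa only [Set.mem_ofPred_eq, ← Lp.toTemperedDistributionCLM_apply, map_add] using this
  zero_mem' := by
    have := TemperedDistribution.memSobolev_fun_zero E ℂ s 2
    simpa only [Set.mem_ofPred_eq, ← Lp.toTemperedDistributionCLM_apply, map_zero] using this
  smul_mem' c f hf := by
    have := hf.smul c
    simpa only [Set.mem_ofPred_eq, ← Lp.toTemperedDistributionCLM_apply, map_smul] using this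

/-- The square of the norm of `H^s(E)`: `‖f‖²_{H^s} = ∫ (1 + |p|²)^s |f̂(p)|² dp`. -/
def sobolevNormSq (s : ℝ) (f : L2 E) : ℝ :=
  ∫ p : E, (1 + ‖p‖ ^ 2) ^ s * ‖uFourier f p‖ ^ 2

end Fourier

section Symmetry

/-- Exchange of the particles 2 and 3: `(x, y) ↦ (-x, y)`. -/
def exch23 : E6 →ₗ[ℝ] E6 where
  toFun q := WithLp.toLp 2 (-q.fst, q.snd)
  map_add' a b := by
    apply WithLp.ofLp_injective
    ext1 <;> simp
    abel
  map_smul' c a := by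
    apply WithLp.ofLp_injective
    ext1 <;> simp

/-- Exchange of the particles 3 and 1 in position space: `(x, y) ↦ (x/2 + y, 3x/4 - y/2)`. -/
def exch31 : E6 →ₗ[ℝ] E6 where
  toFun q := WithLp.toLp 2
    ((1 / 2 : ℝ) • q.fst + q.snd, (3 / 4 : ℝ) • q.fst - (1 / 2 : ℝ) • q.snd)
  map_add' a b := by
    apply WithLp.ofLp_injective
    ext1 <;> simp <;> module
  map_smul' c a := by
    apply WithLp.ofLp_injective
    ext1 <;> simp <;> module

/-- Exchange of the particles 3 and 1 in momentum space: `(k, p) ↦ (k/2 + 3p/4, k - p/2)`. -/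
def exch31Momentum : E6 →ₗ[ℝ] E6 where
  toFun q := WithLp.toLp 2
    ((1 / 2 : ℝ) • q.fst + (3 / 4 : ℝ) • q.snd, q.fst - (1 / 2 : ℝ) • q.snd)
  map_add' a b := by
    apply WithLp.ofLp_injective
    ext1 <;> simp <;> module
  map_smul' c a := by
    apply WithLp.ofLp_injective
    ext1 <;> simp <;> module

theorem quasiMeasurePreserving_of_involutive (f : E6 →ₗ[ℝ] E6) (hf : ∀ q, f (f q) = q) :
    Measure.QuasiMeasurePreserving f (volume : Measure E6) volume := by
  refine Measure.LinearMap.quasiMeasurePreserving volume f ?_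
  intro h
  have h2 : f ∘ₗ f = LinearMap.id := LinearMap.ext hf
  have h3 := congrArg LinearMap.det h2
  rw [LinearMap.det_comp, LinearMap.det_id, h] at h3
  norm_num at h3

theorem exch23_qmp : Measure.QuasiMeasurePreserving exch23 (volume : Measure E6) volume := by
  refine quasiMeasurePreserving_of_involutive _ fun q => ?_
  apply WithLp.ofLp_injective
  ext1 <;> simp [exch23]

theorem exch31_qmp : Measure.QuasiMeasurePreserving exch31 (volume : Measure E6) volume := by
  refine quasiMeasurePreserving_of_involutive _ fun q => ?_
  apply WithLp.ofLp_injective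
  ext1 <;> simp [exch31] <;> module

theorem exch31Momentum_qmp :
    Measure.QuasiMeasurePreserving exch31Momentum (volume : Measure E6) volume := by
  refine quasiMeasurePreserving_of_involutive _ fun q => ?_
  apply WithLp.ofLp_injective
  ext1 <;> simp [exch31Momentum] <;> module

/-- `L²_sym(ℝ⁶)`: the states `ψ ∈ L²(ℝ⁶)` of three identical bosons in Jacobi coordinates, i.e.
`ψ(x, y) = ψ(-x, y) = ψ(x/2 + y, 3x/4 - y/2)`. -/
def L2sym : Submodule ℂ (L2 E6) where
  carrier := {ψ | (∀ᵐ q : E6, ψ q = ψ (exch23 q)) ∧ ∀ᵐ q : E6, ψ q = ψ (exch31 q)}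
  add_mem' {f g} hf hg := by
    have h := Lp.coeFn_add f g
    refine ⟨?_, ?_⟩
    · filter_upwards [hf.1, hg.1, h, exch23_qmp.ae h] with q h1 h2 h3 h4
      rw [h3, h4, Pi.add_apply, Pi.add_apply, h1, h2]
    · filter_upwards [hf.2, hg.2, h, exch31_qmp.ae h] with q h1 h2 h3 h4
      rw [h3, h4, Pi.add_apply, Pi.add_apply, h1, h2]
  zero_mem' := by
    have h := Lp.coeFn_zero ℂ 2 (volume : Measure E6)
    refine ⟨?_, ?_⟩
    · filter_upwards [h, exch23_qmp.ae h] with q h3 h4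
      rw [h3, h4, Pi.zero_apply, Pi.zero_apply]
    · filter_upwards [h, exch31_qmp.ae h] with q h3 h4
      rw [h3, h4, Pi.zero_apply, Pi.zero_apply]
  smul_mem' c f hf := by
    have h := Lp.coeFn_smul c f
    refine ⟨?_, ?_⟩
    · filter_upwards [hf.1, h, exch23_qmp.ae h] with q h1 h3 h4
      rw [h3, h4, Pi.smul_apply, Pi.smul_apply, h1]
    · filter_upwards [hf.2, h, exch31_qmp.ae h] with q h1 h3 h4
      rw [h3, h4, Pi.smul_apply, Pi.smul_apply, h1]

end Symmetry

section Potential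

/-- The symbol `k² + (3/4) p²` of the free Hamiltonian `H₀ = -Δ_x - (3/4) Δ_y`. -/
def freeSymbol (q : E6) : ℝ := ‖q.fst‖ ^ 2 + 3 / 4 * ‖q.snd‖ ^ 2

/-- The Fourier transform of the potential `𝒢^λ ξ` of a charge density `ξ` with `ξ̂ = g`:
`√(2/π) (g(p) + g(k - p/2) + g(-k - p/2)) / (k² + (3/4) p² + λ)`. -/
def potentialHat (lam : ℝ) (g : E3 → ℂ) (q : E6) : ℂ :=
  ((Real.sqrt (2 / Real.pi) / (freeSymbol q + lam) : ℝ) : ℂ) *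
    (g q.snd + g (q.fst - (1 / 2 : ℝ) • q.snd) + g (-q.fst - (1 / 2 : ℝ) • q.snd))

/-- `u = 𝒢^λ ξ` in `L²(ℝ⁶)`. -/
def IsPotential (lam : ℝ) (ξ : L2 E3) (u : L2 E6) : Prop :=
  uFourier u =ᵐ[volume] potentialHat lam (uFourier ξ)

/-- `ψ = w + 𝒢^λ ξ` with `w ∈ H¹(ℝ⁶)` and `ξ ∈ H^{1/2}(ℝ³)`. -/
def IsDecomposition (lam : ℝ) (ψ w : L2 E6) (ξ : L2 E3) : Prop :=
  w ∈ sobolev E6 1 ∧ ξ ∈ sobolev E3 (1 / 2) ∧ IsPotential lam ξ (ψ - w)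

theorem snd_qmp : Measure.QuasiMeasurePreserving (fun q : E6 => q.snd)
    (volume : Measure E6) (volume : Measure E3) :=
  (Measure.quasiMeasurePreserving_snd (μ := (volume : Measure E3))
    (ν := (volume : Measure E3))).comp
    (WithLp.volume_preserving_ofLp E3 E3).quasiMeasurePreserving

/-- An almost everywhere identity between functions on `ℝ³` may be inserted in all three terms of
the potential. -/
theorem ae_potential_args {P : E3 → Prop} (h : ∀ᵐ p : E3, P p) :
    ∀ᵐ q : E6, P q.snd ∧ P (q.fst - (1 / 2 : ℝ) • q.snd) ∧
      P (-q.fst - (1 / 2 : ℝ) • q.snd) := by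
  have h1 := snd_qmp.ae h
  have h2 := exch31Momentum_qmp.ae h1
  have h3 := exch23_qmp.ae h2
  filter_upwards [h1, h2, h3] with q a b c
  exact ⟨a, b, c⟩

theorem IsPotential.zero (lam : ℝ) : IsPotential lam 0 0 := by
  have e6 := uFourier_smul (0 : ℂ) (0 : L2 E6)
  have e3 := uFourier_smul (0 : ℂ) (0 : L2 E3)
  rw [zero_smul] at e6 e3
  filter_upwards [e6, ae_potential_args e3] with q h1 h2
  rw [h1, potentialHat, h2.1, h2.2.1, h2.2.2]
  simp

theorem IsPotential.add {lam : ℝ} {ξ ξ' : L2 E3} {u u' : L2 E6} (h : IsPotential lam ξ u)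
    (h' : IsPotential lam ξ' u') : IsPotential lam (ξ + ξ') (u + u') := by
  filter_upwards [h, h', uFourier_add u u', ae_potential_args (uFourier_add ξ ξ')]
    with q h1 h2 h3 h4
  rw [h3, h1, h2]
  simp only [potentialHat]
  rw [h4.1, h4.2.1, h4.2.2]
  ring

theorem IsPotential.smul {lam : ℝ} {ξ : L2 E3} {u : L2 E6} (c : ℂ) (h : IsPotential lam ξ u) :
    IsPotential lam (c • ξ) (c • u) := by
  filter_upwards [h, uFourier_smul c u, ae_potential_args (uFourier_smul c ξ)] with q h1 h3 h4
  rw [h3, h1]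
  simp only [potentialHat]
  rw [h4.1, h4.2.1, h4.2.2]
  ring

end Potential

section Forms

/-- The multiplication `Γ_reg(y) = β + (γ/y) θ(y)`, `y = |y|`. -/
def gammaReg (β γ : ℝ) (θ : ℝ → ℝ) (y : E3) : ℝ := β + γ / ‖y‖ * θ ‖y‖

/-- The integrand of the off-diagonal part of the charge form. -/
def offDiagKernel (lam : ℝ) (ξ : L2 E3) (p p' : E3) : ℂ :=
  starRingEnd ℂ (uFourier ξ p) * uFourier ξ p' /
    ((‖p‖ ^ 2 + ‖p'‖ ^ 2 + inner ℝ p p' + lam : ℝ) : ℂ)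

/-- The charge form
`Φ^λ(ξ) = ∫ √((3/4)p² + λ) |ξ̂(p)|² dp - π⁻² ∬ conj(ξ̂(p)) ξ̂(p') / (p² + p'² + p·p' + λ) dp' dp
  + ∫ Γ_reg(y) |ξ(y)|² dy`. -/
def chargeForm (β γ : ℝ) (θ : ℝ → ℝ) (lam : ℝ) (ξ : L2 E3) : ℂ :=
  ((∫ p : E3, Real.sqrt (3 / 4 * ‖p‖ ^ 2 + lam) * ‖uFourier ξ p‖ ^ 2 : ℝ) : ℂ)
    - 1 / (Real.pi : ℂ) ^ 2 * (∫ p : E3, ∫ p' : E3, offDiagKernel lam ξ p p')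
    + ((∫ y : E3, gammaReg β γ θ y * ‖ξ y‖ ^ 2 : ℝ) : ℂ)

/-- All integrals in the definition of `Φ^λ(ξ)` converge absolutely. -/
def ChargeFormConverges (β γ : ℝ) (θ : ℝ → ℝ) (lam : ℝ) (ξ : L2 E3) : Prop :=
  Integrable (fun p : E3 => Real.sqrt (3 / 4 * ‖p‖ ^ 2 + lam) * ‖uFourier ξ p‖ ^ 2) ∧
  Integrable (fun z : E3 × E3 => offDiagKernel lam ξ z.1 z.2) ∧
  Integrable (fun y : E3 => gammaReg β γ θ y * ‖ξ y‖ ^ 2)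

/-- `ℱ^λ(w) = ∫ (k² + (3/4) p² + λ) |ŵ(k, p)|² dk dp`. -/
def freeForm (lam : ℝ) (w : L2 E6) : ℝ :=
  ∫ q : E6, (freeSymbol q + lam) * ‖uFourier w q‖ ^ 2

/-- The domain of the energy form:
`{ψ ∈ L²_sym(ℝ⁶) | ψ = w + 𝒢^λ ξ, w ∈ H¹(ℝ⁶), ξ ∈ H^{1/2}(ℝ³)}`. -/
def energyDomain (lam : ℝ) : Submodule ℂ L2sym where
  carrier := {ψ | ∃ d : L2 E6 × L2 E3, IsDecomposition lam ψ d.1 d.2}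
  add_mem' := by
    rintro ψ ψ' ⟨d, hw, hξ, h⟩ ⟨d', hw', hξ', h'⟩
    refine ⟨d + d', (sobolev E6 1).add_mem hw hw', (sobolev E3 (1 / 2)).add_mem hξ hξ', ?_⟩
    have e : ((ψ + ψ' : L2sym) : L2 E6) - (d + d').1
        = ((ψ : L2 E6) - d.1) + ((ψ' : L2 E6) - d'.1) := by
      rw [Submodule.coe_add, Prod.fst_add]
      abel
    rw [e]
    exact h.add h'
  zero_mem' := by
    refine ⟨0, (sobolev E6 1).zero_mem, (sobolev E3 (1 / 2)).zero_mem, ?_⟩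
    simpa using IsPotential.zero lam
  smul_mem' := by
    rintro c ψ ⟨d, hw, hξ, h⟩
    refine ⟨c • d, (sobolev E6 1).smul_mem c hw, (sobolev E3 (1 / 2)).smul_mem c hξ, ?_⟩
    have e : ((c • ψ : L2sym) : L2 E6) - (c • d).1 = c • ((ψ : L2 E6) - d.1) := by
      rw [Submodule.coe_smul, Prod.smul_fst, smul_sub]
    rw [e]
    exact h.smul c

/-- The expression `ℱ^λ(w) - λ ‖ψ‖² + 12 π Φ^λ(ξ)`. -/
def energyExpr (β γ : ℝ) (θ : ℝ → ℝ) (lam : ℝ) (ψ w : L2 E6) (ξ : L2 E3) : ℂ :=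
  ((freeForm lam w - lam * ‖ψ‖ ^ 2 : ℝ) : ℂ)
    + 12 * (Real.pi : ℂ) * chargeForm β γ θ lam ξ

open Classical in
/-- The energy form `F(ψ) = ℱ^λ(w) - λ ‖ψ‖² + 12 π Φ^λ(ξ)` for `ψ = w + 𝒢^λ ξ` in the form domain
(and, by convention, `0` outside the form domain). -/
def energyForm (β γ : ℝ) (θ : ℝ → ℝ) (lam : ℝ) (ψ : L2sym) : ℂ :=
  if h : ∃ d : L2 E6 × L2 E3, IsDecomposition lam ψ d.1 d.2 then
    energyExpr β γ θ lam ψ h.choose.1 h.choose.2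
  else 0

variable {H : Type} [NormedAddCommGroup H] [InnerProductSpace ℂ H]

/-- The form `q` with domain `D` is real-valued and `q(u) ≥ m ‖u‖²` on `D`. -/
def IsBoundedBelowBy (D : Submodule ℂ H) (q : H → ℂ) (m : ℝ) : Prop :=
  ∀ u ∈ D, (q u).im = 0 ∧ m * ‖u‖ ^ 2 ≤ (q u).re

/-- The quadratic form `q` with domain `D` is closed in the Hilbert space `H`: if `uₙ ∈ D`,
`uₙ → u` in `H` and `q(uₙ - uₘ) → 0` as `n, m → ∞`, then `u ∈ D` and `q(uₙ - u) → 0`. -/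
def IsClosedForm (D : Submodule ℂ H) (q : H → ℂ) : Prop :=
  ∀ (u : ℕ → H) (v : H), (∀ n, u n ∈ D) → Tendsto u atTop (𝓝 v) →
    Tendsto (fun nm : ℕ × ℕ => q (u nm.1 - u nm.2)) atTop (𝓝 0) →
    v ∈ D ∧ Tendsto (fun n => q (u n - v)) atTop (𝓝 0)

end Forms

/-- The threshold `γ_c = (√3/π) (4π/(3√3) - 1)`. -/
def gammaCrit : ℝ :=
  Real.sqrt 3 / Real.pi * (4 * Real.pi / (3 * Real.sqrt 3) - 1)

/-- The hypothesis (H1) on the cut-off function: `θ ∈ L^∞(ℝ⁺)` and `|θ(r) - 1| ≤ c r` for some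
`c > 0` (for almost every `r > 0`). Only the values of `θ` on `(0, ∞)` matter. -/
def CutoffH1 (θ : ℝ → ℝ) : Prop :=
  MemLp θ ⊤ (volume.restrict (Set.Ioi 0)) ∧
    ∃ c > 0, ∀ᵐ r ∂(volume.restrict (Set.Ioi (0 : ℝ))), |θ r - 1| ≤ c * r

end

/-! Everything rests on a lower bound for the charge form. Let w = ∫ |ξ|²/|y| be the Coulomb energy
and N = ∫ |p| |ξ̂|². In momentum space the Coulomb potential is the kernel |p - p'|⁻², with form 2π²
w (`coulomb_form_eq`), and the off-diagonal kernel of Φ^λ is dominated, as a quadratic form, by 2/3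
of it (`kernelForm_stm_le`). So the off-diagonal term costs at most (4/3) w. Since Γ_reg differs
from γ/|y| by a bounded function (`gammaReg_spec`), Φ^λ is at least its diagonal part plus (γ - 4/3)
w minus C‖ξ‖². If γ < 4/3, Kato's inequality w ≤ (π/2) N (`kernelForm_inv_sq_sub_le`) is played
against the diagonal part, which is at least (√3/2) N. The margin is positive exactly when γ > 4/3 -
√3/π = γ_c, and a large λ absorbs C (`realChargeForm_coercive`).

The domination `kernelNonneg_stm` avoids spherical harmonics and the Mellin transform. Both kernels
are geometric series in p·p'. The kernels (p·p')ⁿ/(p² + p'² + λ)ⁿ⁺¹ are positive, being Laplace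
transforms of Gaussians times Gram kernels of tensor powers, and their forms decrease in λ. In 2/3
Coulomb minus off-diagonal, odd powers thus contribute positively. An even power 2m has coefficient
(2/3)4ᵐ - 1, negative only for m = 0. For m ≥ 1 each even kernel exceeds its angular average by a
positive kernel (`kernelNonneg_residue`), so only the sum of the angular averages remains to be
treated. With ρ the ratio of the smaller to the larger radius and L(y) = log((1+y)/(1-y)), that sum
equals (3L(ρ³) - L(ρ))/(6|p||p'|), and it is positive because every 3ρ³ʲ - ρʲ is an explicit Gram
kernel (`kernelNonneg_swave`).

For the energy form, a potential 𝒢^λζ lies in H¹ only if ζ = 0 (`IsPotential.eq_zero`), so the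
decomposition is unique. Changing λ to μ keeps ξ and moves an H¹ function between the two summands.
The change of the free part is the integral of a resolvent difference against the squared sum of
three copies of ξ̂ (`integral_resolventGap_mul_sum`); its diagonal and cross terms reproduce the
change of 12π Φ^λ(ξ). Hence λ may be taken large, where F + λ‖·‖² is a sum of two nonnegative terms
controlling w in H¹ and ξ in H^{1/2}. Boundedness from below is then immediate, and closedness
follows from completeness of weighted norms (`weighted_norm_closed`). -/

/-! ### Plancherel for the unitary Fourier transform, and Sobolev spaces as weighted spaces. -/

section FourierBasics

variable {E : Type} [NormedAddCommGroup E] [InnerProductSpace ℝ E] [FiniteDimensional ℝ E]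
  [MeasurableSpace E] [BorelSpace E]

theorem memLp_comp_smul {g : E → ℂ} (hg : MemLp g 2) {c : ℝ} (hc : c ≠ 0) :
    MemLp (fun p => g (c • p)) 2 := by
  have h : MemLp g 2 (Measure.map (c • ·) (volume : Measure E)) := by
    rw [Measure.map_addHaar_smul volume hc]
    exact hg.smul_measure ENNReal.ofReal_ne_top
  exact (memLp_map_measure_iff h.1 (measurable_const_smul c).aemeasurable).1 h

theorem memLp_uFourier (f : L2 E) : MemLp (uFourier f) 2 :=
  (memLp_comp_smul (Lp.memLp (Lp.fourierTransformₗᵢ E ℂ f)) (by positivity)).const_mul _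

theorem integral_norm_sq_eq (f : L2 E) : ∫ x, ‖f x‖ ^ 2 = ‖f‖ ^ 2 := by
  have h := L2.inner_def (𝕜 := ℂ) f f
  have h2 := congrArg RCLike.re h
  rw [inner_self_eq_norm_sq] at h2
  rw [h2, ← integral_re]
  · congr 1 with x
    simp [inner_self_eq_norm_sq_to_K]
    norm_cast
  · exact L2.integrable_inner f f

theorem integral_norm_sq_uFourier (f : L2 E) : ∫ p, ‖uFourier f p‖ ^ 2 = ‖f‖ ^ 2 := by
  have h : ∀ p, ‖uFourier f p‖ ^ 2 = (2 * Real.pi) ^ (-(Module.finrank ℝ E : ℝ)) *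
      (fun q => ‖(Lp.fourierTransformₗᵢ E ℂ f : L2 E) q‖ ^ 2) ((2 * Real.pi)⁻¹ • p) := by
    intro p
    simp only [uFourier, norm_mul, mul_pow, Complex.norm_real, Real.norm_eq_abs, sq_abs]
    rw [← Real.rpow_natCast, ← Real.rpow_mul (by positivity)]
    congr 2
    push_cast
    ring
  simp_rw [h]
  rw [integral_const_mul, Measure.integral_comp_inv_smul volume
    (fun q => ‖(Lp.fourierTransformₗᵢ E ℂ f : L2 E) q‖ ^ 2), integral_norm_sq_eq,
    LinearIsometryEquiv.norm_map, abs_of_nonneg (by positivity), smul_eq_mul, ← mul_assoc,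
    ← Real.rpow_natCast, ← Real.rpow_add (by positivity)]
  simp

theorem integrable_norm_sq_uFourier (f : L2 E) : Integrable (fun p => ‖uFourier f p‖ ^ 2) :=
  (memLp_uFourier f).integrable_norm_pow (by norm_num)

theorem uFourier_sub (f g : L2 E) :
    uFourier (f - g) =ᵐ[volume] fun p => uFourier f p - uFourier g p := by
  rw [sub_eq_add_neg, ← neg_one_smul ℂ g]
  filter_upwards [uFourier_add f ((-1 : ℂ) • g), uFourier_smul (-1 : ℂ) g] with p h1 h2
  rw [h1, h2]
  ring

theorem uFourier_injective {f g : L2 E} (h : uFourier f =ᵐ[volume] uFourier g) : f = g := by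
  have h1 : ∫ p, ‖uFourier (f - g) p‖ ^ 2 = 0 := by
    rw [integral_eq_zero_of_ae]
    filter_upwards [uFourier_sub f g, h] with p h1 h2
    simp [h1, h2]
  rw [integral_norm_sq_uFourier] at h1
  exact sub_eq_zero.1 (norm_eq_zero.1 (pow_eq_zero_iff (by norm_num) |>.1 h1))

/-- Undo the prefactor and the rescaling by 2π, then invert the Plancherel isometry. Potentials are
constructed this way. -/
theorem exists_uFourier_eq {g : E → ℂ} (hg : MemLp g 2) :
    ∃ f : L2 E, uFourier f =ᵐ[volume] g := by
  have hpi : (2 * Real.pi) ≠ 0 := by positivity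
  set c : ℂ := (((2 * Real.pi) ^ (-(Module.finrank ℝ E : ℝ) / 2) : ℝ) : ℂ) with hc
  have hc0 : c ≠ 0 := by
    rw [hc]
    exact_mod_cast (by positivity : (0 : ℝ) < (2 * Real.pi) ^ (-(Module.finrank ℝ E : ℝ) / 2)).ne'
  have h1 : MemLp (fun p => c⁻¹ * g ((2 * Real.pi) • p)) 2 := (memLp_comp_smul hg hpi).const_mul _
  refine ⟨(Lp.fourierTransformₗᵢ E ℂ).symm h1.toLp, ?_⟩
  have h := (Measure.quasiMeasurePreserving_smul (volume : Measure E)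
    (r := (2 * Real.pi)⁻¹) (by positivity)).ae h1.coeFn_toLp
  filter_upwards [h] with p hp
  simp only [uFourier, LinearIsometryEquiv.apply_symm_apply]
  rw [hp, ← hc, ← mul_assoc, mul_inv_cancel₀ hc0, one_mul, smul_smul, mul_inv_cancel₀ hpi, one_smul]

-- The growing weight acts only on distributions, whereas its reciprocal is bounded and multiplies
-- L². Both directions therefore work with the reciprocal weight, cancel the two weights as
-- distributional multipliers, and use that L² embeds injectively into the tempered distributions.
open FourierTransform TemperedDistribution in
theorem mem_sobolev_iff_memLp {s : ℝ} (hs : 0 ≤ s) (ξ : L2 E) : ξ ∈ sobolev E s ↔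
    MemLp (fun p => (((1 + ‖p‖ ^ 2) ^ (s / 2) : ℝ) : ℂ) *
      (Lp.fourierTransformₗᵢ E ℂ ξ : L2 E) p) 2 := by
  set F : L2 E := Lp.fourierTransformₗᵢ E ℂ ξ with hF
  have hFξ : 𝓕 (Lp.toTemperedDistribution ξ) = Lp.toTemperedDistribution F :=
    Lp.fourier_toTemperedDistribution_eq ξ
  have hw : MemLp (fun p : E => (((1 + ‖p‖ ^ 2) ^ (-s / 2) : ℝ) : ℂ)) ⊤ := by
    refine memLp_top_of_bound ?_ 1 (ae_of_all _ fun p => ?_)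
    · refine Continuous.aestronglyMeasurable ?_
      refine Complex.continuous_ofReal.comp (Continuous.rpow_const (by fun_prop) fun p => ?_)
      left; positivity
    · rw [Complex.norm_real, Real.norm_eq_abs, abs_of_nonneg (by positivity)]
      exact Real.rpow_le_one_of_one_le_of_nonpos (by nlinarith [sq_nonneg ‖p‖]) (by linarith)
  have key : ∀ g : L2 E, smulLeftCLM ℂ (fun x : E ↦ (((1 + ‖x‖ ^ 2) ^ (-s / 2) : ℝ) : ℂ))
      (Lp.toTemperedDistribution g) =
        Lp.toTemperedDistribution ((hw.toLp _ (μ := volume)) • g : L2 E) := by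
    intro g
    rw [Lp.toTemperedDistribution_smul_eq]
    fun_prop
  have hsm : ∀ g : L2 E, ((hw.toLp _ (μ := volume)) • g : L2 E) =ᵐ[volume] fun p =>
      (((1 + ‖p‖ ^ 2) ^ (-s / 2) : ℝ) : ℂ) * g p := by
    intro g
    filter_upwards [Lp.coeFn_lpSMul (r := 2) (hw.toLp _ (μ := volume)) g, hw.coeFn_toLp]
      with p h1 h2
    rw [h1, Pi.smul_apply', h2, smul_eq_mul]
  have hinv : ∀ p : E, ((((1 + ‖p‖ ^ 2) ^ (s / 2) : ℝ) : ℂ)) *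
      (((1 + ‖p‖ ^ 2) ^ (-s / 2) : ℝ) : ℂ) = 1 := by
    intro p
    rw [← Complex.ofReal_mul, ← Real.rpow_add (by positivity)]
    simp [neg_div]
  change MemSobolev s 2 (Lp.toTemperedDistribution ξ) ↔ _
  rw [memSobolev_iff_exists_smulLeftCLM_fourier, hFξ]
  constructor
  · rintro ⟨f', hf'⟩
    have h1 := key f'
    rw [← hf', smulLeftCLM_smulLeftCLM_apply (by fun_prop) (by fun_prop)] at h1
    have h2' : ((fun x : E ↦ (((1 + ‖x‖ ^ 2) ^ (s / 2) : ℝ) : ℂ)) *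
        fun x : E ↦ (((1 + ‖x‖ ^ 2) ^ (-s / 2) : ℝ) : ℂ)) = fun _ => 1 := by
      ext p
      rw [Pi.mul_apply, hinv]
    rw [h2', smulLeftCLM_const, one_smul] at h1
    have hker := Lp.ker_toTemperedDistributionCLM_eq_bot (F := ℂ) (μ := (volume : Measure E))
      (p := 2)
    have h3 : F = (hw.toLp _ (μ := volume)) • f' :=
      LinearMap.ker_eq_bot.1 hker (by simpa [Lp.toTemperedDistributionCLM_apply] using h1)
    refine (Lp.memLp f').ae_eq ?_
    filter_upwards [hsm f'] with p hp
    rw [h3, hp, ← mul_assoc, hinv, one_mul]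
  · intro h
    refine ⟨h.toLp, ?_⟩
    have h3 : F = (hw.toLp _ (μ := volume)) • h.toLp := by
      apply Lp.ext
      filter_upwards [hsm h.toLp, h.coeFn_toLp] with p h1 h2
      rw [h1, h2, ← mul_assoc, mul_comm _ (((1 + ‖p‖ ^ 2) ^ (s / 2) : ℝ) : ℂ), hinv, one_mul]
    have h4 := key h.toLp
    rw [← h3] at h4
    rw [← h4, smulLeftCLM_smulLeftCLM_apply (by fun_prop) (by fun_prop)]
    have h2 : ((fun x : E ↦ (((1 + ‖x‖ ^ 2) ^ (-s / 2) : ℝ) : ℂ)) *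
        fun x : E ↦ (((1 + ‖x‖ ^ 2) ^ (s / 2) : ℝ) : ℂ)) = fun _ => 1 := by
      ext p
      rw [Pi.mul_apply, mul_comm, hinv]
    rw [h2, smulLeftCLM_const, one_smul]

/-- Change of the weight when the argument is rescaled by `c ≤ 1`. -/
theorem memLp_weight_comp_smul {s : ℝ} (hs : 0 ≤ s) {c : ℝ} (hc : c ≠ 0) {g : E → ℂ}
    (hg : MemLp (fun p => (((1 + ‖p‖ ^ 2) ^ (s / 2) : ℝ) : ℂ) * g p) 2)
    (hgm : AEStronglyMeasurable g) :
    MemLp (fun p => (((1 + ‖p‖ ^ 2) ^ (s / 2) : ℝ) : ℂ) * g (c • p)) 2 := by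
  have h1 := (memLp_comp_smul hg hc).const_mul ((((1 + (c ^ 2)⁻¹) ^ (s / 2) : ℝ) : ℂ))
  have hgm' : AEStronglyMeasurable (fun p => g (c • p)) :=
    hgm.comp_quasiMeasurePreserving (Measure.quasiMeasurePreserving_smul _ hc)
  have hwm : Continuous (fun p : E => (((1 + ‖p‖ ^ 2) ^ (s / 2) : ℝ) : ℂ)) := by
    refine Complex.continuous_ofReal.comp (Continuous.rpow_const (by fun_prop) fun p => ?_)
    left; positivity
  refine h1.mono (hwm.aestronglyMeasurable.mul hgm') (ae_of_all _ fun p => ?_)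
  have hc2 : 0 < c ^ 2 := by positivity
  rw [norm_mul, norm_mul, norm_mul, ← mul_assoc]
  gcongr
  simp only [Complex.norm_real, Real.norm_eq_abs]
  rw [abs_of_nonneg (by positivity), abs_of_nonneg (by positivity), abs_of_nonneg (by positivity),
    ← Real.mul_rpow (by positivity) (by positivity)]
  refine Real.rpow_le_rpow (by positivity) ?_ (by positivity)
  rw [norm_smul, mul_pow, Real.norm_eq_abs, sq_abs]
  have : (1 + (c ^ 2)⁻¹) * (1 + c ^ 2 * ‖p‖ ^ 2) = 1 + ‖p‖ ^ 2 + (c ^ 2)⁻¹ + c ^ 2 * ‖p‖ ^ 2 := by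
    field_simp
    ring
  rw [this]
  have : 0 < (c ^ 2)⁻¹ := by positivity
  nlinarith [sq_nonneg ‖p‖, mul_nonneg hc2.le (sq_nonneg ‖p‖)]

/-- The two conventions for the Fourier variable differ by the factor 2π, which changes the weight
by a bounded factor only. -/
theorem mem_sobolev_iff {s : ℝ} (hs : 0 ≤ s) (ξ : L2 E) : ξ ∈ sobolev E s ↔
    Integrable (fun p => (1 + ‖p‖ ^ 2) ^ s * ‖uFourier ξ p‖ ^ 2) := by
  have hpi : (2 * Real.pi) ≠ 0 := by positivity
  set c : ℂ := (((2 * Real.pi) ^ (-(Module.finrank ℝ E : ℝ) / 2) : ℝ) : ℂ) with hc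
  have hc0 : c ≠ 0 := by
    rw [hc]
    exact_mod_cast (by positivity : (0 : ℝ) < (2 * Real.pi) ^ (-(Module.finrank ℝ E : ℝ) / 2)).ne'
  have hwm : Continuous (fun p : E => (((1 + ‖p‖ ^ 2) ^ (s / 2) : ℝ) : ℂ)) := by
    refine Complex.continuous_ofReal.comp (Continuous.rpow_const (by fun_prop) fun p => ?_)
    left; positivity
  have h1 : Integrable (fun p => (1 + ‖p‖ ^ 2) ^ s * ‖uFourier ξ p‖ ^ 2) ↔
      MemLp (fun p => (((1 + ‖p‖ ^ 2) ^ (s / 2) : ℝ) : ℂ) * uFourier ξ p) 2 := by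
    refine Iff.trans ?_
      (memLp_two_iff_integrable_sq_norm (hwm.aestronglyMeasurable.mul (memLp_uFourier ξ).1)).symm
    refine integrable_congr (ae_of_all _ fun p => ?_)
    simp only [Pi.mul_apply, norm_mul, Complex.norm_real, Real.norm_eq_abs]
    rw [abs_of_nonneg (by positivity)]
    rw [mul_pow, ← Real.rpow_natCast ((1 + ‖p‖ ^ 2) ^ (s / 2)), ← Real.rpow_mul (by positivity)]
    norm_num
  rw [h1, mem_sobolev_iff_memLp hs]
  constructor
  · intro h
    refine ((memLp_weight_comp_smul hs (inv_ne_zero hpi) h (Lp.memLp _).1).const_mul c).ae_eq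
      (ae_of_all _ fun p => ?_)
    simp only [uFourier, ← hc]
    ring
  · intro h
    refine ((memLp_weight_comp_smul hs hpi h (memLp_uFourier ξ).1).const_mul c⁻¹).ae_eq
      (ae_of_all _ fun p => ?_)
    simp only [uFourier, ← hc, smul_smul, inv_mul_cancel₀ hpi, one_smul]
    field_simp

end FourierBasics

/-! ### Hermitian forms of real kernels and the positive cone of kernels. -/

noncomputable section KernelForms

/-- The Hermitian form `∬ K(p, p') Re(conj(f(p)) f(p')) dp dp'` of a real kernel. -/
def kernelForm (f : E3 → ℂ) (K : E3 × E3 → ℝ) : ℝ :=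
  ∫ z : E3 × E3, K z * (starRingEnd ℂ (f z.1) * f z.2).re

/-- The form of the kernel `K` at `f` converges absolutely. -/
def KernelConverges (f : E3 → ℂ) (K : E3 × E3 → ℝ) : Prop :=
  AEStronglyMeasurable K ∧ Integrable (fun z : E3 × E3 => K z * (‖f z.1‖ * ‖f z.2‖))

/-- The form of the kernel `K` at `f` converges absolutely to a nonnegative number. -/
def KernelNonneg (f : E3 → ℂ) (K : E3 × E3 → ℝ) : Prop :=
  KernelConverges f K ∧ 0 ≤ kernelForm f K

variable {f : E3 → ℂ} {K K' : E3 × E3 → ℝ}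

theorem abs_re_conj_mul_le (a b : ℂ) : |(starRingEnd ℂ a * b).re| ≤ ‖a‖ * ‖b‖ := by
  refine (Complex.abs_re_le_norm _).trans ?_
  rw [norm_mul, RCLike.norm_conj]

theorem aestronglyMeasurable_re_conj_mul (hf : AEStronglyMeasurable f) :
    AEStronglyMeasurable (fun z : E3 × E3 => (starRingEnd ℂ (f z.1) * f z.2).re) := by
  have h1 : AEStronglyMeasurable (fun z : E3 × E3 => f z.1) := hf.comp_fst
  have h2 : AEStronglyMeasurable (fun z : E3 × E3 => f z.2) := hf.comp_snd
  exact Complex.continuous_re.comp_aestronglyMeasurable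
    ((Complex.continuous_conj.comp_aestronglyMeasurable h1).mul h2)

theorem aestronglyMeasurable_norm_mul_norm (hf : AEStronglyMeasurable f) :
    AEStronglyMeasurable (fun z : E3 × E3 => ‖f z.1‖ * ‖f z.2‖) := by
  have h1 : AEStronglyMeasurable (fun z : E3 × E3 => f z.1) := hf.comp_fst
  have h2 : AEStronglyMeasurable (fun z : E3 × E3 => f z.2) := hf.comp_snd
  exact h1.norm.mul h2.norm

theorem KernelConverges.integrable (hf : AEStronglyMeasurable f) (h : KernelConverges f K) :
    Integrable (fun z : E3 × E3 => K z * (starRingEnd ℂ (f z.1) * f z.2).re) := by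
  refine h.2.mono (h.1.mul (aestronglyMeasurable_re_conj_mul hf)) (ae_of_all _ fun z => ?_)
  rw [norm_mul, norm_mul]
  refine mul_le_mul_of_nonneg_left ?_ (norm_nonneg _)
  rw [Real.norm_eq_abs, Real.norm_eq_abs, abs_of_nonneg (by positivity : 0 ≤ ‖f z.1‖ * ‖f z.2‖)]
  exact abs_re_conj_mul_le _ _

theorem KernelConverges.mono (hf : AEStronglyMeasurable f) (hK : AEStronglyMeasurable K)
    (h : KernelConverges f K') (hle : ∀ᵐ z, |K z| ≤ |K' z|) : KernelConverges f K := by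
  refine ⟨hK, h.2.mono (hK.mul (aestronglyMeasurable_norm_mul_norm hf)) ?_⟩
  filter_upwards [hle] with z hz
  rw [norm_mul (K z), norm_mul (K' z)]
  exact mul_le_mul_of_nonneg_right hz (norm_nonneg _)

theorem KernelConverges.add (h : KernelConverges f K) (h' : KernelConverges f K') :
    KernelConverges f (fun z => K z + K' z) := by
  refine ⟨h.1.add h'.1, (h.2.add h'.2).congr (ae_of_all _ fun z => ?_)⟩
  simp only [Pi.add_apply]
  ring

theorem KernelConverges.const_mul (c : ℝ) (h : KernelConverges f K) :
    KernelConverges f (fun z => c * K z) := by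
  refine ⟨h.1.const_mul c, (h.2.const_mul c).congr (ae_of_all _ fun z => ?_)⟩
  ring

theorem KernelConverges.sub (h : KernelConverges f K) (h' : KernelConverges f K') :
    KernelConverges f (fun z => K z - K' z) := by
  refine ⟨h.1.sub h'.1, (h.2.sub h'.2).congr (ae_of_all _ fun z => ?_)⟩
  simp only [Pi.sub_apply]
  ring

theorem kernelForm_const_mul (c : ℝ) : kernelForm f (fun z => c * K z) = c * kernelForm f K := by
  rw [kernelForm, kernelForm, ← integral_const_mul]
  congr 1 with z
  ring

theorem kernelForm_add (hf : AEStronglyMeasurable f) (h : KernelConverges f K)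
    (h' : KernelConverges f K') :
    kernelForm f (fun z => K z + K' z) = kernelForm f K + kernelForm f K' := by
  rw [kernelForm, kernelForm, kernelForm, ← integral_add (h.integrable hf) (h'.integrable hf)]
  congr 1 with z
  ring

theorem kernelForm_sub (hf : AEStronglyMeasurable f) (h : KernelConverges f K)
    (h' : KernelConverges f K') :
    kernelForm f (fun z => K z - K' z) = kernelForm f K - kernelForm f K' := by
  rw [kernelForm, kernelForm, kernelForm, ← integral_sub (h.integrable hf) (h'.integrable hf)]
  congr 1 with z
  ring

theorem KernelNonneg.add (hf : AEStronglyMeasurable f) (h : KernelNonneg f K)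
    (h' : KernelNonneg f K') : KernelNonneg f (fun z => K z + K' z) := by
  refine ⟨h.1.add h'.1, ?_⟩
  rw [kernelForm_add hf h.1 h'.1]
  exact add_nonneg h.2 h'.2

theorem KernelNonneg.const_mul {c : ℝ} (hc : 0 ≤ c) (h : KernelNonneg f K) :
    KernelNonneg f (fun z => c * K z) := by
  refine ⟨h.1.const_mul c, ?_⟩
  rw [kernelForm_const_mul]
  exact mul_nonneg hc h.2

theorem KernelNonneg.congr (h : KernelNonneg f K) (hK : K =ᵐ[volume] K') : KernelNonneg f K' := by
  refine ⟨⟨h.1.1.congr hK, h.1.2.congr ?_⟩, ?_⟩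
  · filter_upwards [hK] with z hz
    rw [hz]
  · refine h.2.trans_eq (integral_congr_ae ?_)
    filter_upwards [hK] with z hz
    rw [hz]

theorem KernelNonneg.zero : KernelNonneg f (fun _ => 0) := by
  refine ⟨⟨aestronglyMeasurable_const, ?_⟩, ?_⟩ <;> simp [kernelForm]

theorem KernelNonneg.sum {ι : Type*} (s : Finset ι) {L : ι → E3 × E3 → ℝ}
    (hf : AEStronglyMeasurable f) (h : ∀ i ∈ s, KernelNonneg f (L i)) :
    KernelNonneg f (fun z => ∑ i ∈ s, L i z) := by
  classical
  induction s using Finset.induction_on with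
  | empty => simpa using KernelNonneg.zero
  | insert a s ha ih =>
    simp only [Finset.sum_insert ha]
    exact (h a (by simp)).add hf (ih fun i hi => h i (by simp [hi]))

/-- Dominated limits of nonnegative kernels are nonnegative. -/
theorem KernelNonneg.of_tendsto {L : ℕ → E3 × E3 → ℝ} {G : E3 × E3 → ℝ}
    (hf : AEStronglyMeasurable f) (h : ∀ n, KernelNonneg f (L n)) (hG : KernelConverges f G)
    (hle : ∀ n, ∀ᵐ z, |L n z| ≤ G z)
    (hlim : ∀ᵐ z, Tendsto (fun n => L n z) atTop (𝓝 (K z))) : KernelNonneg f K := by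
  have hK : AEStronglyMeasurable K := aestronglyMeasurable_of_tendsto_ae atTop (fun n => (h n).1.1) hlim
  refine ⟨hG.mono hf hK ?_, ?_⟩
  · filter_upwards [ae_all_iff.2 hle, hlim] with z h1 h2
    exact (le_of_tendsto h2.abs (Eventually.of_forall h1)).trans (le_abs_self _)
  · refine ge_of_tendsto' (tendsto_integral_of_dominated_convergence _
      (fun n => ((h n).1.integrable hf).1) hG.2 (fun n => ?_) ?_) fun n => (h n).2
    · filter_upwards [hle n] with z hz
      rw [norm_mul]
      exact mul_le_mul hz (abs_re_conj_mul_le _ _) (norm_nonneg _) ((abs_nonneg _).trans hz)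
    · filter_upwards [hlim] with z hz
      exact hz.mul_const _

/-- Gram kernels are nonnegative. -/
theorem KernelNonneg.of_gram {V : Type*} [MeasurableSpace V] {μ : Measure V} [SFinite μ]
    {g : V → E3 → ℝ} {G : E3 × E3 → ℝ} (hf : AEStronglyMeasurable f)
    (hg : Measurable (Function.uncurry g)) (hG : KernelConverges f G)
    (hint : ∀ᵐ z : E3 × E3, Integrable (fun v => g v z.1 * g v z.2) μ)
    (hle : ∀ᵐ z : E3 × E3, ∫ v, |g v z.1 * g v z.2| ∂μ ≤ G z)
    (hK : ∀ᵐ z : E3 × E3, K z = ∫ v, g v z.1 * g v z.2 ∂μ) : KernelNonneg f K := by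
  have hm : Measurable (fun w : V × (E3 × E3) => g w.1 w.2.1 * g w.1 w.2.2) :=
    (hg.comp (measurable_fst.prodMk (measurable_fst.comp measurable_snd))).mul
      (hg.comp (measurable_fst.prodMk (measurable_snd.comp measurable_snd)))
  have hKm : AEStronglyMeasurable K := by
    have h1 : StronglyMeasurable (fun z : E3 × E3 => ∫ v, g v z.1 * g v z.2 ∂μ) :=
      StronglyMeasurable.integral_prod_right (f := fun z : E3 × E3 => fun v => g v z.1 * g v z.2)
        (hm.comp measurable_swap).stronglyMeasurable
    exact h1.aestronglyMeasurable.congr (hK.mono fun z hz => hz.symm)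
  have hKc : KernelConverges f K := by
    refine hG.mono hf hKm ?_
    filter_upwards [hle, hK] with z h1 h2
    rw [h2]
    exact ((abs_integral_le_integral_abs).trans h1).trans (le_abs_self _)
  refine ⟨hKc, ?_⟩
  have hfm : AEStronglyMeasurable (fun z : E3 × E3 => starRingEnd ℂ (f z.1) * f z.2) :=
    (Complex.continuous_conj.comp_aestronglyMeasurable hf.comp_fst).mul hf.comp_snd
  have hwm : AEStronglyMeasurable (fun w : V × (E3 × E3) => ((g w.1 w.2.1 * g w.1 w.2.2 : ℝ) : ℂ) *
      (starRingEnd ℂ (f w.2.1) * f w.2.2)) (μ.prod volume) :=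
    (Complex.continuous_ofReal.comp_aestronglyMeasurable hm.aestronglyMeasurable).mul
      hfm.comp_snd
  have hI : Integrable (fun w : V × (E3 × E3) => ((g w.1 w.2.1 * g w.1 w.2.2 : ℝ) : ℂ) *
      (starRingEnd ℂ (f w.2.1) * f w.2.2)) (μ.prod volume) := by
    rw [integrable_prod_iff' hwm]
    refine ⟨?_, ?_⟩
    · filter_upwards [hint] with z hz
      exact hz.ofReal.mul_const _
    · refine hG.2.mono ?_ ?_
      · exact AEStronglyMeasurable.integral_prod_right' hwm.norm.prod_swap
      · filter_upwards [hle] with z hz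
        simp only [norm_mul, Complex.norm_real, RCLike.norm_conj, Real.norm_eq_abs,
          integral_mul_const, ← abs_mul] at hz ⊢
        rw [abs_mul, abs_mul (G z)]
        have h0 : 0 ≤ ∫ v, |g v z.1 * g v z.2| ∂μ := integral_nonneg fun v => abs_nonneg _
        rw [abs_of_nonneg h0]
        exact mul_le_mul_of_nonneg_right (hz.trans (le_abs_self _)) (abs_nonneg _)
  have h1 : kernelForm f K = (∫ v, (∫ z : E3 × E3, ((g v z.1 * g v z.2 : ℝ) : ℂ) *
      (starRingEnd ℂ (f z.1) * f z.2)) ∂μ).re := by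
    rw [integral_integral_swap hI, kernelForm]
    refine Eq.trans ?_ (integral_re (𝕜 := ℂ) hI.integral_prod_right)
    refine integral_congr_ae ?_
    filter_upwards [hK] with z hz
    rw [hz, integral_mul_const, integral_complex_ofReal]
    exact (Complex.re_ofReal_mul _ _).symm
  -- After Fubini, the inner integral at fixed v factorises into the squared modulus of ∫ g_v f. The
  -- product formula needs no integrability of g_v f, as both sides are zero by convention when it
  -- fails.
  have h2 : ∀ v, (∫ z : E3 × E3, ((g v z.1 * g v z.2 : ℝ) : ℂ) *
      (starRingEnd ℂ (f z.1) * f z.2)) =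
      ((‖∫ p, ((g v p : ℝ) : ℂ) * f p‖ ^ 2 : ℝ) : ℂ) := by
    intro v
    have h3 : ∀ z : E3 × E3, ((g v z.1 * g v z.2 : ℝ) : ℂ) * (starRingEnd ℂ (f z.1) * f z.2) =
        starRingEnd ℂ (((g v z.1 : ℝ) : ℂ) * f z.1) * (((g v z.2 : ℝ) : ℂ) * f z.2) := by
      intro z
      rw [map_mul, Complex.conj_ofReal]
      push_cast
      ring
    simp_rw [h3]
    rw [Measure.volume_eq_prod, integral_prod_mul (fun p => starRingEnd ℂ (((g v p : ℝ) : ℂ) * f p))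
      (fun p => ((g v p : ℝ) : ℂ) * f p), integral_conj, Complex.conj_mul']
    push_cast
    rfl
  rw [h1]
  simp_rw [h2]
  rw [integral_complex_ofReal, Complex.ofReal_re]
  exact integral_nonneg fun v => by positivity

end KernelForms

/-! ### Schur's test. -/

section SchurTest

variable {f : E3 → ℂ}

theorem ae_ne_zero_E3 : ∀ᵐ p : E3, p ≠ 0 := by
  rw [ae_iff]
  simp

theorem ae_pair_ne_zero : ∀ᵐ z : E3 × E3, z.1 ≠ 0 ∧ z.2 ≠ 0 := by
  rw [Measure.volume_eq_prod]
  exact (Measure.quasiMeasurePreserving_fst.ae ae_ne_zero_E3).and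
    (Measure.quasiMeasurePreserving_snd.ae ae_ne_zero_E3)

/-- Schur's test with the weight `|p|⁻²`. -/
theorem lintegral_kernel_le_of_schur {K : E3 × E3 → ℝ} {C : ℝ} (hf : AEStronglyMeasurable f)
    (hK : Measurable K) (hK0 : ∀ z, 0 ≤ K z) (hsymm : ∀ z, K z.swap = K z)
    (hC : ∀ p : E3, p ≠ 0 → ∫⁻ p' : E3, ENNReal.ofReal (K (p, p') / ‖p'‖ ^ 2) ≤
      ENNReal.ofReal (C / ‖p‖)) :
    ∫⁻ z : E3 × E3, ENNReal.ofReal (K z * (‖f z.1‖ * ‖f z.2‖)) ≤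
      ENNReal.ofReal C * ∫⁻ p : E3, ENNReal.ofReal (‖p‖ * ‖f p‖ ^ 2) := by
  set H : E3 × E3 → ENNReal := fun z =>
    ENNReal.ofReal (‖f z.1‖ ^ 2 * ‖z.1‖ ^ 2 / 2) * ENNReal.ofReal (K z / ‖z.2‖ ^ 2) with hH
  have hfm : AEMeasurable (fun p : E3 => ENNReal.ofReal (‖f p‖ ^ 2 * ‖p‖ ^ 2 / 2)) := by
    refine AEMeasurable.ennreal_ofReal ?_
    exact (((hf.norm.aemeasurable).pow_const 2).mul (by fun_prop)).div_const 2
  have hKm : Measurable (fun z : E3 × E3 => ENNReal.ofReal (K z / ‖z.2‖ ^ 2)) := by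
    refine Measurable.ennreal_ofReal ?_
    exact hK.div (by fun_prop)
  have hHm : AEMeasurable H := (hfm.comp_fst (ν := (volume : Measure E3))).mul hKm.aemeasurable
  have h1 : ∫⁻ z, H z ≤ ENNReal.ofReal (C / 2) * ∫⁻ p : E3, ENNReal.ofReal (‖p‖ * ‖f p‖ ^ 2) := by
    rw [Measure.volume_eq_prod, lintegral_prod _ hHm]
    have hm2 : AEMeasurable (fun p : E3 => ENNReal.ofReal (‖p‖ * ‖f p‖ ^ 2)) := by
      refine AEMeasurable.ennreal_ofReal ?_
      exact AEMeasurable.mul (by fun_prop) ((hf.norm.aemeasurable).pow_const 2)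
    rw [← lintegral_const_mul'' _ hm2]
    refine lintegral_mono_ae ?_
    filter_upwards [ae_ne_zero_E3] with p hp
    have hp' : 0 < ‖p‖ := norm_pos_iff.2 hp
    simp only [hH]
    rw [lintegral_const_mul' _ _ ENNReal.ofReal_ne_top]
    refine (mul_le_mul_right (hC p hp) _).trans ?_
    by_cases hC0 : 0 ≤ C
    · rw [← ENNReal.ofReal_mul (by positivity), ← ENNReal.ofReal_mul (by positivity)]
      refine (ENNReal.ofReal_le_ofReal (le_of_eq ?_))
      field_simp
    · rw [ENNReal.ofReal_of_nonpos (p := C / ‖p‖)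
        (div_nonpos_of_nonpos_of_nonneg (not_le.1 hC0).le hp'.le)]
      simp
  have h2 : ∫⁻ z : E3 × E3, H z.swap = ∫⁻ z, H z := by
    rw [Measure.volume_eq_prod]
    exact lintegral_prod_swap H
  calc ∫⁻ z : E3 × E3, ENNReal.ofReal (K z * (‖f z.1‖ * ‖f z.2‖))
      ≤ ∫⁻ z, (H z + H z.swap) := by
        refine lintegral_mono_ae ?_
        filter_upwards [ae_pair_ne_zero] with z hz
        have h1 : 0 < ‖z.1‖ := norm_pos_iff.2 hz.1
        have h2 : 0 < ‖z.2‖ := norm_pos_iff.2 hz.2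
        have hk := hK0 z
        simp only [hH, hsymm, Prod.fst_swap, Prod.snd_swap]
        rw [← ENNReal.ofReal_mul (by positivity), ← ENNReal.ofReal_mul (by positivity),
          ← ENNReal.ofReal_add (by positivity) (by positivity)]
        refine ENNReal.ofReal_le_ofReal ?_
        -- The arithmetic-geometric mean inequality for |f(p)||p|/|p'| and |f(p')||p'|/|p|, whose
        -- product is |f(p)||f(p')|. The two halves are exchanged by the symmetry of K.
        have h3 : ‖f z.1‖ ^ 2 * ‖z.1‖ ^ 2 / 2 * (K z / ‖z.2‖ ^ 2) +
            ‖f z.2‖ ^ 2 * ‖z.2‖ ^ 2 / 2 * (K z / ‖z.1‖ ^ 2) - K z * (‖f z.1‖ * ‖f z.2‖) =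
            K z / 2 * (‖f z.1‖ * ‖z.1‖ / ‖z.2‖ - ‖f z.2‖ * ‖z.2‖ / ‖z.1‖) ^ 2 := by
          field_simp
          ring
        have h4 : 0 ≤ K z / 2 * (‖f z.1‖ * ‖z.1‖ / ‖z.2‖ - ‖f z.2‖ * ‖z.2‖ / ‖z.1‖) ^ 2 := by
          positivity
        linarith
    _ = (∫⁻ z, H z) + (∫⁻ z, H z) := by
        rw [lintegral_add_left' hHm, h2]
    _ ≤ _ := by
        refine (add_le_add h1 h1).trans (le_of_eq ?_)
        rw [← two_mul, ← mul_assoc]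
        congr 1
        rw [show (2 : ENNReal) = ENNReal.ofReal 2 by simp, ← ENNReal.ofReal_mul (by norm_num)]
        congr 1
        ring

theorem kernelConverges_of_schur {K : E3 × E3 → ℝ} {C : ℝ} (hf : AEStronglyMeasurable f)
    (hN : Integrable (fun p : E3 => ‖p‖ * ‖f p‖ ^ 2))
    (hK : Measurable K) (hK0 : ∀ z, 0 ≤ K z) (hsymm : ∀ z, K z.swap = K z)
    (hC : ∀ p : E3, p ≠ 0 → ∫⁻ p' : E3, ENNReal.ofReal (K (p, p') / ‖p'‖ ^ 2) ≤
      ENNReal.ofReal (C / ‖p‖)) (hC0 : 0 ≤ C) :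
    KernelConverges f K ∧ ∫ z : E3 × E3, K z * (‖f z.1‖ * ‖f z.2‖) ≤
      C * ∫ p : E3, ‖p‖ * ‖f p‖ ^ 2 := by
  have h := lintegral_kernel_le_of_schur hf hK hK0 hsymm hC
  have hm : AEStronglyMeasurable (fun z : E3 × E3 => K z * (‖f z.1‖ * ‖f z.2‖)) :=
    hK.aestronglyMeasurable.mul (aestronglyMeasurable_norm_mul_norm hf)
  have h0 : ∀ z : E3 × E3, 0 ≤ K z * (‖f z.1‖ * ‖f z.2‖) := fun z => by
    have := hK0 z
    positivity
  rw [← ofReal_integral_eq_lintegral_ofReal hN (ae_of_all _ fun p => by positivity),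
    ← ENNReal.ofReal_mul hC0] at h
  refine ⟨⟨hK.aestronglyMeasurable, ?_⟩, ?_⟩
  · refine (lintegral_ofReal_ne_top_iff_integrable hm (ae_of_all _ h0)).1 ?_
    exact (h.trans_lt ENNReal.ofReal_lt_top).ne
  · rw [integral_eq_lintegral_of_nonneg_ae (ae_of_all _ h0) hm]
    refine ENNReal.toReal_le_of_le_ofReal ?_ h
    have : 0 ≤ ∫ p : E3, ‖p‖ * ‖f p‖ ^ 2 := integral_nonneg fun p => by positivity
    positivity

end SchurTest

/-! ### Explicit radial integrals in three dimensions. -/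

section RadialIntegrals

theorem volume_real_ball_E3 : (volume : Measure E3).real (Metric.ball 0 1) = 4 * Real.pi / 3 := by
  rw [measureReal_def, EuclideanSpace.volume_ball_fin_three]
  simp
  rw [ENNReal.toReal_ofReal (by positivity)]
  ring

theorem integral_radial_E3 (g : ℝ → ℝ) :
    ∫ x : E3, g ‖x‖ = 4 * Real.pi * ∫ y in Set.Ioi (0 : ℝ), y ^ 2 * g y := by
  rw [integral_fun_norm_addHaar, volume_real_ball_E3, finrank_euclideanSpace_fin]
  simp
  ring

theorem integrable_radial_E3_iff (g : ℝ → ℝ) :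
    Integrable (fun x : E3 => g ‖x‖) ↔ IntegrableOn (fun y => y ^ 2 * g y) (Set.Ioi 0) := by
  rw [integrable_fun_norm_addHaar, finrank_euclideanSpace_fin]
  simp

theorem tendsto_arctan_div_atTop {c : ℝ} (hc : 0 < c) :
    Tendsto (fun y => Real.arctan (y / c)) atTop (𝓝 (Real.pi / 2)) :=
  (tendsto_nhds_of_tendsto_nhdsWithin Real.tendsto_arctan_atTop).comp
    (tendsto_id.atTop_div_const hc)

theorem hasDerivAt_arctan_div {c : ℝ} (hc : 0 < c) (y : ℝ) :
    HasDerivAt (fun y => Real.arctan (y / c)) (c / (y ^ 2 + c ^ 2)) y := by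
  have h := (Real.hasDerivAt_arctan (y / c)).comp y ((hasDerivAt_id y).div_const c)
  refine h.congr_deriv ?_
  field_simp
  ring

theorem radial_inv_sq_sq {c : ℝ} (hc : 0 < c) :
    Integrable (fun x : E3 => 1 / (‖x‖ ^ 2 + c ^ 2) ^ 2) ∧
      ∫ x : E3, 1 / (‖x‖ ^ 2 + c ^ 2) ^ 2 = Real.pi ^ 2 / c := by
  have hd : ∀ y ∈ Set.Ici (0 : ℝ), HasDerivAt
      (fun y => 1 / (2 * c) * Real.arctan (y / c) - y / (2 * (y ^ 2 + c ^ 2)))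
      (y ^ 2 * (1 / (y ^ 2 + c ^ 2) ^ 2)) y := by
    intro y _
    have hpos : 0 < y ^ 2 + c ^ 2 := by positivity
    have h1 := (hasDerivAt_arctan_div hc y).const_mul (1 / (2 * c))
    have h2 : HasDerivAt (fun y : ℝ => 2 * (y ^ 2 + c ^ 2)) (2 * (2 * y)) y := by
      simpa using ((hasDerivAt_pow 2 y).add_const (c ^ 2)).const_mul 2
    have h3 := (hasDerivAt_id y).div h2 (by positivity)
    refine (h1.sub h3).congr_deriv ?_
    simp only [id]
    field_simp
    ring
  have hlim : Tendsto (fun y => 1 / (2 * c) * Real.arctan (y / c) - y / (2 * (y ^ 2 + c ^ 2)))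
      atTop (𝓝 (1 / (2 * c) * (Real.pi / 2) - 0)) := by
    refine ((tendsto_arctan_div_atTop hc).const_mul _).sub ?_
    refine squeeze_zero' (g := fun y => y⁻¹) ?_ ?_ tendsto_inv_atTop_zero
    · filter_upwards [eventually_gt_atTop 0] with y hy
      positivity
    · filter_upwards [eventually_gt_atTop 0] with y hy
      rw [div_le_iff₀ (by positivity)]
      field_simp
      nlinarith [sq_nonneg y, sq_nonneg c]
  refine ⟨(integrable_radial_E3_iff (fun y => 1 / (y ^ 2 + c ^ 2) ^ 2)).2
    (integrableOn_Ioi_deriv_of_nonneg' hd (fun y _ => by positivity) hlim), ?_⟩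
  rw [integral_radial_E3 (fun y => 1 / (y ^ 2 + c ^ 2) ^ 2),
    integral_Ioi_of_hasDerivAt_of_nonneg' hd (fun y _ => by positivity) hlim]
  simp
  field_simp
  ring

/-- Each resolvent alone is not integrable over ℝ³; only the difference is. The value, linear in B -
A, is the source of the square root in the diagonal part of the charge form. -/
theorem radial_resolvent_sub {A B : ℝ} (hA : 0 < A) (hAB : A ≤ B) :
    Integrable (fun x : E3 => 1 / (‖x‖ ^ 2 + A ^ 2) - 1 / (‖x‖ ^ 2 + B ^ 2)) ∧
      ∫ x : E3, (1 / (‖x‖ ^ 2 + A ^ 2) - 1 / (‖x‖ ^ 2 + B ^ 2)) =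
        2 * Real.pi ^ 2 * (B - A) := by
  have hB : 0 < B := hA.trans_le hAB
  have hd : ∀ y ∈ Set.Ici (0 : ℝ), HasDerivAt
      (fun y => B * Real.arctan (y / B) - A * Real.arctan (y / A))
      (y ^ 2 * (1 / (y ^ 2 + A ^ 2) - 1 / (y ^ 2 + B ^ 2))) y := by
    intro y _
    refine (((hasDerivAt_arctan_div hB y).const_mul B).sub
      ((hasDerivAt_arctan_div hA y).const_mul A)).congr_deriv ?_
    field_simp
    ring
  have hlim : Tendsto (fun y => B * Real.arctan (y / B) - A * Real.arctan (y / A))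
      atTop (𝓝 (B * (Real.pi / 2) - A * (Real.pi / 2))) :=
    ((tendsto_arctan_div_atTop hB).const_mul B).sub ((tendsto_arctan_div_atTop hA).const_mul A)
  have h0 : ∀ y ∈ Set.Ioi (0 : ℝ), 0 ≤ y ^ 2 * (1 / (y ^ 2 + A ^ 2) - 1 / (y ^ 2 + B ^ 2)) := by
    intro y _
    refine mul_nonneg (sq_nonneg y) (sub_nonneg.2 ?_)
    gcongr
  refine ⟨(integrable_radial_E3_iff (fun y => 1 / (y ^ 2 + A ^ 2) - 1 / (y ^ 2 + B ^ 2))).2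
    (integrableOn_Ioi_deriv_of_nonneg' hd h0 hlim), ?_⟩
  rw [integral_radial_E3 (fun y => 1 / (y ^ 2 + A ^ 2) - 1 / (y ^ 2 + B ^ 2)),
    integral_Ioi_of_hasDerivAt_of_nonneg' hd h0 hlim]
  simp
  ring

end RadialIntegrals

/-! ### The Kato inequality with its sharp constant. -/

section KatoConstant

/-- Feynman's parametrisation, with antiderivative x / (B (xA + (1 - x)B)). -/
theorem lintegral_feynman {A B : ℝ} (hA : 0 < A) (hB : 0 < B) :
    ∫⁻ x in Set.Ioc (0 : ℝ) 1, ENNReal.ofReal (1 / (x * A + (1 - x) * B) ^ 2) =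
      ENNReal.ofReal (1 / (A * B)) := by
  have hpos : ∀ x ∈ Set.Icc (0 : ℝ) 1, 0 < x * A + (1 - x) * B := by
    intro x hx
    rcases hx.1.eq_or_lt with h | h
    · subst h; simpa using hB
    · have := mul_pos h hA
      have := mul_nonneg (sub_nonneg.2 hx.2) hB.le
      linarith
  have hd : ∀ x ∈ Set.uIcc (0 : ℝ) 1, HasDerivAt (fun x => x / (B * (x * A + (1 - x) * B)))
      (1 / (x * A + (1 - x) * B) ^ 2) x := by
    intro x hx
    rw [Set.uIcc_of_le zero_le_one] at hx
    have h := hpos x hx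
    have h2 : HasDerivAt (fun x => B * (x * A + (1 - x) * B)) (B * (A - B)) x := by
      have := (((hasDerivAt_id x).mul_const A).add
        (((hasDerivAt_id x).const_sub 1).mul_const B)).const_mul B
      refine this.congr_deriv ?_
      ring
    refine ((hasDerivAt_id x).div h2 (by positivity)).congr_deriv ?_
    simp only [id]
    field_simp
    ring
  have hc : ContinuousOn (fun x => 1 / (x * A + (1 - x) * B) ^ 2) (Set.uIcc (0 : ℝ) 1) := by
    rw [Set.uIcc_of_le zero_le_one]
    refine continuousOn_const.div (by fun_prop) fun x hx => ?_
    have := hpos x hx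
    positivity
  have hi := hc.intervalIntegrable (μ := volume)
  have := intervalIntegral.integral_eq_sub_of_hasDerivAt hd hi
  rw [intervalIntegral.integral_of_le zero_le_one] at this
  rw [← ofReal_integral_eq_lintegral_ofReal
    ((intervalIntegrable_iff_integrableOn_Ioc_of_le zero_le_one).1 hi)
    (ae_of_all _ fun x => by positivity), this]
  congr 1
  simp
  ring

theorem lintegral_arcsine : ∫⁻ x in Set.Ioc (0 : ℝ) 1, ENNReal.ofReal (1 / √(x * (1 - x))) =
    ENNReal.ofReal Real.pi := by
  have hd : ∀ x ∈ Set.Ioo (0 : ℝ) 1, HasDerivAt (fun x => Real.arcsin (2 * x - 1))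
      (1 / √(x * (1 - x))) x := by
    intro x hx
    have h1 : HasDerivAt (fun x : ℝ => 2 * x - 1) 2 x := by
      simpa using ((hasDerivAt_id x).const_mul 2).sub_const 1
    refine ((Real.hasDerivAt_arcsin (by linarith [hx.1]) (by linarith [hx.2])).comp x
      h1).congr_deriv ?_
    rw [show 1 - (2 * x - 1) ^ 2 = 2 ^ 2 * (x * (1 - x)) by ring, Real.sqrt_mul (by norm_num),
      Real.sqrt_sq (by norm_num)]
    have : 0 < √(x * (1 - x)) := Real.sqrt_pos.2 (mul_pos hx.1 (by linarith [hx.2]))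
    field_simp
  have hcont : ContinuousOn (fun x => Real.arcsin (2 * x - 1)) (Set.Icc (0 : ℝ) 1) :=
    (Real.continuous_arcsin.comp (by fun_prop)).continuousOn
  have hi := intervalIntegral.integrableOn_deriv_of_nonneg hcont hd fun x _ => by positivity
  have := intervalIntegral.integral_eq_sub_of_hasDerivAt_of_le zero_le_one hcont hd
    ((intervalIntegrable_iff_integrableOn_Ioc_of_le zero_le_one).2 hi)
  rw [intervalIntegral.integral_of_le zero_le_one] at this
  rw [← ofReal_integral_eq_lintegral_ofReal hi (ae_of_all _ fun x => by positivity), this]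
  congr 1
  norm_num

/-- Feynman's parametrisation merges the two factors into one squared denominator. After completing
the square, the p'-integral is π²/(|p|√(x(1-x))), and the arcsine integral supplies the third π. -/
theorem lintegral_inv_sq_conv_inv_sq {p : E3} (hp : p ≠ 0) :
    ∫⁻ p' : E3, ENNReal.ofReal (1 / ‖p - p'‖ ^ 2 / ‖p'‖ ^ 2) ≤
      ENNReal.ofReal (Real.pi ^ 3 / ‖p‖) := by
  have hp' : 0 < ‖p‖ := norm_pos_iff.2 hp
  have hm : Measurable (fun w : E3 × ℝ => ENNReal.ofReal
      (1 / (w.2 * ‖p - w.1‖ ^ 2 + (1 - w.2) * ‖w.1‖ ^ 2) ^ 2)) := by fun_prop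
  calc ∫⁻ p' : E3, ENNReal.ofReal (1 / ‖p - p'‖ ^ 2 / ‖p'‖ ^ 2)
      = ∫⁻ p' : E3, ∫⁻ x in Set.Ioc (0 : ℝ) 1, ENNReal.ofReal
          (1 / (x * ‖p - p'‖ ^ 2 + (1 - x) * ‖p'‖ ^ 2) ^ 2) := by
        refine lintegral_congr_ae ?_
        have h1 : ∀ᵐ p' : E3, p' ≠ p := by
          rw [ae_iff]
          simp
        filter_upwards [ae_ne_zero_E3, h1] with p' h2 h3
        rw [lintegral_feynman (by have := norm_pos_iff.2 (sub_ne_zero.2 h3.symm); positivity)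
          (by have := norm_pos_iff.2 h2; positivity), div_div]
    _ = ∫⁻ x in Set.Ioc (0 : ℝ) 1, ∫⁻ p' : E3, ENNReal.ofReal
          (1 / (x * ‖p - p'‖ ^ 2 + (1 - x) * ‖p'‖ ^ 2) ^ 2) :=
        lintegral_lintegral_swap hm.aemeasurable
    _ = ∫⁻ x in Set.Ioo (0 : ℝ) 1, ∫⁻ p' : E3, ENNReal.ofReal
          (1 / (x * ‖p - p'‖ ^ 2 + (1 - x) * ‖p'‖ ^ 2) ^ 2) :=
        (setLIntegral_congr Ioo_ae_eq_Ioc).symm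
    _ = ∫⁻ x in Set.Ioo (0 : ℝ) 1, ENNReal.ofReal (Real.pi ^ 2 / ‖p‖) *
          ENNReal.ofReal (1 / √(x * (1 - x))) := by
        refine setLIntegral_congr_fun measurableSet_Ioo fun x hx => ?_
        have hx2 : 0 < x * (1 - x) := mul_pos hx.1 (by linarith [hx.2])
        have hs := Real.sqrt_pos.2 hx2
        -- Completing the square: the centre is xp and the remaining mass term is x(1-x)|p|².
        have h1 : ∀ p' : E3, x * ‖p - p'‖ ^ 2 + (1 - x) * ‖p'‖ ^ 2 =
            ‖p' - x • p‖ ^ 2 + (√(x * (1 - x)) * ‖p‖) ^ 2 := by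
          intro p'
          rw [mul_pow, Real.sq_sqrt hx2.le, norm_sub_sq_real, norm_sub_sq_real, norm_smul,
            inner_smul_right, real_inner_comm, mul_pow, Real.norm_eq_abs, sq_abs]
          ring
        simp_rw [h1]
        rw [lintegral_sub_right_eq_self (fun q : E3 => ENNReal.ofReal
          (1 / (‖q‖ ^ 2 + (√(x * (1 - x)) * ‖p‖) ^ 2) ^ 2)) (x • p)]
        have h2 := radial_inv_sq_sq (c := √(x * (1 - x)) * ‖p‖) (by positivity)
        rw [← ofReal_integral_eq_lintegral_ofReal h2.1 (ae_of_all _ fun x => by positivity), h2.2,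
          ← ENNReal.ofReal_mul (by positivity)]
        congr 1
        field_simp
    _ = ENNReal.ofReal (Real.pi ^ 3 / ‖p‖) := by
        rw [lintegral_const_mul' _ _ ENNReal.ofReal_ne_top, setLIntegral_congr Ioo_ae_eq_Ioc,
          lintegral_arcsine, ← ENNReal.ofReal_mul (by positivity)]
        congr 1
        ring
    _ ≤ _ := le_rfl

variable {f : E3 → ℂ}

/-- The sharp Herbst–Kato bound for the kernel `|p - p'|⁻²`. -/
theorem kernelConverges_inv_sq_sub (hf : AEStronglyMeasurable f)
    (hN : Integrable (fun p : E3 => ‖p‖ * ‖f p‖ ^ 2)) :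
    KernelConverges f (fun z => 1 / ‖z.1 - z.2‖ ^ 2) ∧
      ∫ z : E3 × E3, 1 / ‖z.1 - z.2‖ ^ 2 * (‖f z.1‖ * ‖f z.2‖) ≤
        Real.pi ^ 3 * ∫ p : E3, ‖p‖ * ‖f p‖ ^ 2 := by
  refine kernelConverges_of_schur hf hN (by fun_prop) (fun z => by positivity) (fun z => ?_)
    (fun p hp => lintegral_inv_sq_conv_inv_sq hp) (by positivity)
  simp only [Prod.fst_swap, Prod.snd_swap]
  rw [norm_sub_rev]

/-- The reflection p' ↦ -p' reduces this to |p - p'|⁻². It serves for domination: series in |p·p'|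
are bounded by the sum of the two kernels. -/
theorem kernelConverges_inv_sq_add (hf : AEStronglyMeasurable f)
    (hN : Integrable (fun p : E3 => ‖p‖ * ‖f p‖ ^ 2)) :
    KernelConverges f (fun z => 1 / ‖z.1 + z.2‖ ^ 2) := by
  refine (kernelConverges_of_schur (C := Real.pi ^ 3) hf hN (by fun_prop) (fun z => by positivity)
    (fun z => ?_) (fun p hp => ?_) (by positivity)).1
  · simp only [Prod.fst_swap, Prod.snd_swap]
    rw [add_comm]
  · refine le_trans (le_of_eq ?_) (lintegral_inv_sq_conv_inv_sq hp)
    rw [← lintegral_neg_eq_self]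
    simp [← sub_eq_add_neg]

end KatoConstant

/-! ### Tensor powers and their rotation invariant part, through Gaussian moments. -/

noncomputable section TensorMoments

/-- The monomial `∏ₖ p_{i(k)}`, an entry of the tensor power `p^{⊗n}`. -/
def tensorMonomial {n : ℕ} (i : Fin n → Fin 3) (p : E3) : ℝ := ∏ k, p (i k)

/-- The Gaussian moments of `tensorMonomial`. -/
def tensorMoment {n : ℕ} (i : Fin n → Fin 3) : ℝ :=
  ∫ ω : E3, tensorMonomial i ω * Real.exp (-‖ω‖ ^ 2)

theorem continuous_tensorMonomial {n : ℕ} (i : Fin n → Fin 3) : Continuous (tensorMonomial i) := by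
  unfold tensorMonomial
  fun_prop

theorem inner_pow_eq_sum (n : ℕ) (p q : E3) :
    (inner ℝ p q) ^ n = ∑ i : Fin n → Fin 3, tensorMonomial i p * tensorMonomial i q := by
  have h : inner ℝ p q = ∑ a : Fin 3, p a * q a := by
    rw [PiLp.inner_apply]
    refine Finset.sum_congr rfl fun a _ => ?_
    simp [mul_comm]
  rw [h, Fintype.sum_pow]
  refine Finset.sum_congr rfl fun i _ => ?_
  rw [tensorMonomial, tensorMonomial, ← Finset.prod_mul_distrib]

theorem abs_tensorMonomial_le {n : ℕ} (i : Fin n → Fin 3) (p : E3) :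
    |tensorMonomial i p| ≤ ‖p‖ ^ n := by
  rw [tensorMonomial, Finset.abs_prod]
  refine (Finset.prod_le_prod (fun _ _ => abs_nonneg _)
    fun k _ => PiLp.norm_apply_le p (i k)).trans ?_
  simp

theorem integrableOn_pow_mul_exp_neg_sq (n : ℕ) :
    IntegrableOn (fun y : ℝ => y ^ n * Real.exp (-y ^ 2)) (Set.Ioi 0) := by
  have h := integrableOn_rpow_mul_exp_neg_rpow (p := 2) (s := n)
    (by have : (0 : ℝ) ≤ n := Nat.cast_nonneg n
        linarith) (by norm_num)
  simpa using h

theorem integral_pow_mul_exp_neg_sq_add_two (n : ℕ) :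
    ∫ y in Set.Ioi (0 : ℝ), y ^ (n + 2) * Real.exp (-y ^ 2) =
      ((n : ℝ) + 1) / 2 * ∫ y in Set.Ioi (0 : ℝ), y ^ n * Real.exp (-y ^ 2) := by
  have hn : (0 : ℝ) ≤ n := Nat.cast_nonneg n
  have h1 := integral_rpow_mul_exp_neg_rpow (p := 2) (q := n) (by norm_num) (by linarith)
  have h2 := integral_rpow_mul_exp_neg_rpow (p := 2) (q := (n + 2 : ℕ)) (by norm_num)
    (by push_cast; linarith)
  simp only [Real.rpow_natCast, Real.rpow_two] at h1 h2
  rw [h1, h2]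
  push_cast
  rw [show ((n : ℝ) + 2 + 1) / 2 = ((n : ℝ) + 1) / 2 + 1 by ring,
    Real.Gamma_add_one (by positivity)]
  ring

theorem integrable_norm_pow_mul_exp (n : ℕ) :
    Integrable (fun ω : E3 => ‖ω‖ ^ n * Real.exp (-‖ω‖ ^ 2)) := by
  rw [integrable_radial_E3_iff (fun y => y ^ n * Real.exp (-y ^ 2))]
  refine (integrableOn_pow_mul_exp_neg_sq (n + 2)).congr_fun (fun y _ => ?_) measurableSet_Ioi
  simp only
  ring

theorem integrable_tensorMonomial_mul_exp {n : ℕ} (i : Fin n → Fin 3) :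
    Integrable (fun ω : E3 => tensorMonomial i ω * Real.exp (-‖ω‖ ^ 2)) := by
  refine (integrable_norm_pow_mul_exp n).mono
    ((continuous_tensorMonomial i).mul (by fun_prop)).aestronglyMeasurable (ae_of_all _ fun ω => ?_)
  rw [norm_mul, norm_mul, norm_pow, norm_norm]
  gcongr
  exact abs_tensorMonomial_le i ω

theorem integral_inner_pow_mul_exp (n : ℕ) (p : E3) :
    ∫ ω : E3, (inner ℝ p ω) ^ n * Real.exp (-‖ω‖ ^ 2) =
      ‖p‖ ^ n * ∫ ω : E3, (ω 0) ^ n * Real.exp (-‖ω‖ ^ 2) := by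
  set e : E3 := EuclideanSpace.single 0 1 with he
  have hen : ‖(‖p‖ • e)‖ = ‖p‖ := by
    rw [norm_smul, he, PiLp.norm_single]
    simp
  -- The reflection carrying |p| e₀ to p replaces p by a multiple of the first basis vector without
  -- changing the Gaussian.
  set U := (Submodule.span ℝ {‖p‖ • e - p})ᗮ.reflection with hU
  have hUe : U (‖p‖ • e) = p := Submodule.reflection_sub hen
  have h1 := (U.measurePreserving).integral_comp U.toHomeomorph.measurableEmbedding
    (fun ω : E3 => (inner ℝ p ω) ^ n * Real.exp (-‖ω‖ ^ 2))
  rw [← h1, ← integral_const_mul]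
  refine integral_congr_ae (ae_of_all _ fun ω => ?_)
  simp only
  have h2 : inner ℝ p (U ω) = ‖p‖ * ω 0 := by
    rw [← hUe, LinearIsometryEquiv.inner_map_map, hUe, inner_smul_left, he,
      EuclideanSpace.inner_single_left]
    simp
  rw [h2, LinearIsometryEquiv.norm_map]
  ring

/-- The number 1/(2m+1) is the mean of cos²ᵐ over the sphere. Gaussian moments give it without
spherical integration: the Gaussian factorises over the coordinates, and the radial factor r² raises
the one-dimensional moment by one step of the Gamma recursion. -/
theorem gaussian_moment_ratio (m : ℕ) :
    (2 * (m : ℝ) + 1) * ∫ ω : E3, (ω 0) ^ (2 * m) * Real.exp (-‖ω‖ ^ 2) =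
      ∫ ω : E3, ‖ω‖ ^ (2 * m) * Real.exp (-‖ω‖ ^ 2) := by
  rw [integral_radial_E3 (fun y => y ^ (2 * m) * Real.exp (-y ^ 2))]
  have h1 : ∫ y in Set.Ioi (0 : ℝ), y ^ 2 * (y ^ (2 * m) * Real.exp (-y ^ 2)) =
      (2 * (m : ℝ) + 1) / 2 * ∫ y in Set.Ioi (0 : ℝ), y ^ (2 * m) * Real.exp (-y ^ 2) := by
    have := integral_pow_mul_exp_neg_sq_add_two (2 * m)
    push_cast at this
    rw [← this]
    congr 1 with y
    ring
  rw [h1]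
  have h2 : ∫ ω : E3, (ω 0) ^ (2 * m) * Real.exp (-‖ω‖ ^ 2) =
      ∏ a : Fin 3, ∫ y : ℝ, (if a = 0 then y ^ (2 * m) else 1) * Real.exp (-y ^ 2) := by
    rw [← integral_fintype_prod_volume_eq_prod]
    rw [← (EuclideanSpace.volume_preserving_symm_measurableEquiv_toLp (Fin 3)).symm.integral_comp
      (MeasurableEquiv.measurableEmbedding _)]
    refine integral_congr_ae (ae_of_all _ fun ω => ?_)
    simp [Fin.prod_univ_three, EuclideanSpace.norm_sq_eq, Fin.sum_univ_three, Real.exp_add]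
    ring
  have h3 : ∫ y : ℝ, y ^ (2 * m) * Real.exp (-y ^ 2) =
      2 * ∫ y in Set.Ioi (0 : ℝ), y ^ (2 * m) * Real.exp (-y ^ 2) := by
    rw [← integral_comp_abs (f := fun y => y ^ (2 * m) * Real.exp (-y ^ 2))]
    congr 1 with y
    rw [sq_abs, (even_two_mul m).pow_abs]
  have h4 : ∫ y : ℝ, Real.exp (-y ^ 2) = √Real.pi := by
    simpa using integral_gaussian 1
  rw [h2, Fin.prod_univ_three]
  simp only [if_true, one_mul, show (1 : Fin 3) ≠ 0 by decide, show (2 : Fin 3) ≠ 0 by decide,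
    if_false, h3, h4]
  have := Real.mul_self_sqrt Real.pi_pos.le
  linear_combination (2 * (m : ℝ) + 1) * 2 *
    (∫ y in Set.Ioi (0 : ℝ), y ^ (2 * m) * Real.exp (-y ^ 2)) * this

theorem sum_tensorMoment_mul {n : ℕ} (p : E3) :
    ∑ i : Fin n → Fin 3, tensorMonomial i p * tensorMoment i =
      ‖p‖ ^ n * ∫ ω : E3, (ω 0) ^ n * Real.exp (-‖ω‖ ^ 2) := by
  rw [← integral_inner_pow_mul_exp]
  simp only [inner_pow_eq_sum, tensorMoment, ← integral_const_mul, Finset.sum_mul]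
  rw [integral_finsetSum]
  · refine Finset.sum_congr rfl fun i _ => ?_
    congr 1 with ω
    ring
  · intro i _
    refine ((integrable_tensorMonomial_mul_exp i).const_mul (tensorMonomial i p)).congr
      (ae_of_all _ fun ω => ?_)
    simp only
    ring

theorem sum_tensorMoment_sq (n : ℕ) :
    ∑ i : Fin n → Fin 3, tensorMoment i * tensorMoment i =
      (∫ ω : E3, ‖ω‖ ^ n * Real.exp (-‖ω‖ ^ 2)) *
        ∫ ω : E3, (ω 0) ^ n * Real.exp (-‖ω‖ ^ 2) := by
  have h1 : ∀ i : Fin n → Fin 3, tensorMoment i * tensorMoment i =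
      ∫ ω : E3, tensorMonomial i ω * tensorMoment i * Real.exp (-‖ω‖ ^ 2) := by
    intro i
    rw [show tensorMoment i * tensorMoment i =
      (∫ ω : E3, tensorMonomial i ω * Real.exp (-‖ω‖ ^ 2)) * tensorMoment i from rfl,
      ← integral_mul_const]
    congr 1 with ω
    ring
  simp_rw [h1]
  rw [← integral_finsetSum, ← integral_mul_const]
  · congr 1 with ω
    rw [← Finset.sum_mul, sum_tensorMoment_mul]
    ring
  · intro i _
    refine ((integrable_tensorMonomial_mul_exp i).mul_const (tensorMoment i)).congr
      (ae_of_all _ fun ω => ?_)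
    simp only
    ring

/-- The trace-free part of the tensor power `p^{⊗2m}`, as far as the rotation invariant tensors of
rank `2m` are concerned. -/
def tensorResidue {n : ℕ} (i : Fin n → Fin 3) (p : E3) : ℝ :=
  tensorMonomial i p - ‖p‖ ^ n * (tensorMoment i / ∫ ω : E3, ‖ω‖ ^ n * Real.exp (-‖ω‖ ^ 2))

/-- The residue is p^{⊗2m} minus its orthogonal projection onto the line of the Gaussian moment
tensor, so the Gram matrix loses exactly the product of the two projections. The moment identities
evaluate that product; the normalising constants cancel up to 1/(2m+1). -/
theorem sum_tensorResidue (m : ℕ) (p q : E3) :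
    ∑ i : Fin (2 * m) → Fin 3, tensorResidue i p * tensorResidue i q =
      (inner ℝ p q) ^ (2 * m) - (‖p‖ * ‖q‖) ^ (2 * m) / (2 * m + 1) := by
  have hc := gaussian_moment_ratio m
  have h1 := sum_tensorMoment_mul (n := 2 * m) p
  have h2 := sum_tensorMoment_mul (n := 2 * m) q
  have h3 := sum_tensorMoment_sq (2 * m)
  have hM : 0 < ∫ ω : E3, ‖ω‖ ^ (2 * m) * Real.exp (-‖ω‖ ^ 2) := by
    rw [integral_pos_iff_support_of_nonneg (fun ω => by positivity) (integrable_norm_pow_mul_exp _)]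
    refine lt_of_lt_of_le ?_ (measure_mono (s := Metric.ball (0 : E3) 1 \ {0}) fun ω hω => ?_)
    · rw [measure_sdiff_null (measure_singleton _)]
      exact Metric.measure_ball_pos _ _ one_pos
    · have : 0 < ‖ω‖ := norm_pos_iff.2 hω.2
      simp only [Function.mem_support]
      positivity
  set M := ∫ ω : E3, ‖ω‖ ^ (2 * m) * Real.exp (-‖ω‖ ^ 2) with hMdef
  set c := ∫ ω : E3, (ω 0) ^ (2 * m) * Real.exp (-‖ω‖ ^ 2) with hcdef
  have h4 : ∀ i : Fin (2 * m) → Fin 3, tensorResidue i p * tensorResidue i q =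
      tensorMonomial i p * tensorMonomial i q
      - ‖q‖ ^ (2 * m) / M * (tensorMonomial i p * tensorMoment i)
      - ‖p‖ ^ (2 * m) / M * (tensorMonomial i q * tensorMoment i)
      + ‖p‖ ^ (2 * m) * ‖q‖ ^ (2 * m) / M ^ 2 * (tensorMoment i * tensorMoment i) := by
    intro i
    simp only [tensorResidue, ← hMdef]
    ring
  simp_rw [h4]
  rw [Finset.sum_add_distrib, Finset.sum_sub_distrib, Finset.sum_sub_distrib, ← Finset.mul_sum,
    ← Finset.mul_sum, ← Finset.mul_sum, h1, h2, h3, ← inner_pow_eq_sum, ← hc, mul_pow]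
  have hc0 : c ≠ 0 := by
    rintro h
    rw [h, mul_zero] at hc
    exact hM.ne hc
  field_simp
  ring

theorem abs_tensorResidue_le {n : ℕ} (i : Fin n → Fin 3) (p : E3) :
    |tensorResidue i p| ≤
      (1 + |tensorMoment i / ∫ ω : E3, ‖ω‖ ^ n * Real.exp (-‖ω‖ ^ 2)|) * ‖p‖ ^ n := by
  refine (abs_sub _ _).trans ?_
  rw [abs_mul, abs_of_nonneg (by positivity : 0 ≤ ‖p‖ ^ n)]
  have := abs_tensorMonomial_le i p
  linarith

theorem measurable_tensorResidue {n : ℕ} (i : Fin n → Fin 3) : Measurable (tensorResidue i) := by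
  unfold tensorResidue
  exact (continuous_tensorMonomial i).measurable.sub (by fun_prop)

end TensorMoments

/-! ### Positivity of powers of p·p' over powers of p² + p'² + λ. -/

section PowerKernels

variable {f : E3 → ℂ}

theorem ae_pair_norm : ∀ᵐ z : E3 × E3, 0 < ‖z.1‖ ∧ 0 < ‖z.2‖ ∧ ‖z.1‖ ≠ ‖z.2‖ := by
  have h1 : ∀ᵐ z : E3 × E3, ‖z.1‖ ≠ ‖z.2‖ := by
    have hm : MeasurableSet {z : E3 × E3 | ‖z.1‖ = ‖z.2‖} :=
      measurableSet_eq_fun (by fun_prop) (by fun_prop)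
    rw [ae_iff]
    simp only [ne_eq, not_not]
    rw [Measure.volume_eq_prod, Measure.measure_prod_null hm]
    refine ae_of_all _ fun p => ?_
    have h2 : Prod.mk p ⁻¹' {z : E3 × E3 | ‖z.1‖ = ‖z.2‖} = Metric.sphere 0 ‖p‖ := by
      ext q
      simp [eq_comm]
    simp only [h2]
    exact Measure.addHaar_sphere _ _ _
  filter_upwards [h1, ae_pair_ne_zero] with z h2 h3
  exact ⟨norm_pos_iff.2 h3.1, norm_pos_iff.2 h3.2, h2⟩

/-- Integrability is read off from the value: the integral of a non-integrable function is zero by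
convention, and this one is not zero. -/
theorem integral_laplace_pow (n : ℕ) {s : ℝ} (hs : 0 < s) :
    IntegrableOn (fun t : ℝ => t ^ n / n.factorial * Real.exp (-(t * s))) (Set.Ioi 0) ∧
      ∫ t in Set.Ioi (0 : ℝ), t ^ n / n.factorial * Real.exp (-(t * s)) = 1 / s ^ (n + 1) := by
  have h := Real.integral_rpow_mul_exp_neg_mul_Ioi (a := n + 1) (r := s) (by positivity) hs
  have hf0 : (n.factorial : ℝ) ≠ 0 := by positivity
  have h1 : ∫ t in Set.Ioi (0 : ℝ), t ^ n / n.factorial * Real.exp (-(t * s)) =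
      1 / s ^ (n + 1) := by
    have h2 : ∀ t : ℝ, t ^ n / n.factorial * Real.exp (-(t * s)) =
        (n.factorial : ℝ)⁻¹ * (t ^ ((n : ℝ) + 1 - 1) * Real.exp (-(s * t))) := by
      intro t
      rw [add_sub_cancel_right, Real.rpow_natCast, mul_comm t s]
      field_simp
    simp_rw [h2]
    rw [integral_const_mul, h, Real.Gamma_nat_eq_factorial]
    rw [show ((n : ℝ) + 1) = ((n + 1 : ℕ) : ℝ) by push_cast; ring, Real.rpow_natCast, div_pow, one_pow]
    field_simp
  refine ⟨?_, h1⟩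
  by_contra hc
  rw [integral_undef hc] at h1
  have : 0 < 1 / s ^ (n + 1) := by positivity
  exact this.ne h1

theorem measurable_tensor_laplace {φ : E3 → ℝ} (hφ : Measurable φ) {ν : ℝ → ℝ}
    (hν : Measurable ν) (n : ℕ) : Measurable (Function.uncurry fun (t : ℝ) (p : E3) =>
      √(t ^ n / n.factorial * ν t) * Real.exp (-(t * ‖p‖ ^ 2)) * φ p) := by
  unfold Function.uncurry
  simp only
  refine ((Measurable.sqrt ?_).mul (by fun_prop)).mul (hφ.comp measurable_snd)
  exact Measurable.mul (by fun_prop) (hν.comp measurable_fst)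

theorem norm_sub_sq_le_two_mul (p q : E3) : ‖p - q‖ ^ 2 ≤ 2 * (‖p‖ ^ 2 + ‖q‖ ^ 2) := by
  have h := norm_sub_le p q
  nlinarith [sq_nonneg (‖p‖ - ‖q‖), norm_nonneg (p - q), norm_nonneg p, norm_nonneg q]

/-- Laplace transforms of Gaussians against rank one tensors. -/
theorem KernelNonneg.of_laplace {φ : E3 → ℝ} (hφ : Measurable φ) {C : ℝ} {n : ℕ}
    (hφb : ∀ p, |φ p| ≤ C * ‖p‖ ^ n) {ν : ℝ → ℝ} (hν : Measurable ν)
    (h0 : ∀ t, 0 < t → 0 ≤ ν t) (h1 : ∀ t, 0 < t → ν t ≤ 1) (hf : AEStronglyMeasurable f)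
    (hN : Integrable (fun p : E3 => ‖p‖ * ‖f p‖ ^ 2)) :
    KernelNonneg f (fun z => φ z.1 * φ z.2 * ∫ t in Set.Ioi (0 : ℝ),
      t ^ n / n.factorial * ν t * Real.exp (-(t * (‖z.1‖ ^ 2 + ‖z.2‖ ^ 2)))) := by
  -- For fixed t the integrand is a rank one kernel, because the Gaussian in p² + p'² factorises and
  -- the weight is split by its square root.
  have hg : ∀ t ∈ Set.Ioi (0 : ℝ), ∀ z : E3 × E3,
      (√(t ^ n / n.factorial * ν t) * Real.exp (-(t * ‖z.1‖ ^ 2)) * φ z.1) *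
      (√(t ^ n / n.factorial * ν t) * Real.exp (-(t * ‖z.2‖ ^ 2)) * φ z.2) =
      φ z.1 * φ z.2 *
        (t ^ n / n.factorial * ν t * Real.exp (-(t * (‖z.1‖ ^ 2 + ‖z.2‖ ^ 2)))) := by
    intro t ht z
    have ht' : (0 : ℝ) < t := ht
    have hv := h0 t ht'
    have h2 := Real.mul_self_sqrt (show 0 ≤ t ^ n / n.factorial * ν t by positivity)
    rw [mul_add, neg_add, Real.exp_add]
    linear_combination (Real.exp (-(t * ‖z.1‖ ^ 2)) * Real.exp (-(t * ‖z.2‖ ^ 2)) *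
      φ z.1 * φ z.2) * h2
  have hint : ∀ z : E3 × E3, 0 < ‖z.1‖ → IntegrableOn (fun t : ℝ =>
      t ^ n / n.factorial * ν t * Real.exp (-(t * (‖z.1‖ ^ 2 + ‖z.2‖ ^ 2)))) (Set.Ioi 0) := by
    intro z hz
    have ha : 0 < ‖z.1‖ ^ 2 + ‖z.2‖ ^ 2 := by positivity
    refine (integral_laplace_pow n ha).1.mono' ?_ ?_
    · exact (Measurable.mul (Measurable.mul (by fun_prop) hν) (by fun_prop)).aestronglyMeasurable
    · filter_upwards [ae_restrict_mem measurableSet_Ioi] with t ht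
      have ht' : (0 : ℝ) < t := ht
      have hv := h0 t ht'
      rw [Real.norm_eq_abs, abs_of_nonneg (by positivity)]
      have : t ^ n / n.factorial * ν t ≤ t ^ n / n.factorial :=
        mul_le_of_le_one_right (by positivity) (h1 t ht')
      gcongr
  -- The same n bounds the growth of φ and is the power of t. After the t-integration, the bound
  -- (|p||p'|)ⁿ ≤ (p² + p'²)ⁿ leaves a multiple of 1/(p² + p'²), hence of |p - p'|⁻².
  refine KernelNonneg.of_gram (μ := volume.restrict (Set.Ioi (0 : ℝ))) hf
    (measurable_tensor_laplace hφ hν n)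
    ((kernelConverges_inv_sq_sub hf hN).1.const_mul (2 * C ^ 2)) ?_ ?_ ?_
  · filter_upwards [ae_pair_norm] with z hz
    refine (((hint z hz.1).const_mul (φ z.1 * φ z.2))).congr ?_
    filter_upwards [ae_restrict_mem measurableSet_Ioi] with t ht
    rw [hg t ht]
  · filter_upwards [ae_pair_norm] with z hz
    have ha : 0 < ‖z.1‖ ^ 2 + ‖z.2‖ ^ 2 := by have := hz.1; positivity
    have hne : 0 < ‖z.1 - z.2‖ := norm_pos_iff.2 (sub_ne_zero.2 fun h => hz.2.2 (by rw [h]))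
    have h2 : ∫ t in Set.Ioi (0 : ℝ), |(√(t ^ n / n.factorial * ν t) *
          Real.exp (-(t * ‖z.1‖ ^ 2)) * φ z.1) *
        (√(t ^ n / n.factorial * ν t) * Real.exp (-(t * ‖z.2‖ ^ 2)) * φ z.2)| ≤
        |φ z.1 * φ z.2| * (1 / (‖z.1‖ ^ 2 + ‖z.2‖ ^ 2) ^ (n + 1)) := by
      rw [← (integral_laplace_pow n ha).2, ← integral_const_mul]
      refine setIntegral_mono_on ?_ ((integral_laplace_pow n ha).1.const_mul _)
        measurableSet_Ioi fun t ht => ?_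
      · refine (((hint z hz.1).const_mul (φ z.1 * φ z.2)).abs).congr ?_
        filter_upwards [ae_restrict_mem measurableSet_Ioi] with t ht
        rw [hg t ht]
      · have ht' : (0 : ℝ) < t := ht
        have hv := h0 t ht'
        rw [hg t ht, abs_mul]
        rw [abs_of_nonneg (a := t ^ n / n.factorial * ν t * _) (by positivity)]
        have : t ^ n / n.factorial * ν t ≤ t ^ n / n.factorial :=
          mul_le_of_le_one_right (by positivity) (h1 t ht')
        gcongr
    refine h2.trans ?_
    have h3 : |φ z.1 * φ z.2| ≤ C ^ 2 * (‖z.1‖ * ‖z.2‖) ^ n := by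
      rw [abs_mul]
      refine (mul_le_mul (hφb z.1) (hφb z.2) (abs_nonneg _)
        ((abs_nonneg _).trans (hφb z.1))).trans (le_of_eq ?_)
      rw [mul_pow]
      ring
    have h4 : (‖z.1‖ * ‖z.2‖) ^ n ≤ (‖z.1‖ ^ 2 + ‖z.2‖ ^ 2) ^ n := by
      refine pow_le_pow_left₀ (by positivity) ?_ n
      nlinarith [sq_nonneg (‖z.1‖ - ‖z.2‖), sq_nonneg ‖z.1‖, sq_nonneg ‖z.2‖]
    have h5 := norm_sub_sq_le_two_mul z.1 z.2
    calc |φ z.1 * φ z.2| * (1 / (‖z.1‖ ^ 2 + ‖z.2‖ ^ 2) ^ (n + 1))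
        ≤ (C ^ 2 * (‖z.1‖ ^ 2 + ‖z.2‖ ^ 2) ^ n) * (1 / (‖z.1‖ ^ 2 + ‖z.2‖ ^ 2) ^ (n + 1)) := by
          gcongr
          exact h3.trans (by gcongr)
      _ = C ^ 2 * (1 / (‖z.1‖ ^ 2 + ‖z.2‖ ^ 2)) := by
          field_simp
          ring
      _ ≤ C ^ 2 * (2 / ‖z.1 - z.2‖ ^ 2) := by
          refine mul_le_mul_of_nonneg_left ?_ (sq_nonneg C)
          rw [div_le_div_iff₀ ha (by positivity)]
          linarith
      _ = _ := by ring
  · refine ae_of_all _ fun z => ?_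
    rw [← integral_const_mul]
    refine setIntegral_congr_fun measurableSet_Ioi fun t ht => ?_
    exact (hg t ht z).symm

theorem laplace_exp_weight (n : ℕ) {lam s : ℝ} (hl : 0 ≤ lam) (hs : 0 < s) :
    ∫ t in Set.Ioi (0 : ℝ), t ^ n / n.factorial * Real.exp (-(t * lam)) * Real.exp (-(t * s)) =
      1 / (s + lam) ^ (n + 1) := by
  rw [← (integral_laplace_pow n (by linarith : 0 < s + lam)).2]
  congr 1 with t
  rw [mul_assoc, ← Real.exp_add]
  ring_nf

/-- The weight 1 - e^{-tλ} lies between 0 and 1, which is what makes the forms of the power kernels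
monotone in λ. -/
theorem laplace_one_sub_exp_weight (n : ℕ) {lam s : ℝ} (hl : 0 ≤ lam) (hs : 0 < s) :
    ∫ t in Set.Ioi (0 : ℝ), t ^ n / n.factorial * (1 - Real.exp (-(t * lam))) *
      Real.exp (-(t * s)) = 1 / s ^ (n + 1) - 1 / (s + lam) ^ (n + 1) := by
  rw [← (integral_laplace_pow n (by linarith : 0 < s + lam)).2, ← (integral_laplace_pow n hs).2,
    ← integral_sub (integral_laplace_pow n hs).1 (integral_laplace_pow n (by linarith)).1]
  congr 1 with t
  rw [mul_add t s lam, neg_add, Real.exp_add]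
  ring

theorem exp_neg_mul_le_one {lam t : ℝ} (hl : 0 ≤ lam) (ht : 0 < t) :
    Real.exp (-(t * lam)) ≤ 1 := by
  rw [Real.exp_le_one_iff]
  have := mul_nonneg ht.le hl
  linarith

/-- The kernels `(p·p')ⁿ / (p² + p'² + λ)ⁿ⁺¹` are nonnegative. -/
theorem kernelNonneg_pow (hf : AEStronglyMeasurable f)
    (hN : Integrable (fun p : E3 => ‖p‖ * ‖f p‖ ^ 2)) (n : ℕ) {lam : ℝ} (hl : 0 ≤ lam) :
    KernelNonneg f (fun z => (inner ℝ z.1 z.2) ^ n / (‖z.1‖ ^ 2 + ‖z.2‖ ^ 2 + lam) ^ (n + 1)) := by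
  refine (KernelNonneg.sum (Finset.univ : Finset (Fin n → Fin 3)) hf fun i _ =>
    KernelNonneg.of_laplace (n := n) (ν := fun t => Real.exp (-(t * lam)))
      (continuous_tensorMonomial i).measurable
      (fun p => (abs_tensorMonomial_le i p).trans_eq (one_mul _).symm) (by fun_prop)
      (fun t _ => by positivity) (fun t ht => exp_neg_mul_le_one hl ht) hf hN).congr ?_
  filter_upwards [ae_pair_norm] with z hz
  rw [← Finset.sum_mul, ← inner_pow_eq_sum,
    laplace_exp_weight n hl (by have := hz.1; positivity)]
  ring

/-- The kernels of `kernelNonneg_pow` decrease with `λ`. -/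
theorem kernelNonneg_pow_sub (hf : AEStronglyMeasurable f)
    (hN : Integrable (fun p : E3 => ‖p‖ * ‖f p‖ ^ 2)) (n : ℕ) {lam : ℝ} (hl : 0 ≤ lam) :
    KernelNonneg f (fun z => (inner ℝ z.1 z.2) ^ n / (‖z.1‖ ^ 2 + ‖z.2‖ ^ 2) ^ (n + 1) -
      (inner ℝ z.1 z.2) ^ n / (‖z.1‖ ^ 2 + ‖z.2‖ ^ 2 + lam) ^ (n + 1)) := by
  refine (KernelNonneg.sum (Finset.univ : Finset (Fin n → Fin 3)) hf fun i _ =>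
    KernelNonneg.of_laplace (n := n) (ν := fun t => 1 - Real.exp (-(t * lam)))
      (continuous_tensorMonomial i).measurable
      (fun p => (abs_tensorMonomial_le i p).trans_eq (one_mul _).symm) (by fun_prop)
      (fun t ht => sub_nonneg.2 (exp_neg_mul_le_one hl ht))
      (fun t ht => by have := Real.exp_pos (-(t * lam)); linarith) hf hN).congr ?_
  filter_upwards [ae_pair_norm] with z hz
  rw [← Finset.sum_mul, ← inner_pow_eq_sum,
    laplace_one_sub_exp_weight n hl (by have := hz.1; positivity)]
  ring

/-- The kernels `(p·p')²ᵐ / (p² + p'²)²ᵐ⁺¹` are bounded from below by their angular averages. -/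
theorem kernelNonneg_residue (hf : AEStronglyMeasurable f)
    (hN : Integrable (fun p : E3 => ‖p‖ * ‖f p‖ ^ 2)) (m : ℕ) :
    KernelNonneg f (fun z => ((inner ℝ z.1 z.2) ^ (2 * m) -
      (‖z.1‖ * ‖z.2‖) ^ (2 * m) / (2 * m + 1)) / (‖z.1‖ ^ 2 + ‖z.2‖ ^ 2) ^ (2 * m + 1)) := by
  refine (KernelNonneg.sum (Finset.univ : Finset (Fin (2 * m) → Fin 3)) hf fun i _ =>
    KernelNonneg.of_laplace (n := 2 * m) (ν := fun t => 1) (measurable_tensorResidue i)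
      (abs_tensorResidue_le i) (by fun_prop) (fun t _ => zero_le_one)
      (fun t _ => le_rfl) hf hN).congr ?_
  filter_upwards [ae_pair_norm] with z hz
  have ha : 0 < ‖z.1‖ ^ 2 + ‖z.2‖ ^ 2 := by have := hz.1; positivity
  rw [← Finset.sum_mul, sum_tensorResidue]
  simp only [mul_one]
  rw [(integral_laplace_pow (2 * m) ha).2]
  ring

end PowerKernels

/-! ### The radial kernels 3ρ³ʲ - ρʲ. -/

section RadialKernels

variable {f : E3 → ℂ}

/-- The overlap integral of the vectors that realise 3ρ³ - ρ as a Gram kernel. Such vectors exist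
because, with ρ = e^{-|t|}, the Fourier transform of 3ρ³ - ρ in t is 16k²/((k² + 9)(k² + 1)). It
vanishes at k = 0, so the coefficient 3 cannot be lowered. -/
theorem integral_swave_polynomial {m R : ℝ} (hR : 0 < R) :
    ∫ s in (0 : ℝ)..(1 / R), (9 * (m * R) ^ 3 * s ^ 5 - 3 * (m * R) * (m ^ 2 + R ^ 2) * s ^ 3 +
      m * R * s) = (3 * (m / R) ^ 3 - m / R) / 4 := by
  rw [intervalIntegral.integral_add, intervalIntegral.integral_sub,
    intervalIntegral.integral_const_mul, intervalIntegral.integral_const_mul,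
    intervalIntegral.integral_const_mul, integral_pow, integral_pow, integral_id]
  · norm_num
    field_simp
    ring
  all_goals exact Continuous.intervalIntegrable (by fun_prop) _ _

theorem integral_linear {c R : ℝ} (hR : 0 < R) :
    ∫ s in (0 : ℝ)..(1 / R), c * s = c / (2 * R ^ 2) := by
  rw [intervalIntegral.integral_const_mul, integral_id]
  field_simp
  ring

/-- The ratio of the smaller to the larger of the two radii. -/
noncomputable def radiusRatio (z : E3 × E3) : ℝ := min ‖z.1‖ ‖z.2‖ / max ‖z.1‖ ‖z.2‖

/-- Gram vectors for `3 ρ³ʲ - ρʲ`. -/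
noncomputable def swaveVector (j : ℕ) (s : ℝ) (p : E3) : ℝ :=
  if ‖p‖ ^ j * s < 1 then 2 / ‖p‖ * (3 * (‖p‖ ^ j) ^ 3 * s ^ 2 - ‖p‖ ^ j) * √s else 0

theorem measurable_swaveVector (j : ℕ) : Measurable (Function.uncurry (swaveVector j)) := by
  unfold Function.uncurry swaveVector
  refine Measurable.ite (measurableSet_lt (by fun_prop) (by fun_prop)) ?_ measurable_const
  exact Measurable.mul (Measurable.mul (measurable_const.div (by fun_prop)) (by fun_prop))
    (by fun_prop)

/-- The larger radius decides the support of the product, and the polynomial depends on the two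
radii only through symmetric expressions, which may be written in minimum and maximum. The bound
|3Q³s² - Q| ≤ 4Q on Qs < 1 gives the constant 64. -/
theorem swaveVector_mul (j : ℕ) {s : ℝ} (hs : 0 < s) (z : E3 × E3) (h1 : 0 < ‖z.1‖)
    (h2 : 0 < ‖z.2‖) {m R : ℝ} (hm : m = min ‖z.1‖ ‖z.2‖ ^ j) (hR : R = max ‖z.1‖ ‖z.2‖ ^ j) :
    swaveVector j s z.1 * swaveVector j s z.2 = (Set.Iio (1 / R)).indicator
      (fun s => 4 / (‖z.1‖ * ‖z.2‖) * (9 * (m * R) ^ 3 * s ^ 5 -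
        3 * (m * R) * (m ^ 2 + R ^ 2) * s ^ 3 + m * R * s)) s ∧
    |swaveVector j s z.1 * swaveVector j s z.2| ≤ (Set.Iio (1 / R)).indicator
      (fun s => 64 / (‖z.1‖ * ‖z.2‖) * (m * R) * s) s := by
  have hss := Real.mul_self_sqrt hs.le
  have hR0 : 0 < R := by rw [hR]; exact pow_pos (lt_max_of_lt_left h1) j
  have hm0 : 0 < m := by rw [hm]; exact pow_pos (lt_min h1 h2) j
  have hprod : ‖z.1‖ ^ j * ‖z.2‖ ^ j = m * R := by
    rw [hm, hR, ← mul_pow, ← mul_pow, min_mul_max]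
  have hsum : (‖z.1‖ ^ j) ^ 2 + (‖z.2‖ ^ j) ^ 2 = m ^ 2 + R ^ 2 := by
    rw [hm, hR]
    rcases le_total ‖z.1‖ ‖z.2‖ with h | h
    · simp [h]
    · simp [h, add_comm]
  have hmax : ‖z.1‖ ^ j ≤ R ∧ ‖z.2‖ ^ j ≤ R := by
    rw [hR]
    exact ⟨pow_le_pow_left₀ h1.le (le_max_left _ _) j, pow_le_pow_left₀ h2.le (le_max_right _ _) j⟩
  have hmem : s ∈ Set.Iio (1 / R) ↔ R * s < 1 := by
    rw [Set.mem_Iio, lt_div_iff₀ hR0, mul_comm]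
  by_cases hRs : R * s < 1
  · have hp1 : ‖z.1‖ ^ j * s < 1 := (mul_le_mul_of_nonneg_right hmax.1 hs.le).trans_lt hRs
    have hp2 : ‖z.2‖ ^ j * s < 1 := (mul_le_mul_of_nonneg_right hmax.2 hs.le).trans_lt hRs
    rw [Set.indicator_of_mem (hmem.2 hRs), Set.indicator_of_mem (hmem.2 hRs), swaveVector,
      swaveVector, if_pos hp1, if_pos hp2]
    set P := ‖z.1‖ ^ j with hP
    set P' := ‖z.2‖ ^ j with hP'
    have hP0 : 0 < P := by positivity
    have hP0' : 0 < P' := by positivity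
    have e : 2 / ‖z.1‖ * (3 * P ^ 3 * s ^ 2 - P) * √s *
        (2 / ‖z.2‖ * (3 * P' ^ 3 * s ^ 2 - P') * √s) =
        4 / (‖z.1‖ * ‖z.2‖) * ((3 * P ^ 3 * s ^ 2 - P) * (3 * P' ^ 3 * s ^ 2 - P') * s) := by
      linear_combination 4 / (‖z.1‖ * ‖z.2‖) * (3 * P ^ 3 * s ^ 2 - P) *
        (3 * P' ^ 3 * s ^ 2 - P') * hss
    rw [e]
    constructor
    · congr 1
      rw [← hprod, ← hsum]
      ring
    · have b : ∀ Q : ℝ, 0 < Q → Q * s < 1 → |3 * Q ^ 3 * s ^ 2 - Q| ≤ 4 * Q := by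
        intro Q hQ hQs
        have h3 : (Q * s) ^ 2 ≤ 1 := by
          have := mul_pos hQ hs
          nlinarith
        have h4 : 3 * Q ^ 3 * s ^ 2 - Q = Q * (3 * (Q * s) ^ 2 - 1) := by ring
        rw [h4, abs_mul, abs_of_pos hQ, mul_comm 4 Q]
        refine mul_le_mul_of_nonneg_left ?_ hQ.le
        rw [abs_le]
        constructor <;> nlinarith [sq_nonneg (Q * s)]
      rw [abs_mul, abs_mul, abs_mul, abs_of_pos hs,
        abs_of_nonneg (by positivity : 0 ≤ 4 / (‖z.1‖ * ‖z.2‖)), ← hprod]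
      calc 4 / (‖z.1‖ * ‖z.2‖) * (|3 * P ^ 3 * s ^ 2 - P| * |3 * P' ^ 3 * s ^ 2 - P'| * s)
          ≤ 4 / (‖z.1‖ * ‖z.2‖) * ((4 * P) * (4 * P') * s) := by
            gcongr
            · exact b P hP0 hp1
            · exact b P' hP0' hp2
        _ = _ := by ring
  · have hor : ¬ (‖z.1‖ ^ j * s < 1) ∨ ¬ (‖z.2‖ ^ j * s < 1) := by
      rw [hR] at hRs
      rcases le_total ‖z.1‖ ‖z.2‖ with h | h
      · rw [max_eq_right h] at hRs; exact Or.inr hRs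
      · rw [max_eq_left h] at hRs; exact Or.inl hRs
    have h0 : swaveVector j s z.1 * swaveVector j s z.2 = 0 := by
      rcases hor with h | h
      · rw [swaveVector, if_neg h, zero_mul]
      · rw [mul_comm, swaveVector, if_neg h, zero_mul]
    rw [h0, Set.indicator_of_notMem (fun h => hRs (hmem.1 h)),
      Set.indicator_of_notMem (fun h => hRs (hmem.1 h))]
    simp

theorem setIntegral_Ioi_indicator_Iio {c : ℝ} (hc : 0 < c) (h : ℝ → ℝ) :
    ∫ s in Set.Ioi (0 : ℝ), (Set.Iio c).indicator h s = ∫ s in (0 : ℝ)..c, h s := by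
  rw [integral_indicator measurableSet_Iio, Measure.restrict_restrict measurableSet_Iio,
    intervalIntegral.integral_of_le hc.le, integral_Ioc_eq_integral_Ioo, Set.inter_comm,
    Set.Ioi_inter_Iio]

theorem integrableOn_Ioi_indicator_Iio {c : ℝ} {h : ℝ → ℝ} (hh : Continuous h) :
    IntegrableOn ((Set.Iio c).indicator h) (Set.Ioi 0) := by
  rw [IntegrableOn, integrable_indicator_iff measurableSet_Iio, IntegrableOn,
    Measure.restrict_restrict measurableSet_Iio, Set.inter_comm, Set.Ioi_inter_Iio]
  exact (hh.integrableOn_Icc (a := 0) (b := c)).mono_set Set.Ioo_subset_Icc_self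

/-- Positivity of `3 ρ³ʲ - ρʲ` on radial functions. -/
theorem kernelNonneg_swave (hf : AEStronglyMeasurable f) (j : ℕ)
    (hG : KernelConverges f (fun z => 1 / (‖z.1‖ * ‖z.2‖) * radiusRatio z ^ j)) :
    KernelNonneg f (fun z => 1 / (‖z.1‖ * ‖z.2‖) *
      (3 * radiusRatio z ^ (3 * j) - radiusRatio z ^ j)) := by
  -- The constant 32 is 64/2, from integrating s up to 1/R.
  refine KernelNonneg.of_gram (μ := volume.restrict (Set.Ioi (0 : ℝ))) hf
    (measurable_swaveVector j) (hG.const_mul 32) ?_ ?_ ?_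
  · filter_upwards [ae_pair_norm] with z hz
    refine (integrableOn_Ioi_indicator_Iio (c := 1 / (max ‖z.1‖ ‖z.2‖ ^ j))
      (h := fun s => 4 / (‖z.1‖ * ‖z.2‖) * (9 * (min ‖z.1‖ ‖z.2‖ ^ j * max ‖z.1‖ ‖z.2‖ ^ j) ^ 3 *
        s ^ 5 - 3 * (min ‖z.1‖ ‖z.2‖ ^ j * max ‖z.1‖ ‖z.2‖ ^ j) * ((min ‖z.1‖ ‖z.2‖ ^ j) ^ 2 +
        (max ‖z.1‖ ‖z.2‖ ^ j) ^ 2) * s ^ 3 + min ‖z.1‖ ‖z.2‖ ^ j * max ‖z.1‖ ‖z.2‖ ^ j * s))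
      (by fun_prop)).congr ?_
    filter_upwards [ae_restrict_mem measurableSet_Ioi] with s hs
    exact (swaveVector_mul j hs z hz.1 hz.2.1 rfl rfl).1.symm
  · filter_upwards [ae_pair_norm] with z hz
    have hmax : 0 < max ‖z.1‖ ‖z.2‖ ^ j := pow_pos (lt_max_of_lt_left hz.1) j
    refine (integral_mono_of_nonneg (ae_of_all _ fun s => abs_nonneg _) (integrableOn_Ioi_indicator_Iio
      (c := 1 / (max ‖z.1‖ ‖z.2‖ ^ j)) (h := fun s => 64 / (‖z.1‖ * ‖z.2‖) *
        (min ‖z.1‖ ‖z.2‖ ^ j * max ‖z.1‖ ‖z.2‖ ^ j) * s) (by fun_prop))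
        ((ae_restrict_mem measurableSet_Ioi).mono fun s hs =>
        (swaveVector_mul j hs z hz.1 hz.2.1 rfl rfl).2)).trans (le_of_eq ?_)
    rw [setIntegral_Ioi_indicator_Iio (by positivity), integral_linear hmax, radiusRatio, div_pow]
    field_simp
    ring
  · filter_upwards [ae_pair_norm] with z hz
    have hmax : 0 < max ‖z.1‖ ‖z.2‖ ^ j := pow_pos (lt_max_of_lt_left hz.1) j
    rw [setIntegral_congr_fun measurableSet_Ioi fun s hs =>
      (swaveVector_mul j hs z hz.1 hz.2.1 rfl rfl).1,
      setIntegral_Ioi_indicator_Iio (by positivity), intervalIntegral.integral_const_mul,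
      integral_swave_polynomial hmax, radiusRatio, ← div_pow, mul_comm 3 j, pow_mul]
    ring

end RadialKernels

/-! ### Domination of the off-diagonal kernel by the Coulomb kernel. -/

section STMInequality

variable {f : E3 → ℂ}

/-- `log ((1 + y) / (1 - y))`, twice the inverse hyperbolic tangent. -/
noncomputable def logRatio (y : ℝ) : ℝ := Real.log (1 + y) - Real.log (1 - y)

theorem HasSum.congr_eq {u v : ℕ → ℝ} {a : ℝ} (hu : HasSum u a) (h : ∀ n, v n = u n) :
    HasSum v a := by
  rwa [funext h]

theorem hasSum_logRatio {y : ℝ} (h : |y| < 1) :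
    HasSum (fun k : ℕ => 2 / (2 * (k : ℝ) + 1) * y ^ (2 * k + 1)) (logRatio y) := by
  refine (Real.hasSum_log_sub_log_of_abs_lt_one h).congr_eq fun k => ?_
  ring

theorem two_mul_abs_inner_lt {z : E3 × E3} (h : ‖z.1‖ ≠ ‖z.2‖) :
    2 * |inner ℝ z.1 z.2| < ‖z.1‖ ^ 2 + ‖z.2‖ ^ 2 := by
  have h1 := abs_real_inner_le_norm z.1 z.2
  have h2 : 0 < (‖z.1‖ - ‖z.2‖) ^ 2 := by
    have := sub_ne_zero.2 h
    positivity
  nlinarith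

theorem two_mul_norm_mul_lt {z : E3 × E3} (h : ‖z.1‖ ≠ ‖z.2‖) :
    2 * (‖z.1‖ * ‖z.2‖) < ‖z.1‖ ^ 2 + ‖z.2‖ ^ 2 := by
  have h2 : 0 < (‖z.1‖ - ‖z.2‖) ^ 2 := by
    have := sub_ne_zero.2 h
    positivity
  nlinarith

theorem norm_sub_sq_eq (z : E3 × E3) :
    ‖z.1 - z.2‖ ^ 2 = ‖z.1‖ ^ 2 + ‖z.2‖ ^ 2 - 2 * inner ℝ z.1 z.2 := by
  rw [norm_sub_sq_real]
  ring

theorem norm_add_sq_eq (z : E3 × E3) :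
    ‖z.1 + z.2‖ ^ 2 = ‖z.1‖ ^ 2 + ‖z.2‖ ^ 2 + 2 * inner ℝ z.1 z.2 := by
  rw [norm_add_sq_real]
  ring

/-- Geometric series in the form used for resolvent kernels. -/
theorem hasSum_geometric_kernel {a b : ℝ} (h : |b| < a) :
    HasSum (fun n : ℕ => b ^ n / a ^ (n + 1)) (1 / (a - b)) := by
  have ha : 0 < a := (abs_nonneg b).trans_lt h
  have h1 : |b / a| < 1 := by rw [abs_div, abs_of_pos ha, div_lt_one ha]; exact h
  have h2 := (hasSum_geometric_of_abs_lt_one h1).mul_left (1 / a)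
  have h3 : 0 < a - b := by linarith [le_abs_self b]
  have e : 1 / a * (1 - b / a)⁻¹ = 1 / (a - b) := by
    rw [one_sub_div ha.ne']
    field_simp
  rw [e] at h2
  refine h2.congr_eq fun n => ?_
  rw [div_pow, pow_succ]
  field_simp

theorem inv_sub_abs_le {a b : ℝ} (h : |b| < a) : 1 / (a - |b|) ≤ 1 / (a - b) + 1 / (a + b) := by
  have h1 : 0 < a - b := by linarith [le_abs_self b]
  have h2 : 0 < a + b := by linarith [neg_abs_le b]
  rcases abs_cases b with ⟨hb, _⟩ | ⟨hb, _⟩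
  · rw [hb]
    have : 0 < 1 / (a + b) := by positivity
    linarith
  · rw [hb, sub_neg_eq_add]
    have : 0 < 1 / (a - b) := by positivity
    linarith

/-- A bound uniform in the number of terms. With a = p² + p'² and b = 2 p·p' the right side is |p -
p'|⁻² + |p + p'|⁻², which serves as dominating kernel. -/
theorem sum_geometric_le {a b : ℝ} (h : |b| < a) (s : Finset ℕ) :
    ∑ n ∈ s, |b| ^ n / a ^ (n + 1) ≤ 1 / (a - b) + 1 / (a + b) := by
  have ha : 0 < a := (abs_nonneg b).trans_lt h
  refine (sum_le_hasSum s (fun n _ => by positivity)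
    (hasSum_geometric_kernel (a := a) (b := |b|) (by rwa [abs_abs]))).trans (inv_sub_abs_le h)

/-- Averaging a geometric series over the angle kills the odd powers and divides the power 2m by 2m
+ 1, which yields the odd logarithmic series. -/
theorem hasSum_angular_average {a w c : ℝ} (hw : 0 < w) (hc : 0 < c) (h : c * w < a) :
    HasSum (fun m : ℕ => (c * w) ^ (2 * m) / ((2 * m + 1) * a ^ (2 * m + 1)))
      (1 / (2 * c * w) * logRatio (c * w / a)) := by
  have ha : 0 < a := (by positivity : 0 < c * w).trans h
  have h1 : |c * w / a| < 1 := by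
    rw [abs_of_pos (by positivity), div_lt_one ha]
    exact h
  refine ((hasSum_logRatio h1).mul_left (1 / (2 * c * w))).congr_eq fun m => ?_
  rw [div_pow, pow_succ (c * w)]
  field_simp

/-- With ρ = m/R, the first argument gives 1 ± 2ρ/(1 + ρ²) = (1 ± ρ)²/(1 + ρ²). For the second, 1 ±
ρ + ρ² = (1 ∓ ρ³)/(1 ∓ ρ), and this is where the cubes come from. -/
theorem logRatio_two_mul_div {m R : ℝ} (hm : 0 < m) (h : m < R) :
    logRatio (2 * (m * R) / (m ^ 2 + R ^ 2)) = 2 * logRatio (m / R) ∧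
    logRatio (m * R / (m ^ 2 + R ^ 2)) = logRatio (m / R) - logRatio ((m / R) ^ 3) := by
  have hR : 0 < R := hm.trans h
  have ha : 0 < m ^ 2 + R ^ 2 := by positivity
  have h1 : 0 < R - m := sub_pos.2 h
  have h2 : 0 < R + m := by positivity
  have h3 : 0 < R ^ 2 + m * R + m ^ 2 := by positivity
  have h4 : 0 < R ^ 2 - m * R + m ^ 2 := by nlinarith
  have e1 : 1 + 2 * (m * R) / (m ^ 2 + R ^ 2) = (R + m) ^ 2 / (m ^ 2 + R ^ 2) := by
    field_simp
    ring
  have e2 : 1 - 2 * (m * R) / (m ^ 2 + R ^ 2) = (R - m) ^ 2 / (m ^ 2 + R ^ 2) := by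
    field_simp
    ring
  have e3 : 1 + m * R / (m ^ 2 + R ^ 2) = (R ^ 2 + m * R + m ^ 2) / (m ^ 2 + R ^ 2) := by
    field_simp
    ring
  have e4 : 1 - m * R / (m ^ 2 + R ^ 2) = (R ^ 2 - m * R + m ^ 2) / (m ^ 2 + R ^ 2) := by
    field_simp
    ring
  have e5 : 1 + m / R = (R + m) / R := by field_simp
  have e6 : 1 - m / R = (R - m) / R := by field_simp
  have e7 : 1 + (m / R) ^ 3 = (R + m) * (R ^ 2 - m * R + m ^ 2) / R ^ 3 := by
    field_simp
    ring
  have e8 : 1 - (m / R) ^ 3 = (R - m) * (R ^ 2 + m * R + m ^ 2) / R ^ 3 := by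
    field_simp
    ring
  simp only [logRatio, e1, e2, e3, e4, e5, e6, e7, e8]
  rw [Real.log_div (by positivity) ha.ne', Real.log_div (by positivity) ha.ne',
    Real.log_div h2.ne' hR.ne', Real.log_div h1.ne' hR.ne', Real.log_div h3.ne' ha.ne',
    Real.log_div h4.ne' ha.ne', Real.log_div (by positivity) (by positivity),
    Real.log_div (by positivity) (by positivity), Real.log_mul h2.ne' h4.ne',
    Real.log_mul h1.ne' h3.ne', Real.log_pow, Real.log_pow]
  constructor
  · push_cast
    ring
  · ring

theorem radiusRatio_spec {z : E3 × E3} (h : 0 < ‖z.1‖ ∧ 0 < ‖z.2‖ ∧ ‖z.1‖ ≠ ‖z.2‖) :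
    0 < radiusRatio z ∧ radiusRatio z < 1 ∧
    logRatio (2 * (‖z.1‖ * ‖z.2‖) / (‖z.1‖ ^ 2 + ‖z.2‖ ^ 2)) = 2 * logRatio (radiusRatio z) ∧
    logRatio (‖z.1‖ * ‖z.2‖ / (‖z.1‖ ^ 2 + ‖z.2‖ ^ 2)) =
      logRatio (radiusRatio z) - logRatio (radiusRatio z ^ 3) := by
  obtain ⟨h1, h2, h3⟩ := h
  rcases lt_or_gt_of_ne h3 with h | h
  · rw [radiusRatio, min_eq_left h.le, max_eq_right h.le]
    exact ⟨by positivity, (div_lt_one h2).2 h, logRatio_two_mul_div h1 h⟩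
  · rw [radiusRatio, min_eq_right h.le, max_eq_left h.le, mul_comm ‖z.1‖, add_comm (‖z.1‖ ^ 2)]
    exact ⟨by positivity, (div_lt_one h1).2 h, logRatio_two_mul_div h2 h⟩

theorem measurable_radiusRatio : Measurable radiusRatio := by
  unfold radiusRatio
  fun_prop

/-- The angular average of the kernel `(p² + p'²) / ((p² + p'²)² - 4 (p·p')²)`. -/
noncomputable def averagedKernel (z : E3 × E3) : ℝ :=
  1 / (4 * (‖z.1‖ * ‖z.2‖)) * logRatio (2 * (‖z.1‖ * ‖z.2‖) / (‖z.1‖ ^ 2 + ‖z.2‖ ^ 2))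

theorem measurable_averagedKernel : Measurable averagedKernel := by
  unfold averagedKernel logRatio
  exact (by fun_prop : Measurable fun z : E3 × E3 => 1 / (4 * (‖z.1‖ * ‖z.2‖))).mul
    ((Real.measurable_log.comp (by fun_prop)).sub (Real.measurable_log.comp (by fun_prop)))

theorem hasSum_averagedKernel {z : E3 × E3} (h : 0 < ‖z.1‖ ∧ 0 < ‖z.2‖ ∧ ‖z.1‖ ≠ ‖z.2‖) :
    HasSum (fun m : ℕ => 4 ^ m * ((‖z.1‖ * ‖z.2‖) ^ (2 * m) / (2 * m + 1) /
      (‖z.1‖ ^ 2 + ‖z.2‖ ^ 2) ^ (2 * m + 1))) (averagedKernel z) := by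
  have := hasSum_angular_average (mul_pos h.1 h.2.1) two_pos (two_mul_norm_mul_lt h.2.2)
  convert this using 1
  · ext m
    rw [mul_pow 2, pow_mul 2, show (2 : ℝ) ^ 2 = 4 by norm_num]
    field_simp
  · rw [averagedKernel]
    ring_nf

/-- Replacing f by |f| turns forms into absolute integrals. The partial sums of the averaged series
then lie, as forms, below the even partial sums of the power kernels, which are pointwise below the
sum of the two Coulomb kernels. Monotone convergence gives the limit, so no Schur estimate of the
averaged kernel is needed. -/
theorem kernelConverges_averagedKernel (hf : AEStronglyMeasurable f)
    (hN : Integrable (fun p : E3 => ‖p‖ * ‖f p‖ ^ 2)) : KernelConverges f averagedKernel := by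
  set g : E3 → ℂ := fun p => (‖f p‖ : ℂ) with hg
  have hgn : ∀ p, ‖g p‖ = ‖f p‖ := fun p => by simp [hg]
  have hgm : AEStronglyMeasurable g := Complex.continuous_ofReal.comp_aestronglyMeasurable hf.norm
  have hgN : Integrable (fun p : E3 => ‖p‖ * ‖g p‖ ^ 2) := by simpa only [hgn] using hN
  have hgre : ∀ z : E3 × E3, (starRingEnd ℂ (g z.1) * g z.2).re = ‖f z.1‖ * ‖f z.2‖ := by
    intro z
    simp [hg, ← Complex.ofReal_mul]
  set A : ℕ → E3 × E3 → ℝ := fun N z => ∑ m ∈ Finset.range N, 4 ^ m *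
    ((‖z.1‖ * ‖z.2‖) ^ (2 * m) / (2 * m + 1) / (‖z.1‖ ^ 2 + ‖z.2‖ ^ 2) ^ (2 * m + 1)) with hA
  set B : ℕ → E3 × E3 → ℝ := fun N z => ∑ m ∈ Finset.range N, 4 ^ m *
    ((inner ℝ z.1 z.2) ^ (2 * m) / (‖z.1‖ ^ 2 + ‖z.2‖ ^ 2 + 0) ^ (2 * m + 1)) with hB
  set S : E3 × E3 → ℝ := fun z => 1 / ‖z.1 - z.2‖ ^ 2 + 1 / ‖z.1 + z.2‖ ^ 2 with hS
  have hSc : KernelConverges g S :=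
    (kernelConverges_inv_sq_sub hgm hgN).1.add (kernelConverges_inv_sq_add hgm hgN)
  have hBn : ∀ N, KernelNonneg g (B N) := fun N => KernelNonneg.sum _ hgm fun m _ =>
    (kernelNonneg_pow hgm hgN (2 * m) le_rfl).const_mul (by positivity)
  have hBA : ∀ N, KernelNonneg g (fun z => B N z - A N z) := by
    intro N
    refine (KernelNonneg.sum (Finset.range N) hgm fun m _ =>
      (kernelNonneg_residue hgm hgN m).const_mul (by positivity : (0 : ℝ) ≤ 4 ^ m)).congr
      (ae_of_all _ fun z => ?_)
    simp only [hA, hB, ← Finset.sum_sub_distrib, add_zero]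
    refine Finset.sum_congr rfl fun m _ => ?_
    ring
  have hAc : ∀ N, KernelConverges g (A N) := by
    intro N
    have := (hBn N).1.sub (hBA N).1
    simpa using this
  have hA0 : ∀ N z, 0 ≤ A N z := fun N z => Finset.sum_nonneg fun m _ => by positivity
  have hle : ∀ N, ∫ z : E3 × E3, A N z * (‖f z.1‖ * ‖f z.2‖) ≤
      ∫ z : E3 × E3, S z * (‖f z.1‖ * ‖f z.2‖) := by
    intro N
    have h1 := (hBA N).2
    rw [kernelForm_sub hgm (hBn N).1 (hAc N)] at h1
    have h2 : kernelForm g (B N) ≤ kernelForm g S := by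
      refine integral_mono_ae ((hBn N).1.integrable hgm) (hSc.integrable hgm) ?_
      filter_upwards [ae_pair_norm] with z hz
      simp only [hgre]
      refine mul_le_mul_of_nonneg_right ?_ (by positivity)
      have h3 := two_mul_abs_inner_lt hz.2.2
      -- The even terms form a finite subfamily of the geometric series with nonnegative terms |2
      -- p·p'|ⁿ/(p² + p'²)ⁿ⁺¹.
      have h4 := sum_geometric_le (b := 2 * inner ℝ z.1 z.2) (by rwa [abs_mul, abs_two])
        ((Finset.range N).image (2 * ·))
      rw [Finset.sum_image (by intro x _ y _ h; simpa using h), ← norm_sub_sq_eq,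
        ← norm_add_sq_eq] at h4
      refine le_trans (le_of_eq ?_) h4
      refine Finset.sum_congr rfl fun m _ => ?_
      rw [(even_two_mul m).pow_abs, mul_pow, pow_mul 2, add_zero]
      norm_num
      ring
    have h3 : kernelForm g (A N) = ∫ z : E3 × E3, A N z * (‖f z.1‖ * ‖f z.2‖) := by
      simp only [kernelForm, hgre]
    have h4 : kernelForm g S = ∫ z : E3 × E3, S z * (‖f z.1‖ * ‖f z.2‖) := by
      simp only [kernelForm, hgre]
    linarith
  have hlim : ∀ᵐ z : E3 × E3, Tendsto (fun N => A N z) atTop (𝓝 (averagedKernel z)) := by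
    filter_upwards [ae_pair_norm] with z hz
    exact (hasSum_averagedKernel hz).tendsto_sum_nat
  have hAf : ∀ N, Integrable (fun z : E3 × E3 => A N z * (‖f z.1‖ * ‖f z.2‖)) := by
    intro N
    simpa only [hgn] using (hAc N).2
  have hm : AEStronglyMeasurable (fun z : E3 × E3 => averagedKernel z * (‖f z.1‖ * ‖f z.2‖)) :=
    measurable_averagedKernel.aestronglyMeasurable.mul (aestronglyMeasurable_norm_mul_norm hf)
  have h0 : ∀ᵐ z : E3 × E3, 0 ≤ averagedKernel z * (‖f z.1‖ * ‖f z.2‖) := by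
    filter_upwards [hlim] with z hz
    exact mul_nonneg (ge_of_tendsto' hz fun N => hA0 N z) (by positivity)
  refine ⟨measurable_averagedKernel.aestronglyMeasurable,
    (lintegral_ofReal_ne_top_iff_integrable hm h0).1 (ne_top_of_le_ne_top
      (ENNReal.ofReal_ne_top (r := ∫ z : E3 × E3, S z * (‖f z.1‖ * ‖f z.2‖))) ?_)⟩
  refine le_of_tendsto' (lintegral_tendsto_of_tendsto_of_monotone
    (f := fun N z => ENNReal.ofReal (A N z * (‖f z.1‖ * ‖f z.2‖)))
    (fun N => (hAf N).1.aemeasurable.ennreal_ofReal) (ae_of_all _ fun z N M hNM => ?_) ?_)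
    fun N => ?_
  · refine ENNReal.ofReal_le_ofReal (mul_le_mul_of_nonneg_right ?_ (by positivity))
    exact Finset.sum_le_sum_of_subset_of_nonneg (Finset.range_mono hNM)
      fun m _ _ => by positivity
  · filter_upwards [hlim] with z hz
    exact (ENNReal.continuous_ofReal.tendsto _).comp (hz.mul_const _)
  · rw [← ofReal_integral_eq_lintegral_ofReal (hAf N)
      (ae_of_all _ fun z => mul_nonneg (hA0 N z) (by positivity))]
    exact ENNReal.ofReal_le_ofReal (hle N)

/-- Positivity of the averaged difference of the two kernels. -/
theorem kernelNonneg_averaged_sub (hf : AEStronglyMeasurable f)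
    (hN : Integrable (fun p : E3 => ‖p‖ * ‖f p‖ ^ 2)) :
    KernelNonneg f (fun z => 2 / 3 * averagedKernel z - 1 / (2 * (‖z.1‖ * ‖z.2‖)) *
      logRatio (‖z.1‖ * ‖z.2‖ / (‖z.1‖ ^ 2 + ‖z.2‖ ^ 2))) := by
  have hG := kernelConverges_averagedKernel hf hN
  have hρ : ∀ z : E3 × E3, 0 < ‖z.1‖ ∧ 0 < ‖z.2‖ ∧ ‖z.1‖ ≠ ‖z.2‖ →
      HasSum (fun k : ℕ => 1 / (‖z.1‖ * ‖z.2‖) * (1 / (2 * (k : ℝ) + 1) *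
        radiusRatio z ^ (2 * k + 1))) (averagedKernel z) := by
    intro z hz
    obtain ⟨h1, h2, h3, -⟩ := radiusRatio_spec hz
    have h4 := (hasSum_logRatio (y := radiusRatio z) (by rwa [abs_of_pos h1])).mul_left
      (1 / (2 * (‖z.1‖ * ‖z.2‖)))
    have e : averagedKernel z = 1 / (2 * (‖z.1‖ * ‖z.2‖)) * logRatio (radiusRatio z) := by
      rw [averagedKernel, h3]
      ring
    rw [e]
    refine h4.congr_eq fun k => ?_
    field_simp
  -- In terms of ρ and L = `logRatio` the kernel is (3L(ρ³) - L(ρ))/(6|p||p'|); these are the terms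
  -- of its series, with j = 2k + 1.
  have hterm : ∀ k : ℕ, KernelNonneg f (fun z => 1 / (3 * (2 * (k : ℝ) + 1)) *
      (1 / (‖z.1‖ * ‖z.2‖) *
        (3 * radiusRatio z ^ (3 * (2 * k + 1)) - radiusRatio z ^ (2 * k + 1)))) := by
    intro k
    refine (kernelNonneg_swave hf (2 * k + 1) ?_).const_mul (by positivity)
    refine (hG.const_mul (2 * (k : ℝ) + 1)).mono hf ?_ ?_
    · exact ((by fun_prop : Measurable fun z : E3 × E3 => 1 / (‖z.1‖ * ‖z.2‖)).mul
        (measurable_radiusRatio.pow_const _)).aestronglyMeasurable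
    · filter_upwards [ae_pair_norm] with z hz
      obtain ⟨h1, h2, -, -⟩ := radiusRatio_spec hz
      have h3 := le_hasSum (hρ z hz) k fun i _ => by positivity
      rw [abs_of_nonneg (by positivity)]
      refine le_trans ?_ (le_abs_self _)
      calc _ = (2 * (k : ℝ) + 1) * (1 / (‖z.1‖ * ‖z.2‖) * (1 / (2 * (k : ℝ) + 1) *
            radiusRatio z ^ (2 * k + 1))) := by field_simp
        _ ≤ _ := by gcongr
  refine KernelNonneg.of_tendsto hf (fun K => KernelNonneg.sum (Finset.range K) hf
    fun k _ => hterm k) (hG.const_mul (4 / 3)) (fun K => ?_) ?_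
  · filter_upwards [ae_pair_norm] with z hz
    obtain ⟨h1, h2, -, -⟩ := radiusRatio_spec hz
    refine (Finset.abs_sum_le_sum_abs _ _).trans ?_
    refine le_trans (Finset.sum_le_sum (g := fun k : ℕ => 4 / 3 * (1 / (‖z.1‖ * ‖z.2‖) *
      (1 / (2 * (k : ℝ) + 1) * radiusRatio z ^ (2 * k + 1)))) fun k _ => ?_) ?_
    · have h3 : radiusRatio z ^ (3 * (2 * k + 1)) ≤ radiusRatio z ^ (2 * k + 1) :=
        pow_le_pow_of_le_one h1.le h2.le (by omega)
      have h4 : 0 < radiusRatio z ^ (3 * (2 * k + 1)) := by positivity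
      have h5 : |3 * radiusRatio z ^ (3 * (2 * k + 1)) - radiusRatio z ^ (2 * k + 1)| ≤
          4 * radiusRatio z ^ (2 * k + 1) := by
        rw [abs_le]
        constructor <;> linarith
      rw [abs_mul, abs_mul, abs_of_nonneg (by positivity : 0 ≤ 1 / (3 * (2 * (k : ℝ) + 1))),
        abs_of_nonneg (by positivity : 0 ≤ 1 / (‖z.1‖ * ‖z.2‖))]
      calc _ ≤ 1 / (3 * (2 * (k : ℝ) + 1)) * (1 / (‖z.1‖ * ‖z.2‖) *
            (4 * radiusRatio z ^ (2 * k + 1))) := by gcongr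
        _ = _ := by field_simp
    · rw [← Finset.mul_sum]
      have := sum_le_hasSum (Finset.range K) (fun i _ => by positivity) (hρ z hz)
      linarith
  · filter_upwards [ae_pair_norm] with z hz
    obtain ⟨h1, h2, h3, h4⟩ := radiusRatio_spec hz
    have h5 : radiusRatio z ^ 3 < 1 := pow_lt_one₀ h1.le h2 (by norm_num)
    have h6 := (hasSum_logRatio (y := radiusRatio z) (by rwa [abs_of_pos h1]))
    have h7 := (hasSum_logRatio (y := radiusRatio z ^ 3) (by rwa [abs_of_pos (by positivity)]))
    have h8 := ((h7.mul_left 3).sub h6).mul_left (1 / (6 * (‖z.1‖ * ‖z.2‖)))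
    refine Tendsto.congr (fun K => ?_) (h8.tendsto_sum_nat.trans (le_of_eq ?_))
    · refine Finset.sum_congr rfl fun k _ => ?_
      rw [← pow_mul]
      field_simp
      ring
    · congr 1
      rw [averagedKernel, h3, h4]
      field_simp
      ring

theorem sum_range_pairs (u v : ℕ → ℝ) (M : ℕ) :
    ∑ m ∈ Finset.range M, (u (2 * m) + u (2 * m + 1) - v m) =
      ∑ n ∈ Finset.range (2 * M), u n - ∑ m ∈ Finset.range M, v m := by
  induction M with
  | zero => simp
  | succ M ih =>
    rw [Finset.sum_range_succ, ih, Finset.sum_range_succ v, show 2 * (M + 1) = 2 * M + 1 + 1 by ring,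
      Finset.sum_range_succ u, Finset.sum_range_succ u]
    ring

/-- The Skornyakov–Ter-Martirosyan kernel is dominated by the Coulomb kernel. -/
theorem kernelNonneg_stm (hf : AEStronglyMeasurable f)
    (hN : Integrable (fun p : E3 => ‖p‖ * ‖f p‖ ^ 2)) {lam : ℝ} (hl : 0 ≤ lam) :
    KernelNonneg f (fun z => 2 / 3 * (1 / ‖z.1 - z.2‖ ^ 2) -
      1 / (‖z.1‖ ^ 2 + ‖z.2‖ ^ 2 + inner ℝ z.1 z.2 + lam)) := by
  have hd : ∀ m : ℕ, |2 / 3 * (4 : ℝ) ^ m - 1| ≤ 4 ^ m := by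
    intro m
    have : (1 : ℝ) ≤ 4 ^ m := one_le_pow₀ (by norm_num)
    rw [abs_le]
    constructor <;> linarith
  -- The powers 2m and 2m + 1 of both geometric series, from which the angular average of the even
  -- power is subtracted. The subtraction has the λ = 0 coefficient (2/3)4ᵐ - 1; the dependence on λ
  -- is a separate positive difference.
  have hterm : ∀ m : ℕ, KernelNonneg f (fun z =>
      ((2 / 3 * (2 * inner ℝ z.1 z.2) ^ (2 * m) / (‖z.1‖ ^ 2 + ‖z.2‖ ^ 2) ^ (2 * m + 1) -
        (-inner ℝ z.1 z.2) ^ (2 * m) / (‖z.1‖ ^ 2 + ‖z.2‖ ^ 2 + lam) ^ (2 * m + 1)) +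
      (2 / 3 * (2 * inner ℝ z.1 z.2) ^ (2 * m + 1) / (‖z.1‖ ^ 2 + ‖z.2‖ ^ 2) ^ (2 * m + 1 + 1) -
        (-inner ℝ z.1 z.2) ^ (2 * m + 1) / (‖z.1‖ ^ 2 + ‖z.2‖ ^ 2 + lam) ^ (2 * m + 1 + 1)) -
      (2 / 3 * 4 ^ m - 1) * ((‖z.1‖ * ‖z.2‖) ^ (2 * m) / (2 * m + 1) /
        (‖z.1‖ ^ 2 + ‖z.2‖ ^ 2) ^ (2 * m + 1)))) := by
    intro m
    have k1 : KernelNonneg f (fun z => (2 / 3 * 4 ^ m - 1) * (((inner ℝ z.1 z.2) ^ (2 * m) -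
        (‖z.1‖ * ‖z.2‖) ^ (2 * m) / (2 * m + 1)) / (‖z.1‖ ^ 2 + ‖z.2‖ ^ 2) ^ (2 * m + 1))) := by
      -- For m = 0 the coefficient is -1/3, but the residue vanishes because the constant power is
      -- its own angular average.
      rcases Nat.eq_zero_or_pos m with rfl | hm
      · simpa using KernelNonneg.zero
      · refine (kernelNonneg_residue hf hN m).const_mul ?_
        have : (4 : ℝ) ^ 1 ≤ 4 ^ m := pow_le_pow_right₀ (by norm_num) hm
        linarith
    have k2 := kernelNonneg_pow_sub hf hN (2 * m) hl
    have k3 := (kernelNonneg_pow hf hN (2 * m + 1) le_rfl).const_mul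
      (by positivity : (0 : ℝ) ≤ 2 / 3 * 2 ^ (2 * m + 1))
    have k4 := kernelNonneg_pow hf hN (2 * m + 1) hl
    refine (((k1.add hf k2).add hf k3).add hf k4).congr (ae_of_all _ fun z => ?_)
    simp only [add_zero]
    rw [(even_two_mul m).neg_pow, (odd_two_mul_add_one m).neg_pow, mul_pow 2, mul_pow 2,
      pow_mul 2 2 m, show (2 : ℝ) ^ 2 = 4 by norm_num]
    ring
  have hS := (kernelConverges_inv_sq_sub hf hN).1.add (kernelConverges_inv_sq_add hf hN)
  have hG := kernelConverges_averagedKernel hf hN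
  -- The limit carries everything except the angular averages, which `kernelNonneg_averaged_sub`
  -- adds back. In the dominating kernel, 5/3 = 2/3 + 1 accounts for the two geometric series.
  have hD := KernelNonneg.of_tendsto hf (K := fun z => (2 / 3 * (1 / ‖z.1 - z.2‖ ^ 2) -
      1 / (‖z.1‖ ^ 2 + ‖z.2‖ ^ 2 + inner ℝ z.1 z.2 + lam)) - (2 / 3 * averagedKernel z -
      1 / (2 * (‖z.1‖ * ‖z.2‖)) * logRatio (‖z.1‖ * ‖z.2‖ / (‖z.1‖ ^ 2 + ‖z.2‖ ^ 2))))
    (fun M => KernelNonneg.sum (Finset.range M) hf fun m _ => hterm m)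
    ((hS.const_mul (5 / 3)).add hG) (fun M => ?_) ?_
  · refine (hD.add hf (kernelNonneg_averaged_sub hf hN)).congr (ae_of_all _ fun z => ?_)
    simp only
    ring
  · filter_upwards [ae_pair_norm] with z hz
    have hlt := two_mul_abs_inner_lt hz.2.2
    rw [← abs_two, ← abs_mul] at hlt
    have ha : 0 < ‖z.1‖ ^ 2 + ‖z.2‖ ^ 2 := by have := hz.1; positivity
    rw [sum_range_pairs (fun n => 2 / 3 * (2 * inner ℝ z.1 z.2) ^ n /
      (‖z.1‖ ^ 2 + ‖z.2‖ ^ 2) ^ (n + 1) - (-inner ℝ z.1 z.2) ^ n /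
      (‖z.1‖ ^ 2 + ‖z.2‖ ^ 2 + lam) ^ (n + 1))]
    refine (abs_sub _ _).trans (add_le_add ?_ ?_)
    · refine (Finset.abs_sum_le_sum_abs _ _).trans ?_
      refine le_trans (Finset.sum_le_sum (g := fun n => 5 / 3 * (|2 * inner ℝ z.1 z.2| ^ n /
        (‖z.1‖ ^ 2 + ‖z.2‖ ^ 2) ^ (n + 1))) fun n _ => ?_) ?_
      · refine (abs_sub _ _).trans ?_
        rw [abs_div, abs_div, abs_mul (2 / 3), abs_pow (2 * inner ℝ z.1 z.2), abs_pow (-_), abs_neg,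
          abs_of_nonneg (by positivity : 0 ≤ (‖z.1‖ ^ 2 + ‖z.2‖ ^ 2) ^ (n + 1)),
          abs_of_nonneg (by positivity : 0 ≤ (‖z.1‖ ^ 2 + ‖z.2‖ ^ 2 + lam) ^ (n + 1)),
          abs_of_nonneg (by norm_num : (0 : ℝ) ≤ 2 / 3)]
        have h1 : |inner ℝ z.1 z.2| ^ n / (‖z.1‖ ^ 2 + ‖z.2‖ ^ 2 + lam) ^ (n + 1) ≤
            |2 * inner ℝ z.1 z.2| ^ n / (‖z.1‖ ^ 2 + ‖z.2‖ ^ 2) ^ (n + 1) := by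
          refine div_le_div₀ (by positivity) (pow_le_pow_left₀ (abs_nonneg _) ?_ n)
            (by positivity) (pow_le_pow_left₀ ha.le (by linarith) _)
          rw [abs_mul, abs_two]
          linarith [abs_nonneg (inner ℝ z.1 z.2)]
        have h2 : 2 / 3 * |2 * inner ℝ z.1 z.2| ^ n / (‖z.1‖ ^ 2 + ‖z.2‖ ^ 2) ^ (n + 1) =
          2 / 3 * (|2 * inner ℝ z.1 z.2| ^ n / (‖z.1‖ ^ 2 + ‖z.2‖ ^ 2) ^ (n + 1)) := by ring
        rw [h2]
        linarith
      · rw [← Finset.mul_sum]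
        have := sum_geometric_le hlt (Finset.range (2 * M))
        rw [← norm_sub_sq_eq, ← norm_add_sq_eq] at this
        linarith
    · refine (Finset.abs_sum_le_sum_abs _ _).trans ?_
      refine le_trans (Finset.sum_le_sum fun m _ => ?_)
        (sum_le_hasSum (Finset.range M) (fun i _ => by positivity) (hasSum_averagedKernel hz))
      rw [abs_mul, abs_of_nonneg (a := _ / _ / _) (by positivity)]
      exact mul_le_mul_of_nonneg_right (hd m) (by positivity)
  · filter_upwards [ae_pair_norm] with z hz
    have hlt := two_mul_abs_inner_lt hz.2.2
    have hlt2 := hlt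
    rw [← abs_two, ← abs_mul] at hlt
    have ha : 0 < ‖z.1‖ ^ 2 + ‖z.2‖ ^ 2 := by have := hz.1; positivity
    have s1 := (hasSum_geometric_kernel hlt).mul_left (2 / 3)
    have s2 := hasSum_geometric_kernel (a := ‖z.1‖ ^ 2 + ‖z.2‖ ^ 2 + lam) (b := -inner ℝ z.1 z.2)
      (by rw [abs_neg]; linarith [abs_nonneg (inner ℝ z.1 z.2)])
    have s3 := (hasSum_averagedKernel hz).mul_left (2 / 3)
    have s4 := hasSum_angular_average (mul_pos hz.1 hz.2.1) one_pos (a := ‖z.1‖ ^ 2 + ‖z.2‖ ^ 2)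
      (by have := two_mul_norm_mul_lt hz.2.2
          have := mul_pos hz.1 hz.2.1
          linarith)
    -- Terms were grouped in pairs, so only partial sums of even length occur.
    have t1 := (s1.sub s2).tendsto_sum_nat.comp (tendsto_id.const_mul_atTop' two_pos)
    have t2 := (s3.sub s4).tendsto_sum_nat
    refine Tendsto.congr (fun M => ?_) ((t1.sub t2).trans (le_of_eq ?_))
    · rw [sum_range_pairs (fun n => 2 / 3 * (2 * inner ℝ z.1 z.2) ^ n /
        (‖z.1‖ ^ 2 + ‖z.2‖ ^ 2) ^ (n + 1) - (-inner ℝ z.1 z.2) ^ n /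
        (‖z.1‖ ^ 2 + ‖z.2‖ ^ 2 + lam) ^ (n + 1))]
      simp only [Function.comp_apply, id]
      congr 1
      · refine Finset.sum_congr rfl fun n _ => ?_
        ring
      · refine Finset.sum_congr rfl fun n _ => ?_
        rw [one_mul]
        field_simp
    · rw [norm_sub_sq_eq, sub_neg_eq_add]
      congr 1
      ring_nf

theorem kernelConverges_stm (hf : AEStronglyMeasurable f)
    (hN : Integrable (fun p : E3 => ‖p‖ * ‖f p‖ ^ 2)) {lam : ℝ} (hl : 0 ≤ lam) :
    KernelConverges f (fun z => 1 / (‖z.1‖ ^ 2 + ‖z.2‖ ^ 2 + inner ℝ z.1 z.2 + lam)) := by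
  have := ((kernelConverges_inv_sq_sub hf hN).1.const_mul (2 / 3)).sub (kernelNonneg_stm hf hN hl).1
  simpa using this

theorem kernelForm_stm_le (hf : AEStronglyMeasurable f)
    (hN : Integrable (fun p : E3 => ‖p‖ * ‖f p‖ ^ 2)) {lam : ℝ} (hl : 0 ≤ lam) :
    kernelForm f (fun z => 1 / (‖z.1‖ ^ 2 + ‖z.2‖ ^ 2 + inner ℝ z.1 z.2 + lam)) ≤
      2 / 3 * kernelForm f (fun z => 1 / ‖z.1 - z.2‖ ^ 2) := by
  have h1 := (kernelNonneg_stm hf hN hl).2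
  rw [kernelForm_sub hf ((kernelConverges_inv_sq_sub hf hN).1.const_mul _)
    (kernelConverges_stm hf hN hl), kernelForm_const_mul] at h1
  linarith

theorem kernelForm_inv_sq_sub_le (hf : AEStronglyMeasurable f)
    (hN : Integrable (fun p : E3 => ‖p‖ * ‖f p‖ ^ 2)) :
    kernelForm f (fun z => 1 / ‖z.1 - z.2‖ ^ 2) ≤ Real.pi ^ 3 * ∫ p : E3, ‖p‖ * ‖f p‖ ^ 2 := by
  obtain ⟨h1, h2⟩ := kernelConverges_inv_sq_sub hf hN
  refine (integral_mono (h1.integrable hf) h1.2 fun z => ?_).trans h2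
  exact mul_le_mul_of_nonneg_left ((le_abs_self _).trans (abs_re_conj_mul_le _ _)) (by positivity)

end STMInequality

/-! ### Multiplication by a Gaussian as a convolution form in momentum space. -/

noncomputable section GaussianIdentity

open FourierTransform SchwartzMap

/-- The normalised Gaussian `(π/b)^{3/2} e^{-π²|v|²/b}`, the Fourier transform of `e^{-b|y|²}`. -/
def gaussianHat (b : ℝ) (v : E3) : ℝ :=
  (Real.pi / b) ^ (3 / 2 : ℝ) * Real.exp (-(Real.pi ^ 2 / b) * ‖v‖ ^ 2)

theorem continuous_gaussianHat (b : ℝ) : Continuous (gaussianHat b) := by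
  unfold gaussianHat
  fun_prop

theorem gaussianHat_nonneg {b : ℝ} (hb : 0 < b) (v : E3) : 0 ≤ gaussianHat b v := by
  unfold gaussianHat
  positivity

theorem lintegral_gaussianHat {b : ℝ} (hb : 0 < b) :
    ∫⁻ v : E3, ENNReal.ofReal (gaussianHat b v) = 1 := by
  have hc : 0 < Real.pi ^ 2 / b := by positivity
  have h := GaussianFourier.integral_rexp_neg_mul_sq_norm (V := E3) hc
  have h1 : ∫ v : E3, gaussianHat b v = 1 := by
    unfold gaussianHat
    rw [integral_const_mul, h, finrank_euclideanSpace_fin, Nat.cast_ofNat, ← Real.mul_rpow (by positivity)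
      (by positivity)]
    rw [show Real.pi / b * (Real.pi / (Real.pi ^ 2 / b)) = 1 by field_simp]
    simp
  have hi : Integrable (gaussianHat b) := by
    by_contra hc
    rw [integral_undef hc] at h1
    norm_num at h1
  rw [← ofReal_integral_eq_lintegral_ofReal hi (ae_of_all _ (gaussianHat_nonneg hb)), h1]
  simp

/-- The joint law with density `gaussianHat b (z.1 - z.2)`. -/
def gaussianCoupling (b : ℝ) : Measure (E3 × E3) :=
  (volume : Measure (E3 × E3)).withDensity fun z => ENNReal.ofReal (gaussianHat b (z.1 - z.2))

theorem measurable_coupling_density (b : ℝ) :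
    Measurable fun z : E3 × E3 => ENNReal.ofReal (gaussianHat b (z.1 - z.2)) :=
  ((continuous_gaussianHat b).comp (continuous_fst.sub continuous_snd)).measurable.ennreal_ofReal

/-- The Gaussian density has mass one, so both marginals of the coupling are Lebesgue measure.
Pulling back along either projection is then an L² isometry, which makes the convolution form
continuous on L². -/
theorem measurePreserving_fst_coupling {b : ℝ} (hb : 0 < b) :
    MeasurePreserving Prod.fst (gaussianCoupling b) (volume : Measure E3) := by
  refine ⟨measurable_fst, Measure.ext fun s hs => ?_⟩
  rw [Measure.map_apply measurable_fst hs, gaussianCoupling,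
    withDensity_apply _ (measurable_fst hs), ← Set.prod_univ, Measure.volume_eq_prod,
    ← Measure.prod_restrict, lintegral_prod _ (measurable_coupling_density b).aemeasurable]
  simp only [Measure.restrict_univ]
  have h : ∀ x : E3, ∫⁻ y : E3, ENNReal.ofReal (gaussianHat b (x - y)) = 1 := by
    intro x
    rw [lintegral_sub_left_eq_self (fun v => ENNReal.ofReal (gaussianHat b v)),
      lintegral_gaussianHat hb]
  simp [h]

theorem measurePreserving_snd_coupling {b : ℝ} (hb : 0 < b) :
    MeasurePreserving Prod.snd (gaussianCoupling b) (volume : Measure E3) := by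
  refine ⟨measurable_snd, Measure.ext fun s hs => ?_⟩
  rw [Measure.map_apply measurable_snd hs, gaussianCoupling,
    withDensity_apply _ (measurable_snd hs), ← Set.univ_prod, Measure.volume_eq_prod,
    ← Measure.prod_restrict, lintegral_prod_symm _ (measurable_coupling_density b).aemeasurable]
  simp only [Measure.restrict_univ]
  have h : ∀ y : E3, ∫⁻ x : E3, ENNReal.ofReal (gaussianHat b (x - y)) = 1 := by
    intro y
    rw [lintegral_sub_right_eq_self (fun v => ENNReal.ofReal (gaussianHat b v)),
      lintegral_gaussianHat hb]
  simp [h]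

/-- The Gaussian form as an inner product. -/
def couplingInner {b : ℝ} (hb : 0 < b) (φ : L2 E3) : ℂ :=
  inner ℂ (Lp.compMeasurePreserving Prod.fst (measurePreserving_fst_coupling hb) φ)
    (Lp.compMeasurePreserving Prod.snd (measurePreserving_snd_coupling hb) φ)

theorem continuous_couplingInner {b : ℝ} (hb : 0 < b) : Continuous (couplingInner hb) :=
  ((Lp.isometry_compMeasurePreserving _).continuous).inner
    ((Lp.isometry_compMeasurePreserving _).continuous)

theorem coupling_integrable {b : ℝ} (hb : 0 < b) (φ : L2 E3) :
    Integrable (fun z : E3 × E3 => ((gaussianHat b (z.1 - z.2) : ℝ) : ℂ) *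
      (starRingEnd ℂ (φ z.1) * φ z.2)) ∧
    ∫ z : E3 × E3, ((gaussianHat b (z.1 - z.2) : ℝ) : ℂ) * (starRingEnd ℂ (φ z.1) * φ z.2) =
      couplingInner hb φ := by
  have h1 := Lp.coeFn_compMeasurePreserving φ (measurePreserving_fst_coupling hb)
  have h2 := Lp.coeFn_compMeasurePreserving φ (measurePreserving_snd_coupling hb)
  have hi := L2.integrable_inner (𝕜 := ℂ)
    (Lp.compMeasurePreserving Prod.fst (measurePreserving_fst_coupling hb) φ)
    (Lp.compMeasurePreserving Prod.snd (measurePreserving_snd_coupling hb) φ)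
  have hae : (fun z : E3 × E3 => starRingEnd ℂ (φ z.1) * φ z.2) =ᵐ[gaussianCoupling b] fun z =>
      inner ℂ ((Lp.compMeasurePreserving Prod.fst (measurePreserving_fst_coupling hb) φ) z)
        ((Lp.compMeasurePreserving Prod.snd (measurePreserving_snd_coupling hb) φ) z) := by
    filter_upwards [h1, h2] with z e1 e2
    rw [e1, e2]
    simp [mul_comm]
  have hi2 := hi.congr hae.symm
  have hr : ∀ z : E3 × E3, (ENNReal.ofReal (gaussianHat b (z.1 - z.2))).toReal =
      gaussianHat b (z.1 - z.2) := fun z => ENNReal.toReal_ofReal (gaussianHat_nonneg hb _)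
  constructor
  · rw [gaussianCoupling, integrable_withDensity_iff_integrable_smul' (measurable_coupling_density b)
      (ae_of_all _ fun z => ENNReal.ofReal_lt_top)] at hi2
    refine hi2.congr (ae_of_all _ fun z => ?_)
    simp only [hr, Complex.real_smul]
  · rw [couplingInner, L2.inner_def, ← integral_congr_ae hae, gaussianCoupling,
      integral_withDensity_eq_integral_toReal_smul (measurable_coupling_density b)
      (ae_of_all _ fun z => ENNReal.ofReal_lt_top)]
    simp only [hr, Complex.real_smul]

/-- The multiplication by `e^{-b|y|²}` in `L^∞`. -/
theorem memLp_top_gaussian {b : ℝ} (hb : 0 < b) :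
    MemLp (fun y : E3 => ((Real.exp (-b * ‖y‖ ^ 2) : ℝ) : ℂ)) ⊤ := by
  refine memLp_top_of_bound ?_ 1 (ae_of_all _ fun p => ?_)
  · exact (by fun_prop : Continuous _).aestronglyMeasurable
  · rw [Complex.norm_real, Real.norm_eq_abs, abs_of_nonneg (by positivity), Real.exp_le_one_iff]
    nlinarith [sq_nonneg ‖p‖]

theorem continuous_gaussian_smul {b : ℝ} (hb : 0 < b) :
    Continuous fun ξ : L2 E3 => (((memLp_top_gaussian hb).toLp _ (μ := volume)) • ξ : L2 E3) := by
  refine (LipschitzWith.of_dist_le_mul (K := ‖((memLp_top_gaussian hb).toLp _ (μ := volume))‖₊)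
    fun x y => ?_).continuous
  rw [dist_eq_norm, dist_eq_norm]
  have h : (((memLp_top_gaussian hb).toLp _ (μ := volume)) • x : L2 E3) -
      (((memLp_top_gaussian hb).toLp _ (μ := volume)) • y : L2 E3) =
      (((memLp_top_gaussian hb).toLp _ (μ := volume)) • (x - y) : L2 E3) := by
    rw [sub_eq_iff_eq_add, ← MeasureTheory.Lp.add_smul, sub_add_cancel]
  rw [h]
  exact Lp.norm_smul_le _ _

theorem inner_gaussian_smul {b : ℝ} (hb : 0 < b) (ξ : L2 E3) :
    inner ℂ ξ (((memLp_top_gaussian hb).toLp _ (μ := volume)) • ξ : L2 E3) =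
      ∫ y : E3, ((Real.exp (-b * ‖y‖ ^ 2) : ℝ) : ℂ) * (starRingEnd ℂ (ξ y) * ξ y) := by
  rw [L2.inner_def]
  refine integral_congr_ae ?_
  filter_upwards [Lp.coeFn_lpSMul (r := 2) ((memLp_top_gaussian hb).toLp _ (μ := volume)) ξ,
    (memLp_top_gaussian hb).coeFn_toLp] with y h1 h2
  rw [h1, Pi.smul_apply', h2, smul_eq_mul]
  simp
  ring

theorem integrable_cexp_gaussian {b : ℝ} (hb : 0 < b) (v : E3) :
    Integrable fun y : E3 => Complex.exp (-(b : ℂ) * ‖y‖ ^ 2 +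
      2 * Real.pi * Complex.I * (inner ℝ v y : ℝ)) :=
  GaussianFourier.integrable_cexp_neg_mul_sq_norm_add (by simpa using hb) _ _

/-- The convolution theorem, obtained from the multiplication formula: the Fourier integral is moved
between φ and the Gaussian modulated by v, whose transform is the Gaussian centred at v. -/
theorem fourier_gaussian_mul_fourierInv {b : ℝ} (hb : 0 < b) (φ : 𝓢(E3, ℂ)) (v : E3) :
    𝓕 (fun y : E3 => ((Real.exp (-b * ‖y‖ ^ 2) : ℝ) : ℂ) * (𝓕⁻ φ : 𝓢(E3, ℂ)) y) v =
      ∫ v' : E3, ((gaussianHat b (v - v') : ℝ) : ℂ) * φ v' := by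
  have hb' : 0 < (b : ℂ).re := by simpa using hb
  have hG := integrable_cexp_gaussian hb v
  have hflip := VectorFourier.integral_fourierIntegral_smul_eq_flip
    (μ := (volume : Measure E3)) (ν := (volume : Measure E3)) (L := innerₗ E3)
    Real.continuous_fourierChar continuous_inner hG φ.integrable
  have h1 : ∀ w : E3, VectorFourier.fourierIntegral Real.fourierChar volume (innerₗ E3)
      (fun y : E3 => Complex.exp (-(b : ℂ) * ‖y‖ ^ 2 +
        2 * Real.pi * Complex.I * (inner ℝ v y : ℝ))) w = ((gaussianHat b (v - w) : ℝ) : ℂ) := by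
    intro w
    have h := fourier_gaussian_innerProductSpace' hb' v w
    refine Eq.trans h ?_
    rw [gaussianHat, finrank_euclideanSpace_fin]
    push_cast
    rw [Complex.ofReal_cpow (by positivity)]
    push_cast
    congr 2
    ring
  have h2 : ∀ w : E3, VectorFourier.fourierIntegral Real.fourierChar volume (innerₗ E3).flip φ w =
      (𝓕⁻ φ : 𝓢(E3, ℂ)) (-w) := by
    intro w
    rw [fourierInv_coe, Real.fourierInv_eq_fourier_neg, neg_neg, flip_innerₗ]
    rfl
  simp only [h1, h2, smul_eq_mul] at hflip
  rw [hflip, Real.fourier_eq', ← integral_neg_eq_self]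
  congr 1 with y
  rw [smul_eq_mul, ← mul_assoc]
  congr 1
  rw [norm_neg, Complex.ofReal_exp, ← Complex.exp_add]
  congr 1
  rw [inner_neg_left, real_inner_comm]
  push_cast
  ring

theorem schwartz_gaussian_identity {b : ℝ} (hb : 0 < b) (φ : 𝓢(E3, ℂ)) :
    ∫ y : E3, ((Real.exp (-b * ‖y‖ ^ 2) : ℝ) : ℂ) *
      (starRingEnd ℂ ((𝓕⁻ φ : 𝓢(E3, ℂ)) y) * (𝓕⁻ φ : 𝓢(E3, ℂ)) y) =
    ∫ v : E3, starRingEnd ℂ (φ v) * ∫ v' : E3, ((gaussianHat b (v - v') : ℝ) : ℂ) * φ v' := by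
  have hi : Integrable fun y : E3 => ((Real.exp (-b * ‖y‖ ^ 2) : ℝ) : ℂ) *
      (𝓕⁻ φ : 𝓢(E3, ℂ)) y := by
    refine (𝓕⁻ φ : 𝓢(E3, ℂ)).integrable.bdd_mul (c := 1)
      (by fun_prop : Continuous _).aestronglyMeasurable (ae_of_all _ fun p => ?_)
    rw [Complex.norm_real, Real.norm_eq_abs, abs_of_nonneg (by positivity), Real.exp_le_one_iff]
    nlinarith [sq_nonneg ‖p‖]
  have hc : Integrable fun v : E3 => starRingEnd ℂ (φ v) := by
    refine φ.integrable.mono (Complex.continuous_conj.comp φ.continuous).aestronglyMeasurable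
      (ae_of_all _ fun v => ?_)
    simp
  have hflip := VectorFourier.integral_fourierIntegral_smul_eq_flip
    (μ := (volume : Measure E3)) (ν := (volume : Measure E3)) (L := innerₗ E3)
    Real.continuous_fourierChar continuous_inner hc hi
  have h1 : ∀ y : E3, VectorFourier.fourierIntegral Real.fourierChar volume (innerₗ E3)
      (fun v : E3 => starRingEnd ℂ (φ v)) y = starRingEnd ℂ ((𝓕⁻ φ : 𝓢(E3, ℂ)) y) := by
    intro y
    rw [fourierInv_coe, Real.fourierInv_eq', ← integral_conj]
    refine Eq.trans (Real.fourier_eq' (fun v : E3 => starRingEnd ℂ (φ v)) y) ?_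
    congr 1 with v
    simp only [smul_eq_mul, map_mul, ← Complex.exp_conj]
    congr 2
    simp [Complex.conj_ofNat]
  have h2 : ∀ v : E3, VectorFourier.fourierIntegral Real.fourierChar volume (innerₗ E3).flip
      (fun y : E3 => ((Real.exp (-b * ‖y‖ ^ 2) : ℝ) : ℂ) * (𝓕⁻ φ : 𝓢(E3, ℂ)) y) v =
      ∫ v' : E3, ((gaussianHat b (v - v') : ℝ) : ℂ) * φ v' := by
    intro v
    rw [flip_innerₗ]
    exact fourier_gaussian_mul_fourierInv hb φ v
  simp only [h1, h2, smul_eq_mul] at hflip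
  rw [← hflip]
  congr 1 with y
  ring

theorem coupling_schwartz {b : ℝ} (hb : 0 < b) (φ : 𝓢(E3, ℂ)) :
    couplingInner hb (φ.toLp 2 : L2 E3) =
      ∫ v : E3, starRingEnd ℂ (φ v) * ∫ v' : E3, ((gaussianHat b (v - v') : ℝ) : ℂ) * φ v' := by
  have hφ := φ.coeFn_toLp 2 (volume : Measure E3)
  have hφ2 : ∀ᵐ z : E3 × E3, (φ.toLp 2 : L2 E3) z.1 = φ z.1 ∧ (φ.toLp 2 : L2 E3) z.2 = φ z.2 := by
    filter_upwards [Measure.quasiMeasurePreserving_fst.ae hφ,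
      Measure.quasiMeasurePreserving_snd.ae hφ] with z a c using ⟨a, c⟩
  have hi := (coupling_integrable hb (φ.toLp 2 : L2 E3)).1
  have hae : (fun z : E3 × E3 => ((gaussianHat b (z.1 - z.2) : ℝ) : ℂ) *
      (starRingEnd ℂ ((φ.toLp 2 : L2 E3) z.1) * (φ.toLp 2 : L2 E3) z.2)) =ᵐ[volume]
      fun z => ((gaussianHat b (z.1 - z.2) : ℝ) : ℂ) * (starRingEnd ℂ (φ z.1) * φ z.2) := by
    filter_upwards [hφ2] with z hz
    rw [hz.1, hz.2]
  rw [← (coupling_integrable hb _).2, integral_congr_ae hae, Measure.volume_eq_prod,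
    integral_prod _ (by rw [← Measure.volume_eq_prod]; exact hi.congr hae)]
  congr 1 with v
  rw [← integral_const_mul]
  congr 1 with v'
  ring

/-- Both sides are continuous on L² and agree on the dense Schwartz functions. -/
theorem inner_gaussian_smul_eq {b : ℝ} (hb : 0 < b) (ξ : L2 E3) :
    inner ℂ ξ (((memLp_top_gaussian hb).toLp _ (μ := volume)) • ξ : L2 E3) =
      couplingInner hb (Lp.fourierTransformₗᵢ E3 ℂ ξ) := by
  have key : ∀ φ : L2 E3,
      inner ℂ ((Lp.fourierTransformₗᵢ E3 ℂ).symm φ) (((memLp_top_gaussian hb).toLp _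
        (μ := volume)) • ((Lp.fourierTransformₗᵢ E3 ℂ).symm φ) : L2 E3) = couplingInner hb φ := by
    intro φ
    refine DenseRange.induction_on (p := fun φ : L2 E3 =>
      inner ℂ ((Lp.fourierTransformₗᵢ E3 ℂ).symm φ) (((memLp_top_gaussian hb).toLp _
        (μ := volume)) • ((Lp.fourierTransformₗᵢ E3 ℂ).symm φ) : L2 E3) = couplingInner hb φ)
      (SchwartzMap.denseRange_toLpCLM (F := ℂ) (E := E3) (p := 2) (μ := volume)
        ENNReal.ofNat_ne_top) φ ?_ ?_
    · refine isClosed_eq ?_ (continuous_couplingInner hb)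
      exact (LinearIsometryEquiv.continuous _).inner
        ((continuous_gaussian_smul hb).comp (LinearIsometryEquiv.continuous _))
    · intro φ
      have e : (Lp.fourierTransformₗᵢ E3 ℂ).symm (SchwartzMap.toLpCLM ℝ ℂ 2 volume φ) =
          (𝓕⁻ φ).toLp 2 := (SchwartzMap.toLp_fourierInv_eq φ)
      rw [e, inner_gaussian_smul hb]
      have e1 : (∫ y : E3, ((Real.exp (-b * ‖y‖ ^ 2) : ℝ) : ℂ) *
          (starRingEnd ℂ (((𝓕⁻ φ).toLp 2 : L2 E3) y) * ((𝓕⁻ φ).toLp 2 : L2 E3) y)) =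
          ∫ y : E3, ((Real.exp (-b * ‖y‖ ^ 2) : ℝ) : ℂ) *
      (starRingEnd ℂ ((𝓕⁻ φ : 𝓢(E3, ℂ)) y) * (𝓕⁻ φ : 𝓢(E3, ℂ)) y) := by
        refine integral_congr_ae ?_
        filter_upwards [(𝓕⁻ φ : 𝓢(E3, ℂ)).coeFn_toLp 2 volume] with y hy
        rw [hy]
      rw [e1, schwartz_gaussian_identity hb]
      rw [SchwartzMap.toLpCLM_apply, coupling_schwartz hb φ]
  have h := key (Lp.fourierTransformₗᵢ E3 ℂ ξ)
  rwa [LinearIsometryEquiv.symm_apply_apply] at h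

end GaussianIdentity

/-! ### The Coulomb form in momentum space, by superposing Gaussians. -/

section CoulombForm

theorem integral_coulomb_laplace {s : ℝ} (hs : 0 < s) :
    ∫ b in Set.Ioi (0 : ℝ), (√Real.pi)⁻¹ * b ^ (-(1 / 2) : ℝ) * Real.exp (-b * s ^ 2) = 1 / s := by
  have h := Real.integral_rpow_mul_exp_neg_mul_Ioi (a := 1 / 2) (r := s ^ 2) (by norm_num)
    (by positivity)
  have e : ∀ b : ℝ, (√Real.pi)⁻¹ * b ^ (-(1 / 2) : ℝ) * Real.exp (-b * s ^ 2) =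
      (√Real.pi)⁻¹ * (b ^ ((1 / 2 : ℝ) - 1) * Real.exp (-(s ^ 2 * b))) := by
    intro b
    rw [mul_assoc]
    norm_num [mul_comm]
  simp_rw [e]
  rw [integral_const_mul, h, Real.Gamma_one_half_eq, ← Real.sqrt_eq_rpow, Real.sqrt_div (by simp),
    Real.sqrt_one, Real.sqrt_sq hs.le]
  have : √Real.pi ≠ 0 := by positivity
  field_simp

theorem integral_inv_sq_exp_inv {c : ℝ} (hc : 0 < c) :
    ∫ b in Set.Ioi (0 : ℝ), (b ^ 2)⁻¹ * Real.exp (-c / b) = 1 / c := by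
  -- The antiderivative is e^{-c/b}/c. Writing it through `expNegInvGlue` extends it continuously by
  -- zero to b = 0.
  have h := integral_Ioi_of_hasDerivAt_of_nonneg
    (g := fun b => c⁻¹ * expNegInvGlue (c⁻¹ * b)) (a := 0) (l := c⁻¹)
    (g' := fun b => (b ^ 2)⁻¹ * Real.exp (-c / b)) ?_ ?_ ?_ ?_
  · rw [h]
    simp [expNegInvGlue.zero]
  · exact (continuous_const.mul ((expNegInvGlue.contDiff (n := 0)).continuous.comp
      (continuous_const.mul continuous_id))).continuousWithinAt
  · intro b hb
    have hb : 0 < b := hb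
    have h1 : HasDerivAt (fun b => c⁻¹ * Real.exp (-(c * b⁻¹)))
        (c⁻¹ * (Real.exp (-(c * b⁻¹)) * -(c * (-(b ^ 2)⁻¹)))) b :=
      (((hasDerivAt_inv hb.ne').const_mul c).neg.exp).const_mul c⁻¹
    refine (h1.congr_of_eventuallyEq ?_).congr_deriv ?_
    · filter_upwards [Ioi_mem_nhds hb] with x hx
      have hx : 0 < x := hx
      rw [expNegInvGlue, if_neg (by push Not; positivity), mul_inv, inv_inv]
    · field_simp
  · intro b hb
    positivity
  · have h1 : Tendsto (fun b : ℝ => c⁻¹ * Real.exp (-(c * b⁻¹))) atTop (𝓝 (c⁻¹ * Real.exp (-(c * 0)))) :=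
      ((Real.continuous_exp.tendsto _).comp (tendsto_inv_atTop_zero.const_mul c).neg).const_mul _
    simp only [mul_zero, neg_zero, Real.exp_zero, mul_one] at h1
    refine h1.congr' ?_
    filter_upwards [eventually_gt_atTop 0] with x hx
    rw [expNegInvGlue, if_neg (by push Not; positivity), mul_inv, inv_inv]

theorem coulomb_weight_gaussianHat {b : ℝ} (hb : 0 < b) (v : E3) :
    (√Real.pi)⁻¹ * b ^ (-(1 / 2) : ℝ) * gaussianHat b v =
      Real.pi * ((b ^ 2)⁻¹ * Real.exp (-(Real.pi ^ 2 * ‖v‖ ^ 2) / b)) := by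
  have hpi := Real.pi_pos
  have e1 : (Real.pi / b) ^ (3 / 2 : ℝ) = Real.pi * √Real.pi * (b ^ (3 / 2 : ℝ))⁻¹ := by
    rw [Real.div_rpow hpi.le hb.le, div_eq_mul_inv, Real.sqrt_eq_rpow]
    congr 1
    rw [← Real.rpow_one_add' hpi.le (by norm_num)]
    norm_num
  have e2 : b ^ (-(1 / 2) : ℝ) * (b ^ (3 / 2 : ℝ))⁻¹ = (b ^ 2)⁻¹ := by
    rw [← Real.rpow_neg hb.le, ← Real.rpow_add hb, ← Real.rpow_natCast, ← Real.rpow_neg hb.le]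
    norm_num
  rw [gaussianHat, e1, ← e2]
  have e3 : -(Real.pi ^ 2 / b) * ‖v‖ ^ 2 = -(Real.pi ^ 2 * ‖v‖ ^ 2) / b := by ring
  rw [e3]
  have : √Real.pi ≠ 0 := by positivity
  field_simp

theorem integral_coulomb_gaussianHat {v : E3} (hv : v ≠ 0) :
    ∫ b in Set.Ioi (0 : ℝ), (√Real.pi)⁻¹ * b ^ (-(1 / 2) : ℝ) * gaussianHat b v =
      1 / (Real.pi * ‖v‖ ^ 2) := by
  rw [setIntegral_congr_fun measurableSet_Ioi fun b hb => coulomb_weight_gaussianHat hb v,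
    integral_const_mul, integral_inv_sq_exp_inv (by have := norm_pos_iff.2 hv; positivity)]
  have := norm_pos_iff.2 hv
  field_simp

theorem integrable_of_integral_ne_zero {α : Type*} [MeasurableSpace α] {μ : Measure α} {g : α → ℝ}
    (h : ∫ x, g x ∂μ ≠ 0) : Integrable g μ := by
  by_contra hc
  exact h (integral_undef hc)

theorem gaussian_form_eq {b : ℝ} (hb : 0 < b) (ξ : L2 E3) :
    Integrable (fun y : E3 => Real.exp (-b * ‖y‖ ^ 2) * ‖ξ y‖ ^ 2) ∧
    Integrable (fun z : E3 × E3 => gaussianHat b (z.1 - z.2) *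
      (starRingEnd ℂ ((Lp.fourierTransformₗᵢ E3 ℂ ξ : L2 E3) z.1) *
        (Lp.fourierTransformₗᵢ E3 ℂ ξ : L2 E3) z.2).re) ∧
    ∫ y : E3, Real.exp (-b * ‖y‖ ^ 2) * ‖ξ y‖ ^ 2 =
      kernelForm (Lp.fourierTransformₗᵢ E3 ℂ ξ : L2 E3) fun z => gaussianHat b (z.1 - z.2) := by
  have h1 := coupling_integrable hb (Lp.fourierTransformₗᵢ E3 ℂ ξ)
  have h0 := inner_gaussian_smul_eq hb ξ
  rw [inner_gaussian_smul hb, ← h1.2] at h0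
  have hi : Integrable (fun y : E3 => Real.exp (-b * ‖y‖ ^ 2) * ‖ξ y‖ ^ 2) := by
    refine ((Lp.memLp ξ).integrable_norm_pow (by norm_num)).bdd_mul (c := 1)
      (by fun_prop : Continuous _).aestronglyMeasurable (ae_of_all _ fun p => ?_)
    rw [Real.norm_eq_abs, abs_of_nonneg (by positivity), Real.exp_le_one_iff]
    nlinarith [sq_nonneg ‖p‖]
  have e : ∀ y : E3, ((Real.exp (-b * ‖y‖ ^ 2) : ℝ) : ℂ) * (starRingEnd ℂ (ξ y) * ξ y) =
      ((Real.exp (-b * ‖y‖ ^ 2) * ‖ξ y‖ ^ 2 : ℝ) : ℂ) := by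
    intro y
    rw [mul_comm (starRingEnd ℂ (ξ y)), Complex.mul_conj, Complex.normSq_eq_norm_sq]
    push_cast
    ring
  simp_rw [e] at h0
  rw [integral_complex_ofReal] at h0
  have h2 := congrArg Complex.re h0
  rw [Complex.ofReal_re] at h2
  have h3 := integral_re h1.1
  simp only [RCLike.re_to_complex, Complex.re_ofReal_mul] at h3
  refine ⟨hi, ?_, ?_⟩
  · have := h1.1.re
    simpa only [RCLike.re_to_complex, Complex.re_ofReal_mul] using this
  · rw [h2, ← h3]
    rfl

theorem ae_sub_ne_zero : ∀ᵐ z : E3 × E3, z.1 - z.2 ≠ 0 := by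
  filter_upwards [ae_pair_norm] with z hz h
  exact hz.2.2 (by rw [sub_eq_zero.1 h])

/-- Integrate the Gaussian identity against the weight that represents 1/|y| as a Laplace integral
in |y|², and apply Fubini on both sides. Absolute convergence is assumed only in momentum space;
positivity of the position side transfers it there. -/
theorem coulomb_form_fourierTransform (ξ : L2 E3)
    (hK : KernelConverges (Lp.fourierTransformₗᵢ E3 ℂ ξ : L2 E3)
      fun z => 1 / (Real.pi * ‖z.1 - z.2‖ ^ 2)) :
    Integrable (fun y : E3 => ‖ξ y‖ ^ 2 / ‖y‖) ∧
    ∫ y : E3, ‖ξ y‖ ^ 2 / ‖y‖ = kernelForm (Lp.fourierTransformₗᵢ E3 ℂ ξ : L2 E3)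
      fun z => 1 / (Real.pi * ‖z.1 - z.2‖ ^ 2) := by
  set F : L2 E3 := Lp.fourierTransformₗᵢ E3 ℂ ξ with hF
  have hFm : AEStronglyMeasurable F := (Lp.memLp F).1
  have hξm : AEStronglyMeasurable ξ := (Lp.memLp ξ).1
  set wt : ℝ → ℝ := fun b => (√Real.pi)⁻¹ * b ^ (-(1 / 2) : ℝ) with hwt
  have hwm : Measurable wt := by rw [hwt]; fun_prop
  have hw0 : ∀ b : ℝ, 0 < b → 0 ≤ wt b := fun b hb => by simp only [hwt]; positivity
  have hGm : Measurable fun x : ℝ × (E3 × E3) => gaussianHat x.1 (x.2.1 - x.2.2) := by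
    unfold gaussianHat
    fun_prop
  set Φ : ℝ × (E3 × E3) → ℝ := fun x => wt x.1 * gaussianHat x.1 (x.2.1 - x.2.2) *
    (starRingEnd ℂ (F x.2.1) * F x.2.2).re with hΦ
  set μ := volume.restrict (Set.Ioi (0 : ℝ)) with hμ
  have hΦm : AEStronglyMeasurable Φ (μ.prod volume) :=
    ((hwm.comp measurable_fst).mul hGm).aestronglyMeasurable.mul
      (aestronglyMeasurable_re_conj_mul hFm).comp_snd
  have hΦi : Integrable Φ (μ.prod volume) := by
    rw [integrable_prod_iff' hΦm]
    have e : ∀ z : E3 × E3, z.1 - z.2 ≠ 0 → ∫ b, ‖Φ (b, z)‖ ∂μ =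
        1 / (Real.pi * ‖z.1 - z.2‖ ^ 2) * |(starRingEnd ℂ (F z.1) * F z.2).re| := by
      intro z hz
      rw [← integral_coulomb_gaussianHat hz, ← integral_mul_const]
      refine setIntegral_congr_fun measurableSet_Ioi fun b hb => ?_
      simp only [hΦ]
      rw [norm_mul, Real.norm_eq_abs, Real.norm_eq_abs, abs_of_nonneg]
      exact mul_nonneg (hw0 b hb) (gaussianHat_nonneg hb _)
    constructor
    · filter_upwards [ae_sub_ne_zero] with z hz
      have h0 : Integrable (fun b => (√Real.pi)⁻¹ * b ^ (-(1 / 2) : ℝ) *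
          gaussianHat b (z.1 - z.2)) μ := by
        refine integrable_of_integral_ne_zero ?_
        rw [integral_coulomb_gaussianHat hz]
        have := norm_pos_iff.2 hz
        positivity
      exact h0.mul_const (starRingEnd ℂ (F z.1) * F z.2).re
    · refine (hK.integrable hFm).norm.congr ?_
      filter_upwards [ae_sub_ne_zero] with z hz
      rw [e z hz, norm_mul, Real.norm_eq_abs, Real.norm_eq_abs, abs_of_nonneg]
      positivity
  have hb_pos : ∀ᵐ b ∂μ, 0 < b := ae_restrict_mem measurableSet_Ioi
  have e1 : ∀ b, 0 < b → ∫ z, Φ (b, z) = wt b * ∫ y : E3, Real.exp (-b * ‖y‖ ^ 2) * ‖ξ y‖ ^ 2 := by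
    intro b hb
    rw [(gaussian_form_eq hb ξ).2.2, kernelForm, ← integral_const_mul]
    congr 1 with z
    simp only [hΦ, ← hF]
    ring
  set Ψ : ℝ × E3 → ℝ := fun x => wt x.1 * (Real.exp (-x.1 * ‖x.2‖ ^ 2) * ‖ξ x.2‖ ^ 2) with hΨ
  have hΨm : AEStronglyMeasurable Ψ (μ.prod volume) := by
    refine (hwm.comp measurable_fst).aestronglyMeasurable.mul ?_
    refine AEStronglyMeasurable.mul (by fun_prop : Continuous _).aestronglyMeasurable ?_
    exact (hξm.norm.pow 2).comp_snd
  have hΨi : Integrable Ψ (μ.prod volume) := by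
    rw [integrable_prod_iff hΨm]
    constructor
    · filter_upwards [hb_pos] with b hb
      exact (gaussian_form_eq hb ξ).1.const_mul (wt b)
    · refine hΦi.integral_prod_left.congr ?_
      filter_upwards [hb_pos] with b hb
      rw [e1 b hb, ← integral_const_mul]
      congr 1 with y
      rw [Real.norm_eq_abs, abs_of_nonneg]
      exact mul_nonneg (hw0 b hb) (by positivity)
  have e2 : ∀ᵐ y : E3, ∫ b, Ψ (b, y) ∂μ = ‖ξ y‖ ^ 2 / ‖y‖ := by
    filter_upwards [ae_ne_zero_E3] with y hy
    have h := integral_coulomb_laplace (norm_pos_iff.2 hy)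
    rw [div_eq_mul_one_div, mul_comm, ← h, ← integral_mul_const]
    congr 1 with b
    simp only [hΨ, hwt]
    ring
  have e3 : ∀ᵐ z : E3 × E3, ∫ b, Φ (b, z) ∂μ = 1 / (Real.pi * ‖z.1 - z.2‖ ^ 2) *
      (starRingEnd ℂ (F z.1) * F z.2).re := by
    filter_upwards [ae_sub_ne_zero] with z hz
    rw [← integral_coulomb_gaussianHat hz, ← integral_mul_const]
  refine ⟨hΨi.integral_prod_right.congr e2, ?_⟩
  rw [← integral_congr_ae e2, kernelForm, ← integral_congr_ae e3, ← integral_prod_symm _ hΨi,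
    ← integral_prod_symm _ hΦi, integral_prod _ hΨi, integral_prod _ hΦi]
  refine integral_congr_ae ?_
  filter_upwards [hb_pos] with b hb
  rw [e1 b hb, ← integral_const_mul]

instance : (volume : Measure (E3 × E3)).IsAddHaarMeasure :=
  inferInstanceAs ((volume : Measure E3).prod (volume : Measure E3)).IsAddHaarMeasure

theorem uFourier_E3_eq (ξ : L2 E3) (p : E3) : uFourier ξ p =
    (((2 * Real.pi) ^ (-(3 / 2) : ℝ) : ℝ) : ℂ) *
      (Lp.fourierTransformₗᵢ E3 ℂ ξ : L2 E3) ((2 * Real.pi)⁻¹ • p) := by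
  rw [uFourier, finrank_euclideanSpace_fin]
  norm_num

/-- The Coulomb form in momentum space. -/
theorem coulomb_form_eq (ξ : L2 E3)
    (hN : Integrable (fun p => ‖p‖ * ‖uFourier ξ p‖ ^ 2)) :
    Integrable (fun y : E3 => ‖ξ y‖ ^ 2 / ‖y‖) ∧
    kernelForm (uFourier ξ) (fun z => 1 / ‖z.1 - z.2‖ ^ 2) =
      2 * Real.pi ^ 2 * ∫ y : E3, ‖ξ y‖ ^ 2 / ‖y‖ := by
  have hK := (kernelConverges_inv_sq_sub (memLp_uFourier ξ).1 hN).1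
  have hpi := Real.pi_pos
  set F : L2 E3 := Lp.fourierTransformₗᵢ E3 ℂ ξ with hF
  have hc : ((2 * Real.pi) ^ (-(3 / 2) : ℝ)) ^ 2 = ((2 * Real.pi) ^ 3)⁻¹ := by
    rw [← Real.rpow_natCast, ← Real.rpow_mul (by positivity), ← Real.rpow_natCast,
      ← Real.rpow_neg (by positivity)]
    norm_num
  have hfr : Module.finrank ℝ (E3 × E3) = 6 := by
    rw [Module.finrank_prod, finrank_euclideanSpace_fin]
  -- One change of variables serves two choices of B: the product of moduli for convergence, and the
  -- real part of the Hermitian product for the value.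
  have key : ∀ B : ℂ → ℂ → ℝ, (∀ (c : ℝ) (x y : ℂ), B ((c : ℂ) * x) ((c : ℂ) * y) = c ^ 2 * B x y) →
      ∀ z : E3 × E3, 1 / ‖z.1 - z.2‖ ^ 2 * B (uFourier ξ z.1) (uFourier ξ z.2) =
        (fun z : E3 × E3 => ((2 * Real.pi) ^ 4)⁻¹ * 2⁻¹ * (1 / (Real.pi * ‖z.1 - z.2‖ ^ 2) *
          B (F z.1) (F z.2))) ((2 * Real.pi)⁻¹ • z) := by
    intro B hB z
    simp only [uFourier_E3_eq, ← hF, hB, hc, Prod.smul_fst, Prod.smul_snd, ← smul_sub, norm_smul,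
      mul_pow, Real.norm_eq_abs, sq_abs]
    field_simp
  have hconv : KernelConverges F fun z => 1 / (Real.pi * ‖z.1 - z.2‖ ^ 2) := by
    refine ⟨(by fun_prop : Measurable _).aestronglyMeasurable, ?_⟩
    have h := hK.2.congr (ae_of_all _ (key (fun x y => ‖x‖ * ‖y‖) (by
      intro c x y
      simp only [norm_mul, Complex.norm_real, Real.norm_eq_abs]
      rw [← sq_abs c]
      ring)))
    have h1 := (integrable_comp_smul_iff volume (fun z : E3 × E3 => ((2 * Real.pi) ^ 4)⁻¹ * 2⁻¹ *
      (1 / (Real.pi * ‖z.1 - z.2‖ ^ 2) * (‖F z.1‖ * ‖F z.2‖))) (R := (2 * Real.pi)⁻¹)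
      (by positivity)).1 h
    have h2 := h1.const_mul ((2 * Real.pi) ^ 4 * 2)
    refine h2.congr (ae_of_all _ fun z => ?_)
    simp only
    field_simp
  have h := coulomb_form_fourierTransform ξ hconv
  refine ⟨h.1, ?_⟩
  rw [h.2, kernelForm, integral_congr_ae (ae_of_all _ (key (fun x y => (starRingEnd ℂ x * y).re) (by
      intro c x y
      simp only [map_mul, Complex.conj_ofReal]
      rw [show (c : ℂ) * starRingEnd ℂ x * ((c : ℂ) * y) = ((c ^ 2 : ℝ) : ℂ) * (starRingEnd ℂ x * y)
        by push_cast; ring, Complex.re_ofReal_mul]))),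
    Measure.integral_comp_inv_smul volume (fun z : E3 × E3 => ((2 * Real.pi) ^ 4)⁻¹ * 2⁻¹ *
      (1 / (Real.pi * ‖z.1 - z.2‖ ^ 2) * (starRingEnd ℂ (F z.1) * F z.2).re)), hfr,
      integral_const_mul, abs_of_nonneg (by positivity), smul_eq_mul, kernelForm]
  field_simp
  ring

end CoulombForm

/-! ### Completeness of weighted norms. -/

section Closedness

variable {E : Type} [NormedAddCommGroup E] [InnerProductSpace ℝ E] [FiniteDimensional ℝ E]
  [MeasurableSpace E] [BorelSpace E]

theorem exists_seq_tendsto_uFourier {u : ℕ → L2 E} {v : L2 E} (h : Tendsto u atTop (𝓝 v)) :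
    ∃ φ : ℕ → ℕ, StrictMono φ ∧
      ∀ᵐ p, Tendsto (fun k => uFourier (u (φ k)) p) atTop (𝓝 (uFourier v p)) := by
  have h1 : Tendsto (fun n => Lp.fourierTransformₗᵢ E ℂ (u n)) atTop
      (𝓝 (Lp.fourierTransformₗᵢ E ℂ v)) :=
    ((Lp.fourierTransformₗᵢ E ℂ).continuous.tendsto v).comp h
  obtain ⟨φ, hφ, hae⟩ := (tendstoInMeasure_of_tendsto_Lp h1).exists_seq_tendsto_ae
  refine ⟨φ, hφ, ?_⟩
  have h2 := (Measure.quasiMeasurePreserving_smul (volume : Measure E)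
    (r := (2 * Real.pi)⁻¹) (by positivity)).ae hae
  filter_upwards [h2] with p hp
  exact hp.const_mul _

/-- Completeness of a weighted norm on the Fourier side, by Fatou's lemma. -/
theorem weighted_norm_closed {ω : E → ℝ} (hω : Measurable ω) (hω0 : ∀ p, 0 ≤ ω p)
    {u : ℕ → L2 E} {v : L2 E} (h : Tendsto u atTop (𝓝 v))
    (hi : ∀ n m, Integrable fun p => ω p * ‖uFourier (u n - u m) p‖ ^ 2)
    (hc : Tendsto (fun nm : ℕ × ℕ => ∫ p, ω p * ‖uFourier (u nm.1 - u nm.2) p‖ ^ 2) atTop (𝓝 0)) :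
    (∀ᶠ n in atTop, Integrable fun p => ω p * ‖uFourier (u n - v) p‖ ^ 2) ∧
    Tendsto (fun n => ∫ p, ω p * ‖uFourier (u n - v) p‖ ^ 2) atTop (𝓝 0) := by
  obtain ⟨φ, hφ, hae⟩ := exists_seq_tendsto_uFourier h
  have hm : ∀ w : L2 E, AEStronglyMeasurable fun p => ω p * ‖uFourier w p‖ ^ 2 := fun w =>
    hω.aestronglyMeasurable.mul ((memLp_uFourier w).1.norm.pow 2)
  have key : ∀ ε > 0, ∃ N, ∀ n ≥ N, (Integrable fun p => ω p * ‖uFourier (u n - v) p‖ ^ 2) ∧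
      ∫ p, ω p * ‖uFourier (u n - v) p‖ ^ 2 ≤ ε := by
    intro ε hε
    have h1 := (hc.eventually_le_const hε)
    obtain ⟨⟨N, M⟩, hNM⟩ := eventually_atTop.1 h1
    refine ⟨N, fun n hn => ?_⟩
    have hle : ∫⁻ p, ENNReal.ofReal (ω p * ‖uFourier (u n - v) p‖ ^ 2) ≤ ENNReal.ofReal ε := by
      -- L² convergence gives pointwise convergence of the transforms along a subsequence only. That
      -- suffices: Fatou with n fixed and m running through the subsequence preserves the Cauchy
      -- bound.
      have e : ∀ᵐ p, ENNReal.ofReal (ω p * ‖uFourier (u n - v) p‖ ^ 2) =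
          liminf (fun k => ENNReal.ofReal (ω p * ‖uFourier (u n - u (φ k)) p‖ ^ 2)) atTop := by
        have h2 : ∀ᵐ p, ∀ k, uFourier (u n - u (φ k)) p = uFourier (u n) p - uFourier (u (φ k)) p :=
          ae_all_iff.2 fun k => uFourier_sub _ _
        filter_upwards [hae, h2, uFourier_sub (u n) v] with p hp h2 h3
        refine (Tendsto.liminf_eq ?_).symm
        simp_rw [h2, h3]
        exact (ENNReal.continuous_ofReal.tendsto _).comp
          (((tendsto_const_nhds.sub hp).norm.pow 2).const_mul _)
      rw [lintegral_congr_ae e]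
      refine (lintegral_liminf_le' fun k => (hm _).aemeasurable.ennreal_ofReal).trans ?_
      refine liminf_le_of_frequently_le' (Eventually.frequently ?_)
      filter_upwards [hφ.tendsto_atTop.eventually_ge_atTop M] with k hk
      rw [← ofReal_integral_eq_lintegral_ofReal (hi _ _)
        (ae_of_all _ fun p => mul_nonneg (hω0 p) (by positivity))]
      exact ENNReal.ofReal_le_ofReal (hNM (n, φ k) ⟨hn, hk⟩)
    have hint : Integrable fun p => ω p * ‖uFourier (u n - v) p‖ ^ 2 := by
      refine ⟨hm _, ?_⟩
      rw [hasFiniteIntegral_iff_ofReal (ae_of_all _ fun p => mul_nonneg (hω0 p) (by positivity))]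
      exact hle.trans_lt ENNReal.ofReal_lt_top
    refine ⟨hint, ?_⟩
    rw [← ofReal_integral_eq_lintegral_ofReal hint
      (ae_of_all _ fun p => mul_nonneg (hω0 p) (by positivity))] at hle
    exact (ENNReal.ofReal_le_ofReal_iff hε.le).1 hle
  constructor
  · obtain ⟨N, hN⟩ := key 1 one_pos
    filter_upwards [eventually_ge_atTop N] with n hn using (hN n hn).1
  · rw [Metric.tendsto_atTop]
    intro ε hε
    obtain ⟨N, hN⟩ := key (ε / 2) (by positivity)
    refine ⟨N, fun n hn => ?_⟩
    have h0 : 0 ≤ ∫ p, ω p * ‖uFourier (u n - v) p‖ ^ 2 :=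
      integral_nonneg fun p => mul_nonneg (hω0 p) (by positivity)
    rw [Real.dist_0_eq_abs, abs_of_nonneg h0]
    linarith [(hN n hn).2]

theorem sobolev_closed {s : ℝ} (hs : 0 ≤ s) {u : ℕ → L2 E} {v : L2 E}
    (hu : ∀ n, u n ∈ sobolev E s) (h : Tendsto u atTop (𝓝 v))
    (hc : Tendsto (fun nm : ℕ × ℕ => sobolevNormSq s (u nm.1 - u nm.2)) atTop (𝓝 0)) :
    v ∈ sobolev E s ∧ Tendsto (fun n => sobolevNormSq s (u n - v)) atTop (𝓝 0) := by
  have h1 := weighted_norm_closed (ω := fun p : E => (1 + ‖p‖ ^ 2) ^ s) (by fun_prop) (fun p => by positivity) h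
    (fun n m => (mem_sobolev_iff hs _).1 ((sobolev E s).sub_mem (hu n) (hu m))) hc
  refine ⟨?_, h1.2⟩
  obtain ⟨n, hn⟩ := h1.1.exists
  have h2 := (sobolev E s).sub_mem (hu n) ((mem_sobolev_iff hs _).2 hn)
  rwa [sub_sub_cancel] at h2

theorem sobolevNormSq_nonneg (s : ℝ) (f : L2 E) : 0 ≤ sobolevNormSq s f :=
  integral_nonneg fun p => by positivity

end Closedness

/-! ### The regularised potential as a bounded perturbation of γ/|y|. -/

section CutoffPotential

/-- Since (H1) holds only for almost every radius, transporting it to ℝ³ requires null sets of radii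
to have null preimages. -/
theorem norm_quasiMeasurePreserving : Measure.QuasiMeasurePreserving (fun y : E3 => ‖y‖)
    (volume : Measure E3) (volume.restrict (Set.Ioi (0 : ℝ))) := by
  refine ⟨measurable_norm, Measure.AbsolutelyContinuous.mk fun s hs h0 => ?_⟩
  rw [Measure.map_apply measurable_norm hs]
  set g : ℝ → ℝ := s.indicator 1 with hg
  have hz : (fun y : ℝ => y ^ 2 * g y) =ᵐ[volume.restrict (Set.Ioi (0 : ℝ))] 0 := by
    have : ∀ᵐ y ∂(volume.restrict (Set.Ioi (0 : ℝ))), y ∉ s := measure_eq_zero_iff_ae_notMem.1 h0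
    filter_upwards [this] with y hy
    simp [hg, hy]
  have hi : Integrable fun x : E3 => g ‖x‖ :=
    (integrable_radial_E3_iff g).2 ((integrable_zero _ _ _).congr hz.symm)
  have h1 := integral_radial_E3 g
  rw [integral_congr_ae hz] at h1
  simp only [Pi.zero_apply, integral_zero, mul_zero] at h1
  rw [integral_eq_zero_iff_of_nonneg (fun x => by
    simp only [hg]; exact Set.indicator_nonneg (by simp) _) hi] at h1
  rw [measure_eq_zero_iff_ae_notMem]
  filter_upwards [h1] with x hx hxs
  have : ‖x‖ ∈ s := hxs
  simp [hg, this] at hx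

/-- The difference from γ/|y| is β + γ(θ - 1)/|y|, and the linear bound on θ - 1 cancels the
singularity. -/
theorem gammaReg_spec {θ : ℝ → ℝ} (hθ : CutoffH1 θ) (β γ : ℝ) :
    AEStronglyMeasurable (gammaReg β γ θ) ∧
      ∃ C ≥ 0, ∀ᵐ y : E3, |gammaReg β γ θ y - γ / ‖y‖| ≤ C := by
  obtain ⟨hθm, c, hc, hθc⟩ := hθ
  have h1 : AEStronglyMeasurable fun y : E3 => θ ‖y‖ :=
    hθm.1.comp_quasiMeasurePreserving norm_quasiMeasurePreserving
  refine ⟨?_, |β| + |γ| * c, by positivity, ?_⟩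
  · unfold gammaReg
    exact aestronglyMeasurable_const.add
      ((by fun_prop : Measurable fun y : E3 => γ / ‖y‖).aestronglyMeasurable.mul h1)
  · filter_upwards [norm_quasiMeasurePreserving.ae hθc, ae_ne_zero_E3] with y hy hy0
    have hy1 := norm_pos_iff.2 hy0
    have e : gammaReg β γ θ y - γ / ‖y‖ = β + γ * ((θ ‖y‖ - 1) / ‖y‖) := by
      unfold gammaReg
      field_simp
      ring
    rw [e]
    refine (abs_add_le _ _).trans ?_
    rw [abs_mul, abs_div, abs_of_pos hy1]
    gcongr
    rwa [div_le_iff₀ hy1]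

theorem gammaReg_integral {θ : ℝ → ℝ} {β γ C : ℝ} (hm : AEStronglyMeasurable (gammaReg β γ θ))
    (hC : ∀ᵐ y : E3, |gammaReg β γ θ y - γ / ‖y‖| ≤ C) {ξ : L2 E3}
    (hξ : Integrable fun y : E3 => ‖ξ y‖ ^ 2 / ‖y‖) :
    Integrable (fun y : E3 => gammaReg β γ θ y * ‖ξ y‖ ^ 2) ∧
    |(∫ y : E3, gammaReg β γ θ y * ‖ξ y‖ ^ 2) - γ * ∫ y : E3, ‖ξ y‖ ^ 2 / ‖y‖| ≤ C * ‖ξ‖ ^ 2 := by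
  have hS : Integrable fun y : E3 => ‖ξ y‖ ^ 2 := (Lp.memLp ξ).integrable_norm_pow (by norm_num)
  have h1 : Integrable fun y : E3 => (gammaReg β γ θ y - γ / ‖y‖) * ‖ξ y‖ ^ 2 := by
    refine hS.bdd_mul (c := C) (hm.sub (by fun_prop : Measurable fun y : E3 =>
      γ / ‖y‖).aestronglyMeasurable) ?_
    filter_upwards [hC] with y hy using hy
  have h2 := hξ.const_mul γ
  have e : ∀ y : E3, gammaReg β γ θ y * ‖ξ y‖ ^ 2 =
      (gammaReg β γ θ y - γ / ‖y‖) * ‖ξ y‖ ^ 2 + γ * (‖ξ y‖ ^ 2 / ‖y‖) := fun y => by ring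
  simp_rw [e]
  refine ⟨h1.add h2, ?_⟩
  rw [integral_add h1 h2, integral_const_mul, add_sub_cancel_right, ← integral_norm_sq_eq,
    ← integral_const_mul]
  refine (abs_integral_le_integral_abs).trans ?_
  refine integral_mono_ae h1.norm (hS.const_mul C) ?_
  filter_upwards [hC] with y hy
  rw [abs_mul, abs_of_nonneg (by positivity : 0 ≤ ‖ξ y‖ ^ 2)]
  gcongr

end CutoffPotential

/-! ### The charge form: convergence, reality, bounds and closedness. -/

section ChargeForm

theorem sqrt_one_add_sq_eq (p : E3) : (1 + ‖p‖ ^ 2) ^ (1 / 2 : ℝ) = √(1 + ‖p‖ ^ 2) :=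
  (Real.sqrt_eq_rpow _).symm

theorem le_sqrt_one_add_sq (p : E3) : ‖p‖ ≤ √(1 + ‖p‖ ^ 2) :=
  Real.le_sqrt_of_sq_le (by linarith)

theorem sqrt_diag_le {lam : ℝ} (hl : 0 ≤ lam) (p : E3) :
    √(3 / 4 * ‖p‖ ^ 2 + lam) ≤ √(1 + lam) * √(1 + ‖p‖ ^ 2) := by
  rw [← Real.sqrt_mul (by positivity)]
  refine Real.sqrt_le_sqrt ?_
  nlinarith [sq_nonneg ‖p‖, mul_nonneg hl (sq_nonneg ‖p‖)]

variable {ξ : L2 E3}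

theorem integrable_of_mem_sobolev_half (hξ : ξ ∈ sobolev E3 (1 / 2)) {ω : E3 → ℝ} {C : ℝ}
    (hω : Measurable ω) (h : ∀ p, |ω p| ≤ C * √(1 + ‖p‖ ^ 2)) :
    Integrable (fun p => ω p * ‖uFourier ξ p‖ ^ 2) ∧
      ∫ p, ω p * ‖uFourier ξ p‖ ^ 2 ≤ C * sobolevNormSq (1 / 2) ξ := by
  have h1 := (mem_sobolev_iff (by norm_num) ξ).1 hξ
  have h2 := h1.const_mul C
  have hle : ∀ p, |ω p * ‖uFourier ξ p‖ ^ 2| ≤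
      C * ((1 + ‖p‖ ^ 2) ^ (1 / 2 : ℝ) * ‖uFourier ξ p‖ ^ 2) := by
    intro p
    rw [abs_mul, sqrt_one_add_sq_eq, abs_of_nonneg (by positivity : 0 ≤ ‖uFourier ξ p‖ ^ 2),
      ← mul_assoc]
    gcongr
    exact h p
  have hi : Integrable (fun p => ω p * ‖uFourier ξ p‖ ^ 2) :=
    h2.mono' (hω.aestronglyMeasurable.mul ((memLp_uFourier ξ).1.norm.pow 2)) (ae_of_all _ hle)
  refine ⟨hi, ?_⟩
  rw [sobolevNormSq, ← integral_const_mul]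
  exact integral_mono hi h2 fun p => (le_abs_self _).trans (hle p)

theorem norm_sq_le_sobolevNormSq_half (hξ : ξ ∈ sobolev E3 (1 / 2)) :
    ‖ξ‖ ^ 2 ≤ sobolevNormSq (1 / 2) ξ := by
  rw [← integral_norm_sq_uFourier]
  have := (integrable_of_mem_sobolev_half hξ (ω := fun _ => 1) (C := 1) (by fun_prop) fun p => by
    rw [abs_one, one_mul]
    exact Real.one_le_sqrt.2 (by linarith [sq_nonneg ‖p‖])).2
  simpa using this

theorem integrable_norm_mul_of_mem_sobolev_half (hξ : ξ ∈ sobolev E3 (1 / 2)) :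
    Integrable (fun p => ‖p‖ * ‖uFourier ξ p‖ ^ 2) ∧
      ∫ p, ‖p‖ * ‖uFourier ξ p‖ ^ 2 ≤ 1 * sobolevNormSq (1 / 2) ξ :=
  integrable_of_mem_sobolev_half hξ (by fun_prop) fun p => by
    rw [abs_norm, one_mul]
    exact le_sqrt_one_add_sq p

theorem integrable_diag (hξ : ξ ∈ sobolev E3 (1 / 2)) {lam : ℝ} (hl : 0 ≤ lam) :
    Integrable (fun p => √(3 / 4 * ‖p‖ ^ 2 + lam) * ‖uFourier ξ p‖ ^ 2) ∧
      ∫ p, √(3 / 4 * ‖p‖ ^ 2 + lam) * ‖uFourier ξ p‖ ^ 2 ≤ √(1 + lam) * sobolevNormSq (1 / 2) ξ :=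
  integrable_of_mem_sobolev_half hξ (by fun_prop) fun p => by
    rw [abs_of_nonneg (by positivity)]
    exact sqrt_diag_le hl p

theorem integrable_offDiagKernel (hξ : ξ ∈ sobolev E3 (1 / 2)) {lam : ℝ} (hl : 0 ≤ lam) :
    Integrable (fun z : E3 × E3 => offDiagKernel lam ξ z.1 z.2) := by
  have hfm := (memLp_uFourier ξ).1
  have hK := kernelConverges_stm hfm (integrable_norm_mul_of_mem_sobolev_half hξ).1 hl
  refine hK.2.mono ?_ (ae_of_all _ fun z => ?_)
  · unfold offDiagKernel
    have h1 : AEStronglyMeasurable (fun z : E3 × E3 => uFourier ξ z.1) := hfm.comp_fst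
    have h2 : AEStronglyMeasurable (fun z : E3 × E3 => uFourier ξ z.2) := hfm.comp_snd
    have h3 : Measurable fun z : E3 × E3 =>
      (((‖z.1‖ ^ 2 + ‖z.2‖ ^ 2 + inner ℝ z.1 z.2 + lam : ℝ) : ℂ))⁻¹ := by fun_prop
    simp_rw [div_eq_mul_inv]
    exact ((Complex.continuous_conj.comp_aestronglyMeasurable h1).mul h2).mul
      h3.aestronglyMeasurable
  · rw [offDiagKernel, norm_div, norm_mul, RCLike.norm_conj, Complex.norm_real, norm_mul, norm_mul,
      norm_norm, norm_norm, norm_div, norm_one]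
    apply le_of_eq
    ring

/-- Exchanging p and p' conjugates the integrand, so the integral is real and equals the integral of
the real part. -/
theorem integral_offDiagKernel (hξ : ξ ∈ sobolev E3 (1 / 2)) {lam : ℝ} (hl : 0 ≤ lam) :
    ∫ p : E3, ∫ p' : E3, offDiagKernel lam ξ p p' = ((kernelForm (uFourier ξ) fun z =>
      1 / (‖z.1‖ ^ 2 + ‖z.2‖ ^ 2 + inner ℝ z.1 z.2 + lam) : ℝ) : ℂ) := by
  have hi := integrable_offDiagKernel hξ hl
  have h1 : ∫ p : E3, ∫ p' : E3, offDiagKernel lam ξ p p' =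
      ∫ z : E3 × E3, offDiagKernel lam ξ z.1 z.2 := (integral_prod _ hi).symm
  have hsymm : starRingEnd ℂ (∫ z : E3 × E3, offDiagKernel lam ξ z.1 z.2) =
      ∫ z : E3 × E3, offDiagKernel lam ξ z.1 z.2 := by
    have h2 := integral_prod_swap (μ := (volume : Measure E3)) (ν := (volume : Measure E3))
      (fun z : E3 × E3 => offDiagKernel lam ξ z.1 z.2)
    rw [← integral_conj]
    refine Eq.trans ?_ h2
    congr 1 with z
    simp only [offDiagKernel, map_div₀, map_mul, Complex.conj_ofReal, Complex.conj_conj,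
      Prod.fst_swap, Prod.snd_swap]
    rw [real_inner_comm, mul_comm, add_comm (‖z.1‖ ^ 2)]
  rw [h1, ← Complex.conj_eq_iff_re.1 hsymm]
  congr 1
  have h3 := integral_re hi
  simp only [RCLike.re_to_complex] at h3
  rw [kernelForm, ← h3]
  congr 1 with z
  rw [offDiagKernel, Complex.div_ofReal_re]
  ring

/-- A crude bound, for the upper estimate only, from |p - p'|² ≤ 4(p² + p'² + p·p'). -/
theorem kernelForm_stm_abs_le (hξ : ξ ∈ sobolev E3 (1 / 2)) {lam : ℝ} (hl : 0 ≤ lam) :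
    |kernelForm (uFourier ξ) fun z => 1 / (‖z.1‖ ^ 2 + ‖z.2‖ ^ 2 + inner ℝ z.1 z.2 + lam)| ≤
      4 * Real.pi ^ 3 * sobolevNormSq (1 / 2) ξ := by
  have hfm := (memLp_uFourier ξ).1
  have hN := integrable_norm_mul_of_mem_sobolev_half hξ
  have hS := kernelConverges_inv_sq_sub hfm hN.1
  have hle : ∀ᵐ z : E3 × E3, 1 / (‖z.1‖ ^ 2 + ‖z.2‖ ^ 2 + inner ℝ z.1 z.2 + lam) ≤
      4 * (1 / ‖z.1 - z.2‖ ^ 2) ∧ 0 ≤ 1 / (‖z.1‖ ^ 2 + ‖z.2‖ ^ 2 + inner ℝ z.1 z.2 + lam) := by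
    filter_upwards [ae_sub_ne_zero] with z hz
    have h1 : 0 < ‖z.1 - z.2‖ ^ 2 := by have := norm_pos_iff.2 hz; positivity
    have h2 := abs_le.1 (abs_real_inner_le_norm z.1 z.2)
    have h3 : ‖z.1 - z.2‖ ^ 2 ≤ 4 * (‖z.1‖ ^ 2 + ‖z.2‖ ^ 2 + inner ℝ z.1 z.2 + lam) := by
      rw [norm_sub_sq_real]
      nlinarith [sq_nonneg (‖z.1‖ - ‖z.2‖)]
    refine ⟨?_, by have : 0 < ‖z.1‖ ^ 2 + ‖z.2‖ ^ 2 + inner ℝ z.1 z.2 + lam := by linarith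
                   positivity⟩
    rw [mul_one_div, div_le_div_iff₀ (by linarith) h1]
    linarith
  have hbound : |kernelForm (uFourier ξ) fun z =>
      1 / (‖z.1‖ ^ 2 + ‖z.2‖ ^ 2 + inner ℝ z.1 z.2 + lam)| ≤
      ∫ z : E3 × E3, 4 * (1 / ‖z.1 - z.2‖ ^ 2 * (‖uFourier ξ z.1‖ * ‖uFourier ξ z.2‖)) := by
    refine abs_integral_le_integral_abs.trans ?_
    refine integral_mono_ae
      ((kernelConverges_stm hfm hN.1 hl).integrable hfm).norm (hS.1.2.const_mul 4) ?_
    filter_upwards [hle] with z hz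
    rw [abs_mul, abs_of_nonneg hz.2, ← mul_assoc]
    exact mul_le_mul hz.1 (abs_re_conj_mul_le _ _) (abs_nonneg _) (by positivity)
  rw [integral_const_mul] at hbound
  have hpi := Real.pi_pos
  have h3 := hN.2
  have : Real.pi ^ 3 * ∫ p, ‖p‖ * ‖uFourier ξ p‖ ^ 2 ≤ Real.pi ^ 3 * (1 * sobolevNormSq (1 / 2) ξ) :=
    mul_le_mul_of_nonneg_left h3 (by positivity)
  linarith [hS.2]

/-- The charge form as a sum of real integrals. -/
noncomputable def realChargeForm (β γ : ℝ) (θ : ℝ → ℝ) (lam : ℝ) (ξ : L2 E3) : ℝ :=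
  (∫ p : E3, √(3 / 4 * ‖p‖ ^ 2 + lam) * ‖uFourier ξ p‖ ^ 2)
    - 1 / Real.pi ^ 2 * (kernelForm (uFourier ξ) fun z =>
      1 / (‖z.1‖ ^ 2 + ‖z.2‖ ^ 2 + inner ℝ z.1 z.2 + lam))
    + ∫ y : E3, gammaReg β γ θ y * ‖ξ y‖ ^ 2

theorem chargeForm_eq (β γ : ℝ) (θ : ℝ → ℝ) (hξ : ξ ∈ sobolev E3 (1 / 2)) {lam : ℝ}
    (hl : 0 ≤ lam) : chargeForm β γ θ lam ξ = ((realChargeForm β γ θ lam ξ : ℝ) : ℂ) := by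
  rw [chargeForm, integral_offDiagKernel hξ hl, realChargeForm]
  push_cast
  ring

theorem chargeForm_converges {θ : ℝ → ℝ} (hθ : CutoffH1 θ) (β γ : ℝ)
    (hξ : ξ ∈ sobolev E3 (1 / 2)) {lam : ℝ} (hl : 0 ≤ lam) :
    ChargeFormConverges β γ θ lam ξ := by
  obtain ⟨hm, C, -, hC⟩ := gammaReg_spec hθ β γ
  exact ⟨(integrable_diag hξ hl).1, integrable_offDiagKernel hξ hl, (gammaReg_integral hm hC
    (coulomb_form_eq ξ (integrable_norm_mul_of_mem_sobolev_half hξ).1).1).1⟩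

theorem realChargeForm_le {θ : ℝ → ℝ} (hθ : CutoffH1 θ) (β γ : ℝ) {lam : ℝ} (hl : 0 ≤ lam) :
    ∃ C : ℝ, ∀ ξ ∈ sobolev E3 (1 / 2),
      realChargeForm β γ θ lam ξ ≤ C * sobolevNormSq (1 / 2) ξ := by
  obtain ⟨hm, C, hC0, hC⟩ := gammaReg_spec hθ β γ
  refine ⟨√(1 + lam) + 4 * Real.pi + (|γ| * (Real.pi / 2) + C), fun ξ hξ => ?_⟩
  have hfm := (memLp_uFourier ξ).1
  have hpi := Real.pi_pos
  have hN := integrable_norm_mul_of_mem_sobolev_half hξ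
  have h1 := (integrable_diag hξ hl).2
  have h2 := (abs_le.1 (kernelForm_stm_abs_le hξ hl)).1
  have h3 := coulomb_form_eq ξ hN.1
  have h4 := kernelForm_inv_sq_sub_le hfm hN.1
  have h5 := (abs_le.1 (gammaReg_integral hm hC h3.1).2).2
  have h6 : 0 ≤ ∫ y : E3, ‖ξ y‖ ^ 2 / ‖y‖ := integral_nonneg fun y => by positivity
  have h7 := norm_sq_le_sobolevNormSq_half hξ
  have hS := sobolevNormSq_nonneg (1 / 2) ξ
  set N := ∫ p, ‖p‖ * ‖uFourier ξ p‖ ^ 2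
  set w := ∫ y : E3, ‖ξ y‖ ^ 2 / ‖y‖
  have h8 : w ≤ Real.pi / 2 * sobolevNormSq (1 / 2) ξ := by
    rw [h3.2] at h4
    have h9 : 2 * Real.pi ^ 2 * w ≤ Real.pi ^ 3 * sobolevNormSq (1 / 2) ξ :=
      h4.trans (mul_le_mul_of_nonneg_left (by linarith [hN.2]) (by positivity))
    have : 2 * Real.pi ^ 2 * w ≤ 2 * Real.pi ^ 2 * (Real.pi / 2 * sobolevNormSq (1 / 2) ξ) := by
      linarith
    exact le_of_mul_le_mul_left this (by positivity)
  have h10 : γ * w ≤ |γ| * (Real.pi / 2 * sobolevNormSq (1 / 2) ξ) :=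
    (mul_le_mul_of_nonneg_right (le_abs_self γ) h6).trans
      (mul_le_mul_of_nonneg_left h8 (abs_nonneg γ))
  have h11 : C * ‖ξ‖ ^ 2 ≤ C * sobolevNormSq (1 / 2) ξ := mul_le_mul_of_nonneg_left h7 hC0
  have h12 : -(1 / Real.pi ^ 2 * (kernelForm (uFourier ξ) fun z =>
      1 / (‖z.1‖ ^ 2 + ‖z.2‖ ^ 2 + inner ℝ z.1 z.2 + lam))) ≤
      4 * Real.pi * sobolevNormSq (1 / 2) ξ := by
    rw [← mul_neg, one_div, inv_mul_le_iff₀ (by positivity)]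
    linarith
  rw [realChargeForm]
  linarith

/-- A fraction η of the diagonal symbol is estimated by √λ to pay for the bounded part of Γ_reg, and
the rest by (√3/2)|p| to pay for the attraction (γ - 4/3) w through Kato's inequality. -/
theorem realChargeForm_coercive {θ : ℝ → ℝ} (hθ : CutoffH1 θ) (β : ℝ) {γ : ℝ}
    (hγ : gammaCrit < γ) : ∃ lam₀ > 0, ∃ c₀ > 0, ∀ lam > lam₀, ∀ ξ ∈ sobolev E3 (1 / 2),
      c₀ * sobolevNormSq (1 / 2) ξ ≤ realChargeForm β γ θ lam ξ := by
  obtain ⟨hm, C, hC0, hC⟩ := gammaReg_spec hθ β γ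
  have hpi := Real.pi_pos
  have hs3 : 0 < √3 := by positivity
  have hs3' : √3 * √3 = 3 := Real.mul_self_sqrt (by norm_num)
  have hcrit : gammaCrit = 4 / 3 - √3 / Real.pi := by
    rw [gammaCrit]
    field_simp
  have hgap : 0 < √3 / 2 - (4 / 3 - γ) * (Real.pi / 2) := by
    rw [hcrit] at hγ
    have h1 : 4 / 3 - γ < √3 / Real.pi := by linarith
    have h2 : (4 / 3 - γ) * (Real.pi / 2) < √3 / Real.pi * (Real.pi / 2) :=
      mul_lt_mul_of_pos_right h1 (by positivity)
    have h3 : √3 / Real.pi * (Real.pi / 2) = √3 / 2 := by field_simp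
    linarith
  -- The second entry is the margin left by Kato's inequality. The first handles γ ≥ 4/3, where the
  -- Coulomb term is nonnegative, and ensures η ≤ 1.
  set δ := min (√3 / 2) (√3 / 2 - (4 / 3 - γ) * (Real.pi / 2)) with hδ
  have hδ0 : 0 < δ := lt_min (by positivity) hgap
  have hδ1 : δ ≤ √3 / 2 := min_le_left _ _
  have hδ2 : δ ≤ √3 / 2 - (4 / 3 - γ) * (Real.pi / 2) := min_le_right _ _
  set η := δ / √3 with hη
  have hη0 : 0 < η := by positivity
  have hη1 : η ≤ 1 := by
    rw [hη, div_le_one hs3]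
    linarith
  have hη2 : η * √3 = δ := by rw [hη]; field_simp
  -- Beyond this λ, η√λ covers both C and the coefficient δ/2 of the L² part. Since (√3/2)η = δ/2,
  -- half of the margin δ also survives in front of N.
  refine ⟨((C + δ / 2) / η) ^ 2, by positivity, δ / 2, by positivity, fun lam hlam ξ hξ => ?_⟩
  have hl : 0 ≤ lam := (sq_nonneg _).trans hlam.le
  have hsl : C + δ / 2 ≤ η * √lam := by
    have : (C + δ / 2) / η ≤ √lam := Real.le_sqrt_of_sq_le hlam.le
    rwa [div_le_iff₀ hη0, mul_comm] at this
  have hfm := (memLp_uFourier ξ).1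
  have hN := (integrable_norm_mul_of_mem_sobolev_half hξ).1
  have hT := kernelForm_stm_le hfm hN hl
  have hc := coulomb_form_eq ξ hN
  have hW := kernelForm_inv_sq_sub_le hfm hN
  rw [hc.2] at hT hW
  have hG := (abs_le.1 (gammaReg_integral hm hC hc.1).2).1
  have hw0 : 0 ≤ ∫ y : E3, ‖ξ y‖ ^ 2 / ‖y‖ := integral_nonneg fun y => by positivity
  have hN0 : 0 ≤ ∫ p, ‖p‖ * ‖uFourier ξ p‖ ^ 2 := integral_nonneg fun y => by positivity
  have hSi := integrable_norm_sq_uFourier ξ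
  have hD : (1 - η) * (√3 / 2) * (∫ p, ‖p‖ * ‖uFourier ξ p‖ ^ 2) + η * √lam * ‖ξ‖ ^ 2 ≤
      ∫ p : E3, √(3 / 4 * ‖p‖ ^ 2 + lam) * ‖uFourier ξ p‖ ^ 2 := by
    rw [← integral_norm_sq_uFourier, ← integral_const_mul, ← integral_const_mul,
      ← integral_add (hN.const_mul _) (hSi.const_mul _)]
    refine integral_mono ((hN.const_mul _).add (hSi.const_mul _)) (integrable_diag hξ hl).1
      fun p => ?_
    have e1 : √3 / 2 * ‖p‖ ≤ √(3 / 4 * ‖p‖ ^ 2 + lam) := by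
      refine Real.le_sqrt_of_sq_le ?_
      have : (√3 / 2 * ‖p‖) ^ 2 = √3 * √3 / 4 * ‖p‖ ^ 2 := by ring
      rw [this, hs3']
      linarith
    have e2 : √lam ≤ √(3 / 4 * ‖p‖ ^ 2 + lam) := Real.sqrt_le_sqrt (by nlinarith [sq_nonneg ‖p‖])
    have e3 : (1 - η) * (√3 / 2 * ‖p‖) + η * √lam ≤ √(3 / 4 * ‖p‖ ^ 2 + lam) := by
      have a1 := mul_le_mul_of_nonneg_left e1 (sub_nonneg.2 hη1)
      have a2 := mul_le_mul_of_nonneg_left e2 hη0.le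
      linarith
    have := mul_le_mul_of_nonneg_right e3 (sq_nonneg ‖uFourier ξ p‖)
    simp only
    linarith
  have hH : sobolevNormSq (1 / 2) ξ ≤ (∫ p, ‖p‖ * ‖uFourier ξ p‖ ^ 2) + ‖ξ‖ ^ 2 := by
    rw [← integral_norm_sq_uFourier, ← integral_add hN hSi]
    refine integral_mono ((mem_sobolev_iff (by norm_num) ξ).1 hξ) (hN.add hSi) fun p => ?_
    simp only
    rw [sqrt_one_add_sq_eq, ← add_one_mul]
    gcongr
    rw [Real.sqrt_le_left (by positivity)]
    nlinarith [norm_nonneg p]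
  set N := ∫ p, ‖p‖ * ‖uFourier ξ p‖ ^ 2
  set w := ∫ y : E3, ‖ξ y‖ ^ 2 / ‖y‖
  have hw1 : w ≤ Real.pi / 2 * N := by
    have : 2 * Real.pi ^ 2 * w ≤ 2 * Real.pi ^ 2 * (Real.pi / 2 * N) := by linarith
    exact le_of_mul_le_mul_left this (by positivity)
  have hT2 : 1 / Real.pi ^ 2 * (kernelForm (uFourier ξ) fun z =>
      1 / (‖z.1‖ ^ 2 + ‖z.2‖ ^ 2 + inner ℝ z.1 z.2 + lam)) ≤ 4 / 3 * w := by
    rw [one_div, inv_mul_le_iff₀ (by positivity)]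
    linarith
  have hmain : δ * N - √3 / 2 * N ≤ (γ - 4 / 3) * w := by
    rcases le_total (4 / 3) γ with h | h
    · have a1 : 0 ≤ (γ - 4 / 3) * w := mul_nonneg (by linarith) hw0
      have a2 := mul_le_mul_of_nonneg_right hδ1 hN0
      linarith
    · have a1 : (4 / 3 - γ) * w ≤ (4 / 3 - γ) * (Real.pi / 2 * N) :=
        mul_le_mul_of_nonneg_left hw1 (by linarith)
      have a2 := mul_le_mul_of_nonneg_right hδ2 hN0
      linarith
  have hη3 : η * √3 * N = δ * N := by rw [hη2]
  have hS := mul_le_mul_of_nonneg_right hsl (sq_nonneg ‖ξ‖)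
  have hH2 := mul_le_mul_of_nonneg_left hH (by positivity : 0 ≤ δ / 2)
  rw [realChargeForm]
  linarith

theorem chargeForm_isClosed {θ : ℝ → ℝ} (hθ : CutoffH1 θ) (β γ : ℝ) {lam c₀ : ℝ} (hl : 0 ≤ lam)
    (hc₀ : 0 < c₀)
    (hc : ∀ ξ ∈ sobolev E3 (1 / 2), c₀ * sobolevNormSq (1 / 2) ξ ≤ realChargeForm β γ θ lam ξ) :
    IsClosedForm (sobolev E3 (1 / 2)) (chargeForm β γ θ lam) := by
  intro u v hu huv hq
  obtain ⟨C, hC⟩ := realChargeForm_le hθ β γ hl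
  have hsub := fun n m => (sobolev E3 (1 / 2)).sub_mem (hu n) (hu m)
  have h1 : Tendsto (fun nm : ℕ × ℕ => realChargeForm β γ θ lam (u nm.1 - u nm.2)) atTop (𝓝 0) := by
    have h := (Complex.continuous_re.tendsto 0).comp hq
    refine h.congr fun nm => ?_
    simp [chargeForm_eq β γ θ (hsub nm.1 nm.2) hl]
  have h2 : Tendsto (fun nm : ℕ × ℕ => sobolevNormSq (1 / 2) (u nm.1 - u nm.2)) atTop (𝓝 0) := by
    have h3 := h1.const_mul c₀⁻¹
    rw [mul_zero] at h3
    refine squeeze_zero (fun nm => sobolevNormSq_nonneg _ _) (fun nm => ?_) h3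
    rw [← div_eq_inv_mul, le_div_iff₀ hc₀, mul_comm]
    exact hc _ (hsub _ _)
  obtain ⟨hv, hlim⟩ := sobolev_closed (by norm_num) hu huv h2
  refine ⟨hv, ?_⟩
  have hs := fun n => (sobolev E3 (1 / 2)).sub_mem (hu n) hv
  have h4 : Tendsto (fun n => realChargeForm β γ θ lam (u n - v)) atTop (𝓝 0) := by
    have h5 := hlim.const_mul C
    rw [mul_zero] at h5
    exact squeeze_zero (fun n => (mul_nonneg hc₀.le (sobolevNormSq_nonneg _ _)).trans
      (hc _ (hs n))) (fun n => hC _ (hs n)) h5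
  have h6 := (Complex.continuous_ofReal.tendsto 0).comp h4
  rw [Complex.ofReal_zero] at h6
  refine h6.congr fun n => ?_
  simp [chargeForm_eq β γ θ (hs n) hl]

end ChargeForm

/-! ### Particle exchanges in momentum space. -/

section ExchangeMaps

theorem integral_comp_of_measurePreserving {α β : Type*} [MeasurableSpace α] [MeasurableSpace β]
    {μ : Measure α} {ν : Measure β} {T : α → β} (h : MeasurePreserving T μ ν) {g : β → ℝ}
    (hg : AEStronglyMeasurable g ν) : ∫ x, g (T x) ∂μ = ∫ y, g y ∂ν := by
  rw [← h.map_eq] at hg ⊢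
  exact (integral_map h.measurable.aemeasurable hg).symm

/-- An involution has determinant of modulus one. The exchange of particles 3 and 1 is not
orthogonal in these coordinates, so an isometry argument would not apply. -/
theorem LinearMap.measurePreserving_of_involutive {E : Type*} [NormedAddCommGroup E]
    [InnerProductSpace ℝ E] [FiniteDimensional ℝ E] [MeasurableSpace E] [BorelSpace E]
    (T : E →ₗ[ℝ] E) (hT : ∀ q, T (T q) = q) :
    MeasurePreserving T (volume : Measure E) volume := by
  have h2 : T ∘ₗ T = LinearMap.id := LinearMap.ext hT
  have h3 := congrArg LinearMap.det h2
  rw [LinearMap.det_comp, LinearMap.det_id] at h3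
  have h4 : |LinearMap.det T| = 1 := by
    have : |LinearMap.det T| * |LinearMap.det T| = 1 := by rw [← abs_mul, h3, abs_one]
    nlinarith [abs_nonneg (LinearMap.det T)]
  have h0 : LinearMap.det T ≠ 0 := by
    intro h
    rw [h] at h4
    norm_num at h4
  refine ⟨(LinearMap.continuous_of_finiteDimensional T).measurable, ?_⟩
  rw [Measure.map_linearMap_addHaar_eq_smul_addHaar volume h0, abs_inv, h4]
  simp

theorem exch23_exch23 (q : E6) : exch23 (exch23 q) = q := by
  apply WithLp.ofLp_injective
  ext1 <;> simp [exch23]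

theorem exch31Momentum_exch31Momentum (q : E6) : exch31Momentum (exch31Momentum q) = q := by
  apply WithLp.ofLp_injective
  ext1 <;> simp [exch31Momentum] <;> module

/-- The braid relation of the two transpositions. -/
theorem exch_braid (q : E6) : exch31Momentum (exch23 (exch31Momentum q)) =
    exch23 (exch31Momentum (exch23 q)) := by
  apply WithLp.ofLp_injective
  ext1 <;> simp [exch31Momentum, exch23] <;> module

theorem exch23_mp : MeasurePreserving exch23 (volume : Measure E6) volume :=
  LinearMap.measurePreserving_of_involutive _ exch23_exch23

theorem exch31Momentum_mp : MeasurePreserving exch31Momentum (volume : Measure E6) volume :=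
  LinearMap.measurePreserving_of_involutive _ exch31Momentum_exch31Momentum

theorem snd_exch23 (q : E6) : (exch23 q).snd = q.snd := rfl

theorem freeSymbol_exch23 (q : E6) : freeSymbol (exch23 q) = freeSymbol q := by
  simp [freeSymbol, exch23]

theorem freeSymbol_exch31Momentum (q : E6) : freeSymbol (exch31Momentum q) = freeSymbol q := by
  have e : freeSymbol (exch31Momentum q) = ‖(1 / 2 : ℝ) • q.fst + (3 / 4 : ℝ) • q.snd‖ ^ 2 +
    3 / 4 * ‖q.fst - (1 / 2 : ℝ) • q.snd‖ ^ 2 := rfl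
  rw [e, norm_add_sq_real, norm_sub_sq_real, freeSymbol]
  simp only [norm_smul, inner_smul_left, inner_smul_right, Real.norm_eq_abs, mul_pow, sq_abs]
  simp
  ring

theorem freeSymbol_nonneg (q : E6) : 0 ≤ freeSymbol q := by
  unfold freeSymbol
  positivity

theorem continuous_fst_E6 : Continuous fun q : E6 => q.fst :=
  continuous_fst.comp (WithLp.prod_continuous_ofLp 2 E3 E3)

theorem continuous_snd_E6 : Continuous fun q : E6 => q.snd :=
  continuous_snd.comp (WithLp.prod_continuous_ofLp 2 E3 E3)

theorem measurable_freeSymbol : Measurable freeSymbol := by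
  have h1 := continuous_fst_E6.measurable
  have h2 := continuous_snd_E6.measurable
  unfold freeSymbol
  fun_prop

/-- The coordinates `(p, k)` of `q = (k, p)`. -/
theorem snd_fst_mp : MeasurePreserving (fun q : E6 => (q.snd, q.fst)) (volume : Measure E6)
    (volume : Measure (E3 × E3)) :=
  (Measure.measurePreserving_swap (μ := (volume : Measure E3)) (ν := (volume : Measure E3))).comp
    (WithLp.volume_preserving_ofLp E3 E3)

/-- The coordinates `(p, k - p/2)` of `q = (k, p)`. -/
theorem snd_shear_mp : MeasurePreserving
    (fun q : E6 => (q.snd, q.fst - (1 / 2 : ℝ) • q.snd)) (volume : Measure E6)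
    (volume : Measure (E3 × E3)) := by
  have h : MeasurePreserving (fun z : E3 × E3 => (z.1, z.2 - (1 / 2 : ℝ) • z.1))
      ((volume : Measure E3).prod (volume : Measure E3))
      ((volume : Measure E3).prod (volume : Measure E3)) := by
    refine (MeasurePreserving.id volume).skew_product (g := fun a c : E3 => c - (1 / 2 : ℝ) • a)
      (by fun_prop) (ae_of_all _ fun a => ?_)
    exact (measurePreserving_sub_right volume ((1 / 2 : ℝ) • a)).map_eq
  exact h.comp snd_fst_mp

end ExchangeMaps

/-! ### Potentials: existence and dependence on the spectral parameter. -/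

section PotentialSpace

variable {lam : ℝ}

theorem freeSymbol_add_pos (hl : 0 < lam) (q : E6) : 0 < freeSymbol q + lam := by
  have := freeSymbol_nonneg q
  linarith

/-- The free symbol is invariant under the exchanges, so the three terms are transports of a single
function and only that one needs estimating. -/
theorem potentialHat_eq (lam : ℝ) (g : E3 → ℂ) (q : E6) : potentialHat lam g q =
    ((√(2 / Real.pi) : ℝ) : ℂ) * ((fun q : E6 => g q.snd / ((freeSymbol q + lam : ℝ) : ℂ)) q +
      (fun q : E6 => g q.snd / ((freeSymbol q + lam : ℝ) : ℂ)) (exch31Momentum q) +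
      (fun q : E6 => g q.snd / ((freeSymbol q + lam : ℝ) : ℂ)) (exch31Momentum (exch23 q))) := by
  simp only [freeSymbol_exch31Momentum, freeSymbol_exch23]
  have e1 : (exch31Momentum q).snd = q.fst - (1 / 2 : ℝ) • q.snd := rfl
  have e2 : (exch31Momentum (exch23 q)).snd = -q.fst - (1 / 2 : ℝ) • q.snd := rfl
  rw [potentialHat, e1, e2]
  push_cast
  ring

theorem memLp_potentialHat (hl : 0 < lam) {g : E3 → ℂ} (hg : MemLp g 2) :
    MemLp (potentialHat lam g) 2 := by
  have hm : AEStronglyMeasurable (fun q : E6 => g q.snd / ((freeSymbol q + lam : ℝ) : ℂ)) := by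
    simp_rw [div_eq_mul_inv]
    refine (hg.1.comp_quasiMeasurePreserving snd_qmp).mul ?_
    have := measurable_freeSymbol
    exact (by fun_prop : Measurable _).aestronglyMeasurable
  have h0 : MemLp (fun q : E6 => g q.snd / ((freeSymbol q + lam : ℝ) : ℂ)) 2 := by
    rw [memLp_two_iff_integrable_sq_norm hm]
    have hg2 : Integrable fun p => ‖g p‖ ^ 2 := hg.integrable_norm_pow (by norm_num)
    have h1 := hg2.mul_prod
      (radial_inv_sq_sq (Real.sqrt_pos.2 hl)).1
    have h2 := (snd_fst_mp.integrable_comp h1.1).2 h1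
    refine h2.mono' (hm.norm.pow 2) (ae_of_all _ fun q => ?_)
    have hq := freeSymbol_add_pos hl q
    simp only [Function.comp_apply, norm_div, Complex.norm_real, Real.norm_eq_abs]
    rw [abs_of_nonneg (by positivity), div_pow, sq_abs, Real.sq_sqrt hl.le, mul_one_div]
    gcongr
    unfold freeSymbol
    linarith [sq_nonneg ‖q.snd‖]
  have h1 := h0.comp_measurePreserving exch31Momentum_mp
  have h2 := h1.comp_measurePreserving exch23_mp
  refine (((h0.add h1).add h2).const_mul ((√(2 / Real.pi) : ℝ) : ℂ)).ae_eq (ae_of_all _ fun q => ?_)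
  rw [potentialHat_eq]
  rfl

theorem norm_sq_potentialHat (lam : ℝ) (g : E3 → ℂ) (q : E6) : ‖potentialHat lam g q‖ ^ 2 =
    2 / Real.pi / (freeSymbol q + lam) ^ 2 *
      ‖g q.snd + g (q.fst - (1 / 2 : ℝ) • q.snd) + g (-q.fst - (1 / 2 : ℝ) • q.snd)‖ ^ 2 := by
  rw [potentialHat, norm_mul, mul_pow, Complex.norm_real, Real.norm_eq_abs, sq_abs, div_pow,
    Real.sq_sqrt (by positivity)]

theorem exists_isPotential (hl : 0 < lam) (ξ : L2 E3) : ∃ u : L2 E6, IsPotential lam ξ u :=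
  exists_uFourier_eq (memLp_potentialHat hl (memLp_uFourier ξ))

theorem one_add_norm_sq_le (hl : 0 < lam) (q : E6) :
    1 + ‖q‖ ^ 2 ≤ (4 / 3 + 1 / lam) * (freeSymbol q + lam) := by
  rw [WithLp.prod_norm_sq_eq_of_L2, freeSymbol]
  have : 0 < 1 / lam := by positivity
  have e : (4 / 3 + 1 / lam) * (‖q.fst‖ ^ 2 + 3 / 4 * ‖q.snd‖ ^ 2 + lam) =
      4 / 3 * ‖q.fst‖ ^ 2 + ‖q.snd‖ ^ 2 + 4 / 3 * lam +
        1 / lam * (‖q.fst‖ ^ 2 + 3 / 4 * ‖q.snd‖ ^ 2) + 1 := by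
    field_simp
    ring
  rw [e]
  have := mul_nonneg this.le (by positivity : 0 ≤ ‖q.fst‖ ^ 2 + 3 / 4 * ‖q.snd‖ ^ 2)
  nlinarith [sq_nonneg ‖q.fst‖]

theorem freeSymbol_add_le (hl : 0 < lam) (q : E6) :
    freeSymbol q + lam ≤ (1 + lam) * (1 + ‖q‖ ^ 2) := by
  rw [WithLp.prod_norm_sq_eq_of_L2, freeSymbol]
  nlinarith [sq_nonneg ‖q.fst‖, sq_nonneg ‖q.snd‖, mul_nonneg hl.le (sq_nonneg ‖q.fst‖),
    mul_nonneg hl.le (sq_nonneg ‖q.snd‖)]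

theorem mem_sobolev_one_iff (hl : 0 < lam) (w : L2 E6) : w ∈ sobolev E6 1 ↔
    Integrable fun q => (freeSymbol q + lam) * ‖uFourier w q‖ ^ 2 := by
  have hm : AEStronglyMeasurable fun q => ‖uFourier w q‖ ^ 2 := (memLp_uFourier w).1.norm.pow 2
  have hfs := measurable_freeSymbol
  rw [mem_sobolev_iff (by norm_num)]
  simp only [Real.rpow_one]
  constructor
  · intro h
    refine (h.const_mul (1 + lam)).mono' ((by fun_prop : Measurable fun q =>
      freeSymbol q + lam).aestronglyMeasurable.mul hm) (ae_of_all _ fun q => ?_)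
    have := freeSymbol_add_pos hl q
    rw [Real.norm_eq_abs, abs_of_nonneg (by positivity), ← mul_assoc]
    gcongr
    exact freeSymbol_add_le hl q
  · intro h
    refine (h.const_mul (4 / 3 + 1 / lam)).mono' ((by fun_prop : Measurable fun q : E6 =>
      1 + ‖q‖ ^ 2).aestronglyMeasurable.mul hm) (ae_of_all _ fun q => ?_)
    rw [Real.norm_eq_abs, abs_of_nonneg (by positivity), ← mul_assoc]
    gcongr
    exact one_add_norm_sq_le hl q

theorem IsPotential.sub {ξ ξ' : L2 E3} {u u' : L2 E6} (h : IsPotential lam ξ u)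
    (h' : IsPotential lam ξ' u') : IsPotential lam (ξ - ξ') (u - u') := by
  have := h.add (h'.smul (-1 : ℂ))
  simpa [sub_eq_add_neg] using this

theorem IsDecomposition.sub {ψ ψ' w w' : L2 E6} {ξ ξ' : L2 E3} (h : IsDecomposition lam ψ w ξ)
    (h' : IsDecomposition lam ψ' w' ξ') :
    IsDecomposition lam (ψ - ψ') (w - w') (ξ - ξ') := by
  refine ⟨(sobolev E6 1).sub_mem h.1 h'.1, (sobolev E3 (1 / 2)).sub_mem h.2.1 h'.2.1, ?_⟩
  have := h.2.2.sub h'.2.2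
  rwa [sub_sub_sub_comm] at this

/-- By the resolvent identity the difference is (μ - λ)/(H₀ + μ) times the first potential. The
extra decay puts it in H¹, so λ can be changed without changing the charge. -/
theorem potentialHat_sub_bound {mu : ℝ} (hl : 0 < lam) (hm : 0 < mu) (g : E3 → ℂ) (q : E6) :
    (freeSymbol q + mu) * ‖potentialHat lam g q - potentialHat mu g q‖ ^ 2 ≤
      (mu - lam) ^ 2 / mu * ‖potentialHat lam g q‖ ^ 2 := by
  have h1 := freeSymbol_add_pos hl q
  have h2 := freeSymbol_add_pos hm q
  have e : potentialHat lam g q - potentialHat mu g q =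
      (((mu - lam) / (freeSymbol q + mu) : ℝ) : ℂ) * potentialHat lam g q := by
    simp only [potentialHat]
    rw [← mul_assoc, ← sub_mul]
    congr 1
    rw [← Complex.ofReal_sub, ← Complex.ofReal_mul]
    congr 1
    field_simp
    ring
  rw [e, norm_mul, mul_pow, Complex.norm_real, Real.norm_eq_abs, sq_abs, ← mul_assoc]
  gcongr
  rw [div_pow, mul_div_assoc', pow_two (freeSymbol q + mu), ← div_div, mul_div_cancel_left₀ _ h2.ne']
  gcongr
  linarith [freeSymbol_nonneg q]

theorem IsDecomposition.change {mu : ℝ} (hl : 0 < lam) (hm : 0 < mu) {ψ w : L2 E6} {ξ : L2 E3}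
    (h : IsDecomposition lam ψ w ξ) : ∃ w', IsDecomposition mu ψ w' ξ := by
  obtain ⟨hw, hξ, hp⟩ := h
  obtain ⟨u, hu⟩ := exists_isPotential hm ξ
  refine ⟨ψ - u, ?_, hξ, by rwa [sub_sub_cancel]⟩
  have e : ψ - u = w + ((ψ - w) - u) := by abel
  rw [e]
  refine (sobolev E6 1).add_mem hw ((mem_sobolev_one_iff hm _).2 ?_)
  have hfs := measurable_freeSymbol
  refine ((integrable_norm_sq_uFourier (ψ - w)).const_mul ((mu - lam) ^ 2 / mu)).mono'
    ((by fun_prop : Measurable fun q => freeSymbol q + mu).aestronglyMeasurable.mul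
      ((memLp_uFourier _).1.norm.pow 2)) ?_
  filter_upwards [hp, hu, uFourier_sub (ψ - w) u] with q h1 h2 h3
  have := freeSymbol_add_pos hm q
  rw [Real.norm_eq_abs, abs_of_nonneg (by positivity), h3, h1, h2]
  exact potentialHat_sub_bound hl hm _ q

end PotentialSpace

/-! ### Uniqueness of the decomposition. -/

section Uniqueness

variable {lam : ℝ}

theorem not_integrable_inv_sq_add {c : ℝ} (hc : 0 < c) :
    ¬ Integrable fun x : E3 => 1 / (‖x‖ ^ 2 + c ^ 2) := by
  intro h
  have h1 := (integrable_radial_E3_iff fun y => 1 / (y ^ 2 + c ^ 2)).1 h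
  have h2 : IntegrableOn (fun _ : ℝ => (1 / 2 : ℝ)) (Set.Ioi c) := by
    refine Integrable.mono' (h1.mono_set (Set.Ioi_subset_Ioi hc.le)) (by fun_prop) ?_
    filter_upwards [ae_restrict_mem measurableSet_Ioi] with y hy
    have hy : c < y := hy
    rw [Real.norm_eq_abs, abs_of_nonneg (by norm_num), mul_one_div, div_le_div_iff₀ (by norm_num)
      (by positivity)]
    nlinarith
  rw [integrableOn_const_iff] at h2
  simp at h2

theorem norm_sq_sub_sub_le (a b c : ℂ) : ‖a - b - c‖ ^ 2 ≤ 3 * (‖a‖ ^ 2 + ‖b‖ ^ 2 + ‖c‖ ^ 2) := by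
  have h1 : ‖a - b - c‖ ≤ ‖a‖ + ‖b‖ + ‖c‖ :=
    (norm_sub_le _ _).trans (add_le_add_left (norm_sub_le _ _) _)
  have h2 : ‖a - b - c‖ ^ 2 ≤ (‖a‖ + ‖b‖ + ‖c‖) ^ 2 := by gcongr
  nlinarith [sq_nonneg (‖a‖ - ‖b‖), sq_nonneg (‖a‖ - ‖c‖), sq_nonneg (‖b‖ - ‖c‖)]

/-- A charge density whose potential is in `H¹` vanishes. -/
theorem IsPotential.eq_zero (hl : 0 < lam) {ζ : L2 E3} {u : L2 E6} (h : IsPotential lam ζ u)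
    (hu : u ∈ sobolev E6 1) : ζ = 0 := by
  set f := uFourier ζ with hf
  have hfm : AEStronglyMeasurable f := (memLp_uFourier ζ).1
  have hf2 := integrable_norm_sq_uFourier ζ
  rw [mem_sobolev_one_iff hl] at hu
  have hfs := measurable_freeSymbol
  have hsndm := continuous_snd_E6.measurable
  -- For p in a ball the two shifted terms are square integrable in (k, p), since a shear separates
  -- the variables. If the potential is in H¹, then |f(p)|²/(k² + (3/4)p² + λ) is integrable there
  -- too, and divergence of the k-integral forces f(p) = 0.
  have key : ∀ R : ℕ, ∀ᵐ p : E3, ‖p‖ < R → f p = 0 := by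
    intro R
    set χ : E3 → ℝ := (Metric.ball (0 : E3) R).indicator 1 with hχ
    have hχm : Measurable χ := measurable_const.indicator measurableSet_ball
    have hχ0 : ∀ p, 0 ≤ χ p := fun p => Set.indicator_nonneg (by simp) p
    have hχ1 : ∀ p, χ p ≤ 1 := fun p => Set.indicator_le_self' (by simp) p
    have hχi : Integrable χ := by
      rw [hχ, integrable_indicator_iff measurableSet_ball]
      exact integrableOn_const measure_ball_lt_top.ne
    have hterm : Integrable fun q : E6 =>
        χ q.snd * ‖f (q.fst - (1 / 2 : ℝ) • q.snd)‖ ^ 2 := by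
      have h1 := hχi.mul_prod hf2
      exact (snd_shear_mp.integrable_comp h1.1).2 h1
    have hterm' : Integrable fun q : E6 =>
        χ q.snd * ‖f (-q.fst - (1 / 2 : ℝ) • q.snd)‖ ^ 2 :=
      (exch23_mp.integrable_comp hterm.1).2 hterm
    have hg : Integrable fun q : E6 => χ q.snd * ‖f q.snd‖ ^ 2 / (freeSymbol q + lam) := by
      have hdom := ((hu.const_mul (Real.pi / 2)).add ((hterm.add hterm').const_mul (1 / lam))).const_mul 3
      refine hdom.mono' ?_ ?_
      · exact (((hχm.comp hsndm).aestronglyMeasurable.mul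
          ((hfm.comp_quasiMeasurePreserving snd_qmp).norm.pow 2)).mul
          (by fun_prop : Measurable fun q => (freeSymbol q + lam)⁻¹).aestronglyMeasurable)
      · filter_upwards [h] with q hq
        have hpos := freeSymbol_add_pos hl q
        simp only [Pi.add_apply]
        rw [hq, norm_sq_potentialHat]
        set a := f q.snd
        set b := f (q.fst - (1 / 2 : ℝ) • q.snd)
        set c := f (-q.fst - (1 / 2 : ℝ) • q.snd)
        have h3 : ‖a‖ ^ 2 ≤ 3 * (‖a + b + c‖ ^ 2 + ‖b‖ ^ 2 + ‖c‖ ^ 2) := by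
          have := norm_sq_sub_sub_le (a + b + c) b c
          rwa [show a + b + c - b - c = a by ring] at this
        have hpi := Real.pi_pos
        have e1 : Real.pi / 2 * ((freeSymbol q + lam) * (2 / Real.pi / (freeSymbol q + lam) ^ 2 *
            ‖a + b + c‖ ^ 2)) = ‖a + b + c‖ ^ 2 / (freeSymbol q + lam) := by
          field_simp
        rw [e1, Real.norm_eq_abs, abs_of_nonneg (by have := hχ0 q.snd; positivity)]
        have hx0 := hχ0 q.snd
        have hx1 := hχ1 q.snd
        have hinv : 1 / (freeSymbol q + lam) ≤ 1 / lam :=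
          one_div_le_one_div_of_le hl (by linarith [freeSymbol_nonneg q])
        calc χ q.snd * ‖a‖ ^ 2 / (freeSymbol q + lam)
            ≤ χ q.snd * (3 * (‖a + b + c‖ ^ 2 + ‖b‖ ^ 2 + ‖c‖ ^ 2)) / (freeSymbol q + lam) := by gcongr
          _ = 3 * (χ q.snd * (‖a + b + c‖ ^ 2 / (freeSymbol q + lam)) + 1 / (freeSymbol q + lam) *
              (χ q.snd * ‖b‖ ^ 2 + χ q.snd * ‖c‖ ^ 2)) := by ring
          _ ≤ 3 * (1 * (‖a + b + c‖ ^ 2 / (freeSymbol q + lam)) + 1 / lam *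
              (χ q.snd * ‖b‖ ^ 2 + χ q.snd * ‖c‖ ^ 2)) := by gcongr
          _ = _ := by rw [one_mul]
    have hprod : Integrable (fun z : E3 × E3 => χ z.1 * ‖f z.1‖ ^ 2 /
        (‖z.2‖ ^ 2 + 3 / 4 * ‖z.1‖ ^ 2 + lam)) := by
      refine (snd_fst_mp.integrable_comp ?_).1 hg
      exact (((hχm.comp measurable_fst).aestronglyMeasurable.mul (hfm.comp_fst.norm.pow 2)).mul
          (by fun_prop : Measurable fun z : E3 × E3 =>
            (‖z.2‖ ^ 2 + 3 / 4 * ‖z.1‖ ^ 2 + lam)⁻¹).aestronglyMeasurable)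
    filter_upwards [hprod.prod_right_ae] with p hp hpR
    by_contra hne
    have hχp : χ p = 1 := by
      rw [hχ, Set.indicator_of_mem (by simpa using hpR)]
      rfl
    have hc : 0 < 3 / 4 * ‖p‖ ^ 2 + lam := by positivity
    refine not_integrable_inv_sq_add (Real.sqrt_pos.2 hc) ?_
    have hnorm := norm_pos_iff.2 hne
    refine (hp.const_mul (‖f p‖ ^ 2)⁻¹).congr (ae_of_all _ fun k => ?_)
    simp only
    rw [hχp, Real.sq_sqrt hc.le, one_mul, ← add_assoc]
    field_simp
  have hz : f =ᵐ[volume] uFourier (0 : L2 E3) := by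
    have e3 := uFourier_smul (0 : ℂ) (0 : L2 E3)
    rw [zero_smul] at e3
    filter_upwards [ae_all_iff.2 key, e3] with p hp h0
    obtain ⟨R, hR⟩ := exists_nat_gt ‖p‖
    rw [hp R hR, h0, zero_mul]
  exact uFourier_injective hz

theorem IsPotential.eq_zero_of_zero {u : L2 E6} (h : IsPotential lam 0 u) : u = 0 :=
  uFourier_injective (h.trans (IsPotential.zero lam).symm)

theorem IsDecomposition.unique (hl : 0 < lam) {ψ w w' : L2 E6} {ξ ξ' : L2 E3}
    (h : IsDecomposition lam ψ w ξ) (h' : IsDecomposition lam ψ w' ξ') : w = w' ∧ ξ = ξ' := by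
  obtain ⟨hw, -, hp⟩ := h.sub h'
  rw [sub_self, zero_sub] at hp
  have hξ := hp.eq_zero hl ((sobolev E6 1).neg_mem hw)
  rw [hξ] at hp
  exact ⟨sub_eq_zero.1 (neg_eq_zero.1 hp.eq_zero_of_zero), sub_eq_zero.1 hξ⟩

theorem energyForm_eq (β γ : ℝ) (θ : ℝ → ℝ) (hl : 0 < lam) {ψ : L2sym} {w : L2 E6} {ξ : L2 E3}
    (h : IsDecomposition lam ψ w ξ) :
    energyForm β γ θ lam ψ = energyExpr β γ θ lam ψ w ξ := by
  have hex : ∃ d : L2 E6 × L2 E3, IsDecomposition lam ψ d.1 d.2 := ⟨(w, ξ), h⟩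
  rw [energyForm, dif_pos hex]
  obtain ⟨h1, h2⟩ := hex.choose_spec.unique hl h
  rw [h1, h2]

end Uniqueness

/-! ### Independence of the spectral parameter. -/

section ResolventIdentity

variable {lam mu : ℝ} {ξ : L2 E3}

/-- Decrease of the free resolvent between two spectral parameters. -/
noncomputable def resolventGap (lam mu : ℝ) (q : E6) : ℝ :=
  1 / (freeSymbol q + lam) - 1 / (freeSymbol q + mu)

theorem resolventGap_diag (hl : 0 < lam) (hlm : lam ≤ mu) (hξ : ξ ∈ sobolev E3 (1 / 2)) :
    Integrable (fun q : E6 => resolventGap lam mu q * ‖uFourier ξ q.snd‖ ^ 2) ∧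
    ∫ q : E6, resolventGap lam mu q * ‖uFourier ξ q.snd‖ ^ 2 =
      2 * Real.pi ^ 2 * ((∫ p : E3, √(3 / 4 * ‖p‖ ^ 2 + mu) * ‖uFourier ξ p‖ ^ 2) -
        ∫ p : E3, √(3 / 4 * ‖p‖ ^ 2 + lam) * ‖uFourier ξ p‖ ^ 2) := by
  have hm : 0 < mu := hl.trans_le hlm
  have hfm := (memLp_uFourier ξ).1
  set A : E3 → ℝ := fun p => √(3 / 4 * ‖p‖ ^ 2 + lam) with hA
  set B : E3 → ℝ := fun p => √(3 / 4 * ‖p‖ ^ 2 + mu) with hB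
  have hA0 : ∀ p, 0 < A p := fun p => Real.sqrt_pos.2 (by positivity)
  have hAB : ∀ p, A p ≤ B p := fun p => Real.sqrt_le_sqrt (by linarith)
  have hA2 : ∀ p, A p ^ 2 = 3 / 4 * ‖p‖ ^ 2 + lam := fun p => Real.sq_sqrt (by positivity)
  have hB2 : ∀ p, B p ^ 2 = 3 / 4 * ‖p‖ ^ 2 + mu := fun p => Real.sq_sqrt (by positivity)
  have hAm : Measurable A := by fun_prop
  have hBm : Measurable B := by fun_prop
  set G : E3 × E3 → ℝ := fun z => (1 / (‖z.2‖ ^ 2 + A z.1 ^ 2) - 1 / (‖z.2‖ ^ 2 + B z.1 ^ 2)) *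
    ‖uFourier ξ z.1‖ ^ 2 with hG
  have hGm : AEStronglyMeasurable G :=
    (by fun_prop : Measurable fun z : E3 × E3 => (1 / (‖z.2‖ ^ 2 + A z.1 ^ 2) -
      1 / (‖z.2‖ ^ 2 + B z.1 ^ 2))).aestronglyMeasurable.mul (hfm.comp_fst.norm.pow 2)
  have hG0 : ∀ z, 0 ≤ G z := by
    intro z
    refine mul_nonneg (sub_nonneg.2 ?_) (by positivity)
    have h1 := hA0 z.1
    have h2 := hAB z.1
    exact one_div_le_one_div_of_le (by positivity) (by gcongr)
  have hGk : ∀ p, ∫ k, G (p, k) = 2 * Real.pi ^ 2 * (B p * ‖uFourier ξ p‖ ^ 2 -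
      A p * ‖uFourier ξ p‖ ^ 2) := by
    intro p
    simp only [hG]
    rw [integral_mul_const, (radial_resolvent_sub (hA0 p) (hAB p)).2]
    ring
  have hiA := (integrable_diag hξ hl.le).1
  have hiB := (integrable_diag hξ hm.le).1
  have hGi : Integrable G := by
    refine (integrable_prod_iff hGm).2 ⟨ae_of_all _ fun p =>
      (radial_resolvent_sub (hA0 p) (hAB p)).1.mul_const (‖uFourier ξ p‖ ^ 2), ?_⟩
    simp_rw [Real.norm_of_nonneg (hG0 _), hGk]
    exact (hiB.sub hiA).const_mul _
  have e : ∀ q : E6, resolventGap lam mu q * ‖uFourier ξ q.snd‖ ^ 2 = G (q.snd, q.fst) := by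
    intro q
    simp only [hG, hA2, hB2, resolventGap, freeSymbol, add_assoc]
  simp_rw [e]
  refine ⟨(snd_fst_mp.integrable_comp hGm).2 hGi, ?_⟩
  rw [integral_comp_of_measurePreserving snd_fst_mp hGm, Measure.volume_eq_prod,
    integral_prod _ hGi]
  simp_rw [hGk]
  rw [integral_const_mul, integral_sub hiB hiA]

/-- With p' = k - p/2 the free symbol becomes p² + p'² + p·p', which is how the off-diagonal kernel
arises. -/
theorem resolventGap_cross (hl : 0 < lam) (hm : 0 < mu) (hξ : ξ ∈ sobolev E3 (1 / 2)) :
    Integrable (fun q : E6 => resolventGap lam mu q *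
      (starRingEnd ℂ (uFourier ξ q.snd) * uFourier ξ (exch31Momentum q).snd).re) ∧
    ∫ q : E6, resolventGap lam mu q *
      (starRingEnd ℂ (uFourier ξ q.snd) * uFourier ξ (exch31Momentum q).snd).re =
      (kernelForm (uFourier ξ) fun z => 1 / (‖z.1‖ ^ 2 + ‖z.2‖ ^ 2 + inner ℝ z.1 z.2 + lam)) -
      kernelForm (uFourier ξ) fun z => 1 / (‖z.1‖ ^ 2 + ‖z.2‖ ^ 2 + inner ℝ z.1 z.2 + mu) := by
  have hfm := (memLp_uFourier ξ).1
  have hN := (integrable_norm_mul_of_mem_sobolev_half hξ).1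
  have h1 := kernelConverges_stm hfm hN hl.le
  have h2 := kernelConverges_stm hfm hN hm.le
  have hi := (h1.sub h2).integrable hfm
  have e : ∀ q : E6, resolventGap lam mu q *
      (starRingEnd ℂ (uFourier ξ q.snd) * uFourier ξ (exch31Momentum q).snd).re =
      (fun z : E3 × E3 => (1 / (‖z.1‖ ^ 2 + ‖z.2‖ ^ 2 + inner ℝ z.1 z.2 + lam) -
        1 / (‖z.1‖ ^ 2 + ‖z.2‖ ^ 2 + inner ℝ z.1 z.2 + mu)) *
        (starRingEnd ℂ (uFourier ξ z.1) * uFourier ξ z.2).re)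
        (q.snd, q.fst - (1 / 2 : ℝ) • q.snd) := by
    intro q
    have e1 : (exch31Momentum q).snd = q.fst - (1 / 2 : ℝ) • q.snd := rfl
    have e2 : freeSymbol q = ‖q.snd‖ ^ 2 + ‖q.fst - (1 / 2 : ℝ) • q.snd‖ ^ 2 +
        inner ℝ q.snd (q.fst - (1 / 2 : ℝ) • q.snd) := by
      rw [norm_sub_sq_real, inner_sub_right, inner_smul_right, inner_smul_right,
        real_inner_self_eq_norm_sq, norm_smul, mul_pow, real_inner_comm, freeSymbol]
      norm_num
      ring
    simp only [resolventGap, e1, e2]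
  simp_rw [e]
  refine ⟨(snd_shear_mp.integrable_comp hi.1).2 hi, ?_⟩
  rw [integral_comp_of_measurePreserving snd_shear_mp hi.1, ← kernelForm_sub hfm h1 h2]
  rfl

theorem norm_sq_add_add (a b c : ℂ) : ‖a + b + c‖ ^ 2 = ‖a‖ ^ 2 + ‖b‖ ^ 2 + ‖c‖ ^ 2 +
    2 * ((starRingEnd ℂ a * b).re + (starRingEnd ℂ a * c).re + (starRingEnd ℂ b * c).re) := by
  simp only [Complex.sq_norm, Complex.normSq_apply, Complex.add_re, Complex.add_im, Complex.mul_re,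
    Complex.conj_re, Complex.conj_im]
  ring

/-- The three diagonal terms have equal integrals by exchange invariance, and so do the three cross
terms. Identifying the cross term of the two shifted copies uses the braid relation. -/
theorem integral_resolventGap_mul_sum (hl : 0 < lam) (hlm : lam ≤ mu)
    (hξ : ξ ∈ sobolev E3 (1 / 2)) :
    ∫ q : E6, resolventGap lam mu q * ‖uFourier ξ q.snd + uFourier ξ (q.fst - (1 / 2 : ℝ) • q.snd) +
      uFourier ξ (-q.fst - (1 / 2 : ℝ) • q.snd)‖ ^ 2 =
    6 * Real.pi ^ 2 * ((∫ p : E3, √(3 / 4 * ‖p‖ ^ 2 + mu) * ‖uFourier ξ p‖ ^ 2) -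
        ∫ p : E3, √(3 / 4 * ‖p‖ ^ 2 + lam) * ‖uFourier ξ p‖ ^ 2) +
    6 * ((kernelForm (uFourier ξ) fun z => 1 / (‖z.1‖ ^ 2 + ‖z.2‖ ^ 2 + inner ℝ z.1 z.2 + lam)) -
      kernelForm (uFourier ξ) fun z => 1 / (‖z.1‖ ^ 2 + ‖z.2‖ ^ 2 + inner ℝ z.1 z.2 + mu)) := by
  obtain ⟨hd, hd'⟩ := resolventGap_diag hl hlm hξ
  obtain ⟨hc, hc'⟩ := resolventGap_cross hl (hl.trans_le hlm) hξ
  have hgap : ∀ q, resolventGap lam mu (exch31Momentum q) = resolventGap lam mu q := fun q => by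
    simp only [resolventGap, freeSymbol_exch31Momentum]
  have hgap' : ∀ q, resolventGap lam mu (exch23 q) = resolventGap lam mu q := fun q => by
    simp only [resolventGap, freeSymbol_exch23]
  set G : E6 → ℝ := fun q => resolventGap lam mu q * ‖uFourier ξ q.snd‖ ^ 2 with hG
  set J : E6 → ℝ := fun q => resolventGap lam mu q *
      (starRingEnd ℂ (uFourier ξ q.snd) * uFourier ξ (exch31Momentum q).snd).re with hJ
  have hTR := exch31Momentum_mp.comp exch23_mp
  have hRT := exch23_mp.comp exch31Momentum_mp
  have i1 : Integrable fun q => G (exch31Momentum q) :=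
    (exch31Momentum_mp.integrable_comp hd.1).2 hd
  have i2 : Integrable fun q => G ((exch31Momentum ∘ exch23) q) :=
    (hTR.integrable_comp hd.1).2 hd
  have i3 : Integrable fun q => J (exch23 q) := (exch23_mp.integrable_comp hc.1).2 hc
  have i4 : Integrable fun q => J ((exch23 ∘ exch31Momentum) q) :=
    (hRT.integrable_comp hc.1).2 hc
  have j1 : Integrable fun q => G q + G (exch31Momentum q) := hd.add i1
  have j2 : Integrable fun q => G q + G (exch31Momentum q) + G ((exch31Momentum ∘ exch23) q) :=
    j1.add i2
  have j3 : Integrable fun q => J q + J (exch23 q) := hc.add i3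
  have j4 : Integrable fun q => J q + J (exch23 q) + J ((exch23 ∘ exch31Momentum) q) := j3.add i4
  have e1 := integral_comp_of_measurePreserving exch31Momentum_mp hd.1
  have e2 := integral_comp_of_measurePreserving hTR hd.1
  have e3 := integral_comp_of_measurePreserving exch23_mp hc.1
  have e4 := integral_comp_of_measurePreserving hRT hc.1
  have e : ∀ q : E6, resolventGap lam mu q * ‖uFourier ξ q.snd +
      uFourier ξ (q.fst - (1 / 2 : ℝ) • q.snd) + uFourier ξ (-q.fst - (1 / 2 : ℝ) • q.snd)‖ ^ 2 =
      (G q + G (exch31Momentum q) + G ((exch31Momentum ∘ exch23) q)) +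
        2 * (J q + J (exch23 q) + J ((exch23 ∘ exch31Momentum) q)) := by
    intro q
    have s1 : (exch31Momentum q).snd = q.fst - (1 / 2 : ℝ) • q.snd := rfl
    have s2 : (exch31Momentum (exch23 q)).snd = -q.fst - (1 / 2 : ℝ) • q.snd := rfl
    have s3 : (exch31Momentum (exch23 (exch31Momentum q))).snd = -q.fst - (1 / 2 : ℝ) • q.snd := by
      rw [exch_braid, snd_exch23, s2]
    simp only [hG, hJ, Function.comp_apply, hgap, hgap', snd_exch23, s1, s2, s3]
    rw [norm_sq_add_add]
    ring
  simp_rw [e]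
  rw [integral_add j2 (j4.const_mul 2), integral_const_mul, integral_add j1 i2,
    integral_add hd i1, integral_add j3 i4, integral_add hc i3, e1, e2, e3, e4, hd', hc']
  ring

/-- Expanding each bracket gives h|x|² - 2s Re(x̄S) + s²|S|²/(h + λ), or the same with μ. Only the
last term depends on the parameter. -/
theorem resolvent_pointwise {h lam mu s : ℝ} (x S : ℂ) (h1 : h + lam ≠ 0) (h2 : h + mu ≠ 0) :
    ((h + lam) * ‖x - ((s / (h + lam) : ℝ) : ℂ) * S‖ ^ 2 - lam * ‖x‖ ^ 2) -
      ((h + mu) * ‖x - ((s / (h + mu) : ℝ) : ℂ) * S‖ ^ 2 - mu * ‖x‖ ^ 2) =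
      s ^ 2 * ((1 / (h + lam) - 1 / (h + mu)) * ‖S‖ ^ 2) := by
  simp only [Complex.sq_norm, Complex.normSq_apply, Complex.sub_re, Complex.sub_im,
    Complex.re_ofReal_mul, Complex.im_ofReal_mul]
  field_simp
  ring

/-- The energy as a real number. -/
noncomputable def realEnergy (β γ : ℝ) (θ : ℝ → ℝ) (lam : ℝ) (ψ w : L2 E6) (ξ : L2 E3) : ℝ :=
  freeForm lam w - lam * ‖ψ‖ ^ 2 + 12 * Real.pi * realChargeForm β γ θ lam ξ

theorem energyExpr_eq (β γ : ℝ) (θ : ℝ → ℝ) (hl : 0 < lam) {ψ w : L2 E6}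
    (hξ : ξ ∈ sobolev E3 (1 / 2)) :
    energyExpr β γ θ lam ψ w ξ = ((realEnergy β γ θ lam ψ w ξ : ℝ) : ℂ) := by
  rw [energyExpr, chargeForm_eq β γ θ hξ hl.le, realEnergy]
  push_cast
  ring

theorem realEnergy_eq_of_le (β γ : ℝ) (θ : ℝ → ℝ) (hl : 0 < lam) (hlm : lam ≤ mu)
    {ψ w w' : L2 E6} (h : IsDecomposition lam ψ w ξ) (h' : IsDecomposition mu ψ w' ξ) :
    realEnergy β γ θ lam ψ w ξ = realEnergy β γ θ mu ψ w' ξ := by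
  have hm : 0 < mu := hl.trans_le hlm
  obtain ⟨hw, hξ, hp⟩ := h
  obtain ⟨hw', -, hp'⟩ := h'
  have iw := (mem_sobolev_one_iff hl w).1 hw
  have iw' := (mem_sobolev_one_iff hm w').1 hw'
  have iψ := integrable_norm_sq_uFourier ψ
  have hint := integral_resolventGap_mul_sum hl hlm hξ
  have jw : Integrable fun q => (freeSymbol q + lam) * ‖uFourier w q‖ ^ 2 -
    lam * ‖uFourier ψ q‖ ^ 2 := iw.sub (iψ.const_mul lam)
  have jw' : Integrable fun q => (freeSymbol q + mu) * ‖uFourier w' q‖ ^ 2 -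
    mu * ‖uFourier ψ q‖ ^ 2 := iw'.sub (iψ.const_mul mu)
  have hfree : (freeForm lam w - lam * ‖ψ‖ ^ 2) - (freeForm mu w' - mu * ‖ψ‖ ^ 2) =
      2 / Real.pi * ∫ q : E6, resolventGap lam mu q * ‖uFourier ξ q.snd +
        uFourier ξ (q.fst - (1 / 2 : ℝ) • q.snd) + uFourier ξ (-q.fst - (1 / 2 : ℝ) • q.snd)‖ ^ 2 := by
    rw [freeForm, freeForm, ← integral_norm_sq_uFourier, ← integral_const_mul, ← integral_const_mul,
      ← integral_const_mul, ← integral_sub iw (iψ.const_mul lam),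
      ← integral_sub iw' (iψ.const_mul mu),
      ← integral_sub jw jw']
    refine integral_congr_ae ?_
    filter_upwards [hp, hp', uFourier_sub ψ w, uFourier_sub ψ w'] with q h1 h2 h3 h4
    have e1 : uFourier w q = uFourier ψ q - potentialHat lam (uFourier ξ) q := by
      rw [← h1, h3]
      ring
    have e2 : uFourier w' q = uFourier ψ q - potentialHat mu (uFourier ξ) q := by
      rw [← h2, h4]
      ring
    rw [e1, e2, potentialHat, potentialHat, resolvent_pointwise _ _ (freeSymbol_add_pos hl q).ne'
      (freeSymbol_add_pos hm q).ne', Real.sq_sqrt (by positivity)]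
    rfl
  rw [hint] at hfree
  have hpi := Real.pi_pos
  rw [realEnergy, realEnergy, realChargeForm, realChargeForm]
  have e : ∀ a b : ℝ, 2 / Real.pi * (6 * Real.pi ^ 2 * a + 6 * b) =
      12 * Real.pi * (a + 1 / Real.pi ^ 2 * b) := by
    intro a b
    field_simp
    ring
  rw [e] at hfree
  linarith

theorem realEnergy_eq (β γ : ℝ) (θ : ℝ → ℝ) (hl : 0 < lam) (hm : 0 < mu)
    {ψ w w' : L2 E6} (h : IsDecomposition lam ψ w ξ) (h' : IsDecomposition mu ψ w' ξ) :
    realEnergy β γ θ lam ψ w ξ = realEnergy β γ θ mu ψ w' ξ := by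
  rcases le_total lam mu with hle | hle
  · exact realEnergy_eq_of_le β γ θ hl hle h h'
  · exact (realEnergy_eq_of_le β γ θ hm hle h' h).symm

theorem energyDomain_eq (hl : 0 < lam) (hm : 0 < mu) : energyDomain lam = energyDomain mu := by
  ext ψ
  constructor
  · rintro ⟨d, hd⟩
    obtain ⟨w', hw'⟩ := hd.change hl hm
    exact ⟨(w', d.2), hw'⟩
  · rintro ⟨d, hd⟩
    obtain ⟨w', hw'⟩ := hd.change hm hl
    exact ⟨(w', d.2), hw'⟩

theorem energyForm_of_notMem (β γ : ℝ) (θ : ℝ → ℝ) {ψ : L2sym} (h : ψ ∉ energyDomain lam) :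
    energyForm β γ θ lam ψ = 0 := by
  have h' : ¬ ∃ d : L2 E6 × L2 E3, IsDecomposition lam ψ d.1 d.2 := h
  rw [energyForm, dif_neg h']

theorem energyForm_eq_energyForm (β γ : ℝ) (θ : ℝ → ℝ) (hl : 0 < lam) (hm : 0 < mu) :
    energyForm β γ θ lam = energyForm β γ θ mu := by
  funext ψ
  by_cases h : ψ ∈ energyDomain lam
  · obtain ⟨⟨w, ξ⟩, hd⟩ := h
    obtain ⟨w', hd'⟩ := hd.change hl hm
    rw [energyForm_eq β γ θ hl hd, energyForm_eq β γ θ hm hd', energyExpr_eq β γ θ hl hd.2.1,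
      energyExpr_eq β γ θ hm hd.2.1, realEnergy_eq β γ θ hl hm hd hd']
  · have h' : ψ ∉ energyDomain mu := by rwa [← energyDomain_eq hl hm]
    rw [energyForm_of_notMem β γ θ h, energyForm_of_notMem β γ θ h']

end ResolventIdentity

/-! ### The energy form: lower bound and closedness. -/

section EnergyForm

variable {lam : ℝ}

theorem freeForm_nonneg (hl : 0 < lam) (w : L2 E6) : 0 ≤ freeForm lam w :=
  integral_nonneg fun q => mul_nonneg (freeSymbol_add_pos hl q).le (by positivity)

theorem mul_norm_sq_le_freeForm (hl : 0 < lam) {w : L2 E6} (hw : w ∈ sobolev E6 1) :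
    lam * ‖w‖ ^ 2 ≤ freeForm lam w := by
  rw [← integral_norm_sq_uFourier, ← integral_const_mul, freeForm]
  refine integral_mono ((integrable_norm_sq_uFourier w).const_mul lam)
    ((mem_sobolev_one_iff hl w).1 hw) fun q => ?_
  simp only
  gcongr
  linarith [freeSymbol_nonneg q]

theorem exists_tendsto_of_norm_sq {V : Type*} [NormedAddCommGroup V] [CompleteSpace V] {u : ℕ → V}
    (h : Tendsto (fun nm : ℕ × ℕ => ‖u nm.1 - u nm.2‖ ^ 2) atTop (𝓝 0)) :
    ∃ v, Tendsto u atTop (𝓝 v) := by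
  refine cauchySeq_tendsto_of_complete (cauchySeq_iff_tendsto_dist_atTop_0.2 ?_)
  have h1 := (Real.continuous_sqrt.tendsto 0).comp h
  rw [Real.sqrt_zero] at h1
  refine h1.congr fun nm => ?_
  simp [Real.sqrt_sq, dist_eq_norm]

theorem IsPotential.of_tendsto {ξ : ℕ → L2 E3} {u : ℕ → L2 E6} {ξ₀ : L2 E3} {u₀ : L2 E6}
    (h : ∀ n, IsPotential lam (ξ n) (u n)) (hξ : Tendsto ξ atTop (𝓝 ξ₀))
    (hu : Tendsto u atTop (𝓝 u₀)) : IsPotential lam ξ₀ u₀ := by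
  obtain ⟨φ, hφ, h1⟩ := exists_seq_tendsto_uFourier hξ
  obtain ⟨φ', hφ', h2⟩ := exists_seq_tendsto_uFourier (hu.comp hφ.tendsto_atTop)
  have h3 : ∀ᵐ q, ∀ n, uFourier (u n) q = potentialHat lam (uFourier (ξ n)) q := ae_all_iff.2 h
  filter_upwards [ae_potential_args h1, h2, h3] with q hq1 hq2 hq3
  refine tendsto_nhds_unique hq2 ?_
  simp only [Function.comp_apply, hq3, potentialHat]
  exact (((hq1.1.add hq1.2.1).add hq1.2.2).comp hφ'.tendsto_atTop).const_mul _

theorem energyForm_isBoundedBelowBy (β γ : ℝ) (θ : ℝ → ℝ) (hl : 0 < lam)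
    (hΦ : ∀ ξ ∈ sobolev E3 (1 / 2), 0 ≤ realChargeForm β γ θ lam ξ) :
    IsBoundedBelowBy (energyDomain lam) (energyForm β γ θ lam) (-lam) := by
  rintro ψ ⟨⟨w, ξ⟩, hd⟩
  rw [energyForm_eq β γ θ hl hd, energyExpr_eq β γ θ hl hd.2.1]
  refine ⟨Complex.ofReal_im _, ?_⟩
  have h1 := freeForm_nonneg hl w
  have h2 := mul_nonneg (by positivity : 0 ≤ 12 * Real.pi) (hΦ ξ hd.2.1)
  rw [Complex.ofReal_re, realEnergy, Submodule.coe_norm]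
  linarith

theorem tendsto_ofReal_combination (b c : ℝ) {x y z : ℕ → ℝ} (hx : Tendsto x atTop (𝓝 0))
    (hy : Tendsto y atTop (𝓝 0)) (hz : Tendsto z atTop (𝓝 0)) :
    Tendsto (fun n => ((x n - b * y n + c * z n : ℝ) : ℂ)) atTop (𝓝 0) := by
  have h := (hx.sub (hy.const_mul b)).add (hz.const_mul c)
  rw [mul_zero, mul_zero, sub_zero, add_zero] at h
  exact (Complex.continuous_ofReal.tendsto 0).comp h

-- At a coercive λ, a form-Cauchy sequence has w and ξ Cauchy in H¹ and H^{1/2}. Their limits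
-- decompose v, because the defining relation of the potential passes to almost everywhere limits
-- along a subsequence.
set_option maxHeartbeats 1000000 in
theorem energyForm_isClosed {θ : ℝ → ℝ} (hθ : CutoffH1 θ) (β γ : ℝ) {c₀ : ℝ} (hl : 0 < lam)
    (hc₀ : 0 < c₀)
    (hc : ∀ ξ ∈ sobolev E3 (1 / 2), c₀ * sobolevNormSq (1 / 2) ξ ≤ realChargeForm β γ θ lam ξ) :
    IsClosedForm (energyDomain lam) (energyForm β γ θ lam) := by
  intro u v hu huv hq
  choose d hd using hu
  set w : ℕ → L2 E6 := fun n => (d n).1 with hw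
  set ξ : ℕ → L2 E3 := fun n => (d n).2 with hξ
  have hdec : ∀ n, IsDecomposition lam (u n) (w n) (ξ n) := hd
  have hpi := Real.pi_pos
  have huv' : Tendsto (fun n => (u n : L2 E6)) atTop (𝓝 (v : L2 E6)) :=
    (continuous_subtype_val.tendsto v).comp huv
  have hsub : ∀ n m, IsDecomposition lam ((u n - u m : L2sym) : L2 E6) (w n - w m) (ξ n - ξ m) :=
    fun n m => (hdec n).sub (hdec m)
  have hΦ0 : ∀ ζ ∈ sobolev E3 (1 / 2), 0 ≤ realChargeForm β γ θ lam ζ := fun ζ hζ =>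
    (mul_nonneg hc₀.le (sobolevNormSq_nonneg _ _)).trans (hc ζ hζ)
  have hsq : Tendsto (fun nm : ℕ × ℕ => ‖u nm.1 - u nm.2‖ ^ 2) atTop (𝓝 0) := by
    have h1 := cauchySeq_iff_tendsto_dist_atTop_0.1 huv.cauchySeq
    have h2 := h1.pow 2
    rw [zero_pow two_ne_zero] at h2
    exact h2.congr fun nm => by rw [dist_eq_norm]
  -- Convergence in L² removes the term -λ‖·‖², leaving two nonnegative summands that must vanish
  -- separately.
  have hsum : Tendsto (fun nm : ℕ × ℕ => freeForm lam (w nm.1 - w nm.2) +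
      12 * Real.pi * realChargeForm β γ θ lam (ξ nm.1 - ξ nm.2)) atTop (𝓝 0) := by
    have h1 := ((Complex.continuous_re.tendsto 0).comp hq).add (hsq.const_mul lam)
    rw [Complex.zero_re, mul_zero, add_zero] at h1
    refine h1.congr fun nm => ?_
    have h2 := hsub nm.1 nm.2
    simp only [Function.comp_apply]
    rw [energyForm_eq β γ θ hl h2, energyExpr_eq β γ θ hl h2.2.1, Complex.ofReal_re, realEnergy,
      Submodule.coe_norm]
    ring
  have hfree : Tendsto (fun nm : ℕ × ℕ => freeForm lam (w nm.1 - w nm.2)) atTop (𝓝 0) :=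
    squeeze_zero (fun nm => freeForm_nonneg hl _) (fun nm => le_add_of_nonneg_right
      (mul_nonneg (by positivity) (hΦ0 _ (hsub nm.1 nm.2).2.1))) hsum
  have hS : Tendsto (fun nm : ℕ × ℕ => sobolevNormSq (1 / 2) (ξ nm.1 - ξ nm.2)) atTop (𝓝 0) := by
    have h1 := hsum.const_mul (12 * Real.pi * c₀)⁻¹
    rw [mul_zero] at h1
    refine squeeze_zero (fun nm => sobolevNormSq_nonneg _ _) (fun nm => ?_) h1
    rw [← div_eq_inv_mul, le_div_iff₀ (by positivity)]
    have h2 := mul_le_mul_of_nonneg_left (hc _ (hsub nm.1 nm.2).2.1)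
      (by positivity : 0 ≤ 12 * Real.pi)
    have h3 := freeForm_nonneg hl (w nm.1 - w nm.2)
    linarith
  obtain ⟨ξ₀, hξ₀⟩ := exists_tendsto_of_norm_sq (squeeze_zero (fun nm => by positivity)
    (fun nm => norm_sq_le_sobolevNormSq_half (hsub nm.1 nm.2).2.1) hS)
  obtain ⟨hξm, hξlim⟩ := sobolev_closed (by norm_num) (fun n => (hdec n).2.1) hξ₀ hS
  obtain ⟨w₀, hw₀⟩ : ∃ w₀, Tendsto w atTop (𝓝 w₀) := by
    have h1 := hfree.const_mul lam⁻¹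
    rw [mul_zero] at h1
    refine exists_tendsto_of_norm_sq (squeeze_zero (fun nm => by positivity) (fun nm => ?_) h1)
    rw [← div_eq_inv_mul, le_div_iff₀ hl, mul_comm]
    exact mul_norm_sq_le_freeForm hl (hsub nm.1 nm.2).1
  have hfs := measurable_freeSymbol
  obtain ⟨hev, hwlim⟩ := weighted_norm_closed (ω := fun q => freeSymbol q + lam) (by fun_prop)
    (fun q => (freeSymbol_add_pos hl q).le) hw₀
    (fun n m => (mem_sobolev_one_iff hl _).1 (hsub n m).1) hfree
  have hwm : w₀ ∈ sobolev E6 1 := by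
    obtain ⟨n, hn⟩ := hev.exists
    have h2 := (sobolev E6 1).sub_mem (hdec n).1 ((mem_sobolev_one_iff hl _).2 hn)
    rwa [sub_sub_cancel] at h2
  have hv : IsDecomposition lam v w₀ ξ₀ :=
    ⟨hwm, hξm, IsPotential.of_tendsto (fun n => (hdec n).2.2) hξ₀ (huv'.sub hw₀)⟩
  refine ⟨⟨(w₀, ξ₀), hv⟩, ?_⟩
  have hn : ∀ n, IsDecomposition lam ((u n - v : L2sym) : L2 E6) (w n - w₀) (ξ n - ξ₀) :=
    fun n => (hdec n).sub hv
  obtain ⟨C, hC⟩ := realChargeForm_le hθ β γ hl.le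
  have hΦlim : Tendsto (fun n => realChargeForm β γ θ lam (ξ n - ξ₀)) atTop (𝓝 0) := by
    have h5 := hξlim.const_mul C
    rw [mul_zero] at h5
    exact squeeze_zero (fun n => hΦ0 _ (hn n).2.1) (fun n => hC _ (hn n).2.1) h5
  have hnorm : Tendsto (fun n => ‖((u n - v : L2sym) : L2 E6)‖ ^ 2) atTop (𝓝 0) := by
    have h1 := (tendsto_iff_norm_sub_tendsto_zero.1 huv').pow 2
    rw [zero_pow two_ne_zero] at h1
    exact h1
  have hwlim' : Tendsto (fun n => freeForm lam (w n - w₀)) atTop (𝓝 0) := hwlim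
  have hE := tendsto_ofReal_combination lam (12 * Real.pi) hwlim' hnorm hΦlim
  refine hE.congr fun n => ?_
  rw [energyForm_eq β γ θ hl (hn n), energyExpr_eq β γ θ hl (hn n).2.1, realEnergy]

end EnergyForm

/-! ### Assembly. -/

theorem theorem2p1 (β γ : ℝ) (θ : ℝ → ℝ) (hθ : CutoffH1 θ) (hγ : gammaCrit < γ) :
    -- the charge form: well defined, real, coercive, bounded and closed on `H^{1/2}(ℝ³)`
    (∃ lam₀ > 0, ∃ c₀ > 0, ∀ lam > lam₀,
      (∀ ξ ∈ sobolev E3 (1 / 2),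
        ChargeFormConverges β γ θ lam ξ ∧ (chargeForm β γ θ lam ξ).im = 0 ∧
        c₀ * sobolevNormSq (1 / 2) ξ ≤ (chargeForm β γ θ lam ξ).re) ∧
      (∃ C : ℝ, ∀ ξ ∈ sobolev E3 (1 / 2),
        (chargeForm β γ θ lam ξ).re ≤ C * sobolevNormSq (1 / 2) ξ) ∧
      IsClosedForm (sobolev E3 (1 / 2)) (chargeForm β γ θ lam)) ∧
    -- the energy form: well defined, independent of `λ`, bounded from below and closed
    (∀ lam > 0, ∀ (ψ : L2sym) (w : L2 E6) (ξ : L2 E3), IsDecomposition lam ψ w ξ →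
      energyForm β γ θ lam ψ = energyExpr β γ θ lam ψ w ξ) ∧
    (∀ lam > 0, ∀ mu > 0, energyDomain lam = energyDomain mu ∧
      energyForm β γ θ lam = energyForm β γ θ mu) ∧
    (∃ m : ℝ, ∀ lam > 0, IsBoundedBelowBy (energyDomain lam) (energyForm β γ θ lam) m) ∧
    (∀ lam > 0, IsClosedForm (energyDomain lam) (energyForm β γ θ lam)) := by
  obtain ⟨lam₀, hlam₀, c₀, hc₀, hc⟩ := realChargeForm_coercive hθ β hγ
  -- The parameter λ₀ + 1 lies in the coercive range. The energy form is analysed there and carried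
  -- to every λ > 0 by independence of λ, so the lower bound is uniform.
  have h1 : lam₀ < lam₀ + 1 := by linarith
  have hl1 : 0 < lam₀ + 1 := by linarith
  refine ⟨⟨lam₀, hlam₀, c₀, hc₀, fun lam hlam => ?_⟩, fun lam hlam ψ w ξ h =>
    energyForm_eq β γ θ hlam h, fun lam hlam mu hmu => ⟨energyDomain_eq hlam hmu,
      energyForm_eq_energyForm β γ θ hlam hmu⟩, ⟨-(lam₀ + 1), fun lam hlam => ?_⟩,
      fun lam hlam => ?_⟩
  · have hl : 0 ≤ lam := (hlam₀.trans hlam).le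
    refine ⟨fun ξ hξ => ⟨chargeForm_converges hθ β γ hξ hl, ?_, ?_⟩, ?_,
      chargeForm_isClosed hθ β γ hl hc₀ (hc lam hlam)⟩
    · rw [chargeForm_eq β γ θ hξ hl, Complex.ofReal_im]
    · rw [chargeForm_eq β γ θ hξ hl, Complex.ofReal_re]
      exact hc lam hlam ξ hξ
    · obtain ⟨C, hC⟩ := realChargeForm_le hθ β γ hl
      refine ⟨C, fun ξ hξ => ?_⟩
      rw [chargeForm_eq β γ θ hξ hl, Complex.ofReal_re]
      exact hC ξ hξ
  · rw [energyDomain_eq hlam hl1, energyForm_eq_energyForm β γ θ hlam hl1]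
    exact energyForm_isBoundedBelowBy β γ θ hl1 fun ξ hξ =>
      (mul_nonneg hc₀.le (sobolevNormSq_nonneg _ _)).trans (hc _ h1 ξ hξ)
  · rw [energyDomain_eq hlam hl1, energyForm_eq_energyForm β γ θ hlam hl1]
    exact energyForm_isClosed hθ β γ hl1 hc₀ (hc _ h1)
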